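/- Let $n\ge 2$ and let $\mathbf B(n)$ be the set of binary strings of length $n$. A de Bruijn sequence of order $n$ is a binary sequence of length $2^n$ that, read cyclically, contains every string of $\mathbf B(n)$ exactly once. Let $alt(m)$ be the alternating binary string of length $m$ that ends with $0$. *The greedy sequence.* The Prefer-same sequence $\mathcal S_n$ is produced as follows: start with the seed $alt(n-1)$ and append $1$; then repeatedly append the same bit as the last one if this does not create a duplicate substring of length $n$, and otherwise the opposite bit if that does not create a duplicate substring of length $n$, until no new bit is added; finally remove the seed. *The successor rule.* For $w=w_1\cdots w_n$ put $f(w)=w_1\oplus w_2\oplus w_n$, $\mathrm{PRR}(w)=w_2\cdots w_n f(w)$ and $\hat w=\overline{w_1}w_2\cdots w_n$ (the conjugate of $w$). The run-length encoding (RLE) of $w$ is the sequence of lengths of its maximal runs, and its run-length is the number of runs. $\mathrm{PRR}$ permutes $\mathbf B(n)$, and run-length is constant on its cycles. For each cycle: - the RL-rep is the string of the cycle with the lexicographically largest RLE and, if there are two such strings, the one beginning with $1$; - the LC-rep is the string $w$ with $\mathrm{PRR}^{i+1}(w)=\sigma$, where $\sigma$ is the RL-rep and $i$ is the number of $1$s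 at the end of the RLE of $\sigma$; - the same-rep is the RL-rep if the RL-rep is special, and the LC-rep otherwise, where a string is special if it begins and ends with $0$ and has an RLE of the form $(2\,1^{2x})^y\,1^z$ with $x\ge 0$, $y\ge 2$, $z\ge 2$. Let $S(w)=\overline{f(w)}$ if $w$ or $\hat w$ is a same-rep of run-length different from $n$, and $S(w)=f(w)$ otherwise. Let $\mathcal X_n=x_1\cdots x_{2^n}$ be the sequence $\mathrm{DB}(S,0\,alt(n-1))$: starting with $w=0\,alt(n-1)$, for $i=1,\dots,2^n$ put $x_i=S(w)$ and replace $w$ by $w_2\cdots w_n x_i$. **Theorem.** For every $n\ge 2$, $\mathcal X_n$ is a de Bruijn sequence of order $n$ and $\mathcal X_n=\mathcal S_n$. Moreover, $\mathcal S_n$ can be generated in $O(n)$ time per bit using $O(n)$ space: there are a program $P$ for a unit-cost random access machine (with addition, truncated subtraction and comparison) and a constant $C$ such that for every $n\ge 2$, on input $n$, $P$ outputs exactly the bits of $\mathcal S_n$ in order and halts, with at most $Cn$ steps before the first bit, between consecutive bits, and between the last bit and halting, and using a fixed number of variables and of arrays with at most $Cn$ cells each, all of whose entries are integers less than $Cn$.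 -/

import Mathlib

/-! Binary strings are lists `w = [w₁, …, wₙ]` of booleans (`true` is the bit 1, `false` the bit 0);
`^^` is addition modulo 2. -/

namespace PrefSame

/-! ### Run-length encodings and the pure run-length register -/

/-- The run-length encoding: the lengths of the maximal runs, from left to right. -/
def rle (w : List Bool) : List ℕ := (w.splitBy (· == ·)).map List.length

/-- The feedback `w₁ ⊕ w₂ ⊕ wₙ` (the default value is never used when `n ≥ 2`). -/
def prrFeedback (w : List Bool) : Bool :=
  (w.getD 0 false) ^^ (w.getD 1 false) ^^ (w.getD (w.length - 1) false)

/-- The feedback shift register `w₁w₂⋯wₙ ↦ w₂⋯wₙ g(w₁w₂⋯wₙ)`. -/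
def shiftRegister (g : List Bool → Bool) (w : List Bool) : List Bool := w.tail ++ [g w]

/-- The pure run-length register `PRR`. -/
def prr : List Bool → List Bool := shiftRegister prrFeedback

/-- The conjugate `w̄₁w₂⋯wₙ` of `w₁w₂⋯wₙ`. -/
def conjugate : List Bool → List Bool
  | [] => []
  | b :: w => (!b) :: w

/-- `v` lies on the cycle of `w` under `PRR`. -/
def OnCycle (w v : List Bool) : Prop := ∃ k : ℕ, prr^[k] w = v

/-! ### Representatives of the cycles of `PRR` -/

/-- `w` is the string of its cycle with the lexicographically largest run-length encoding; if two
strings of the cycle have that encoding, it is the one that begins with 1. -/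
def IsRLRep (w : List Bool) : Prop :=
  ∀ v, OnCycle w v → v = w ∨ rle v < rle w ∨ (rle v = rle w ∧ w.head? = some true)

/-- The number `i` such that the run-length encoding of `w` ends with exactly `i` ones. -/
def trailingOnes (w : List Bool) : ℕ := ((rle w).reverse.takeWhile (· == 1)).length

/-- `w` is the LC-rep of the cycle whose RL-rep is `σ`: if the run-length encoding of `σ` ends with
exactly `i` ones, then `PRR^(i+1) w = σ`. -/
def IsLCRepFor (σ w : List Bool) : Prop := prr^[trailingOnes σ + 1] w = σ

/-- The set `SP`: strings that begin and end with 0 and have a run-length encoding of the form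
`(2 1^(2x))^y 1^z` with `x ≥ 0`, `y ≥ 2` and `z ≥ 2`. -/
def IsSpecial (w : List Bool) : Prop :=
  w.head? = some false ∧ w.getLast? = some false ∧
    ∃ x y z : ℕ, 2 ≤ y ∧ 2 ≤ z ∧
      rle w = (List.replicate y (2 :: List.replicate (2 * x) 1)).flatten ++ List.replicate z 1

/-- `w` is the same-rep of its cycle: the RL-rep `σ` if `σ` is special, the LC-rep otherwise. -/
def IsSameRep (w : List Bool) : Prop :=
  ∃ σ, OnCycle w σ ∧ IsRLRep σ ∧
    ((IsSpecial σ ∧ w = σ) ∨ (¬ IsSpecial σ ∧ IsLCRepFor σ w))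

/-- The set of all same-reps, without the representative of the cycle of run-length `n`. -/
def sameReps : Set (List Bool) := {w | IsSameRep w ∧ (rle w).length ≠ w.length}

open Classical in
/-- The successor rule `S`: complement the feedback `w₁ ⊕ w₂ ⊕ wₙ` exactly when `w` or its conjugate
is in `sameReps`. -/
noncomputable def succS (w : List Bool) : Bool :=
  if w ∈ sameReps ∨ conjugate w ∈ sameReps then !(prrFeedback w) else prrFeedback w

/-! ### The two sequences -/

/-- The first `k` bits produced by the feedback function `g` from the seed `w`. -/
def bitsFrom (g : List Bool → Bool) : ℕ → List Bool → List Bool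
  | 0, _ => []
  | k + 1, w => g w :: bitsFrom g k (shiftRegister g w)

/-- `DB(g, w)`: the `2^n` bits produced by `g` from the seed `w` of length `n`. -/
def DB (g : List Bool → Bool) (w : List Bool) : List Bool := bitsFrom g (2 ^ w.length) w

/-- The alternating string of length `n` that ends with 0. -/
def alt : ℕ → List Bool
  | 0 => []
  | n + 1 => decide (n % 2 = 1) :: alt n

/-- The sequence `X_n = DB(S, 0 alt(n-1))`. -/
noncomputable def seqX (n : ℕ) : List Bool := DB succS (false :: alt (n - 1))

/-- Appending `b` to `T` creates a duplicate substring of length `n`: the last `n` bits of `T b`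
already occur in `T`. -/
def CreatesDuplicate (n : ℕ) (T : List Bool) (b : Bool) : Prop := (T ++ [b]).rtake n <:+: T

instance (n : ℕ) (T : List Bool) (b : Bool) : Decidable (CreatesDuplicate n T b) :=
  inferInstanceAs (Decidable (_ <:+: _))

/-- One round of the Prefer-same construction: append the same bit as the last if it does not create
a duplicate; otherwise append the opposite bit if it does not create a duplicate; otherwise
append nothing. -/
def preferSameStep (n : ℕ) (T : List Bool) : List Bool :=
  if ¬ CreatesDuplicate n T (T.getLastD false) then T ++ [T.getLastD false]
  else if ¬ CreatesDuplicate n T (!(T.getLastD false)) then T ++ [!(T.getLastD false)]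
  else T

/-- The string, seed included, on which the Prefer-same construction stops. It starts from the seed
`alt(n-1)` with 1 appended; after `2^n` rounds no new bit is added any more, as
`preferSameStep_preferSameRaw` shows. -/
def preferSameRaw (n : ℕ) : List Bool := (preferSameStep n)^[2 ^ n] (alt (n - 1) ++ [true])

/-- The greedy Prefer-same sequence `S_n`: the string above with the seed removed. -/
def preferSame (n : ℕ) : List Bool := (preferSameRaw n).drop (n - 1)

/-- `s` is a de Bruijn sequence of order `n`: it has length `2^n`, and read cyclically it contains
every string of length `n` at exactly one position. -/
def IsDeBruijn (n : ℕ) (s : List Bool) : Prop :=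
  s.length = 2 ^ n ∧
    ∀ w : List Bool, w.length = n → ∃! i : ℕ, i < 2 ^ n ∧ (s.rotate i).take n = w

theorem alt_length (n : ℕ) : (alt n).length = n := by
  induction n with
  | zero => rfl
  | succ n ih => simp [alt, ih]

/-- The strings of length `n` occurring in `T` are pairwise distinct. -/
def NoRepeat (n : ℕ) (T : List Bool) : Prop :=
  n ≤ T.length ∧ ∀ i j, i + n ≤ T.length → j + n ≤ T.length →
    (T.drop i).take n = (T.drop j).take n → i = j

theorem noRepeat_append {n : ℕ} {T : List Bool} {b : Bool} (h : NoRepeat n T)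
    (hb : ¬ CreatesDuplicate n T b) : NoRepeat n (T ++ [b]) := by
  obtain ⟨hl, hT⟩ := h
  have key : ∀ i, i + n ≤ T.length → ((T ++ [b]).drop i).take n = (T.drop i).take n := by
    intro i hi
    rw [List.drop_append_of_le_length (by omega), List.take_append_of_le_length (by simp; omega)]
  have hne : ∀ i, i + n ≤ T.length →
      ((T ++ [b]).drop i).take n ≠ ((T ++ [b]).drop (T.length + 1 - n)).take n := by
    intro i hi he
    apply hb
    have h1 : (T ++ [b]).rtake n = ((T ++ [b]).drop (T.length + 1 - n)).take n := by
      rw [List.rtake, List.take_of_length_le (by simp; omega)]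
      simp
    rw [CreatesDuplicate, h1, ← he, key i hi]
    exact (List.take_prefix _ _).isInfix.trans (List.drop_suffix _ _).isInfix
  refine ⟨by simp; omega, fun i j hi hj hij => ?_⟩
  simp only [List.length_append, List.length_singleton] at hi hj
  by_cases hi' : i + n ≤ T.length <;> by_cases hj' : j + n ≤ T.length
  · exact hT i j hi' hj' (by rwa [key i hi', key j hj'] at hij)
  · obtain rfl : j = T.length + 1 - n := by omega
    exact absurd hij (hne i hi')
  · obtain rfl : i = T.length + 1 - n := by omega
    exact absurd hij.symm (hne j hj')
  · omega

theorem noRepeat_length {n : ℕ} {T : List Bool} (h : NoRepeat n T) :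
    T.length < n + 2 ^ n := by
  by_contra! hc
  let F : Fin (2 ^ n + 1) → List.Vector Bool n := fun i =>
    ⟨(T.drop i).take n, by have := i.2; simp; omega⟩
  have hF : Function.Injective F := fun i j hij => Fin.ext <|
    h.2 i j (by have := i.2; omega) (by have := j.2; omega) (congrArg Subtype.val hij)
  have := Fintype.card_le_of_injective F hF
  simp at this

/-- After `2^n` rounds the Prefer-same construction adds no new bit. -/
theorem preferSameStep_preferSameRaw (n : ℕ) (hn : 1 ≤ n) :
    preferSameStep n (preferSameRaw n) = preferSameRaw n := by
  have hstep : ∀ T, NoRepeat n T → preferSameStep n T = T ∨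
      (NoRepeat n (preferSameStep n T) ∧ (preferSameStep n T).length = T.length + 1) := by
    intro T hT
    unfold preferSameStep
    by_cases h1 : CreatesDuplicate n T (T.getLastD false)
    · by_cases h2 : CreatesDuplicate n T (!(T.getLastD false))
      · left; simp only [h1, h2, not_true_eq_false, if_false]
      · right
        simp only [h1, h2, not_true_eq_false, not_false_eq_true, if_false, if_true]
        exact ⟨noRepeat_append hT h2, by simp⟩
    · right
      simp only [h1, not_false_eq_true, if_true]
      exact ⟨noRepeat_append hT h1, by simp⟩
  have h0 : NoRepeat n (alt (n - 1) ++ [true]) := by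
    have hl : (alt (n - 1) ++ [true]).length = n := by simp [alt_length]; omega
    exact ⟨hl.ge, fun i j hi hj _ => by omega⟩
  have hall : ∀ k, NoRepeat n ((preferSameStep n)^[k] (alt (n - 1) ++ [true])) ∧
      (preferSameStep n ((preferSameStep n)^[k] (alt (n - 1) ++ [true])) =
          (preferSameStep n)^[k] (alt (n - 1) ++ [true]) ∨
        n + k ≤ ((preferSameStep n)^[k] (alt (n - 1) ++ [true])).length) := by
    intro k
    induction k with
    | zero => exact ⟨h0, Or.inr (by simpa using h0.1)⟩
    | succ k ih =>
      obtain ⟨hk, hk'⟩ := ih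
      rw [Function.iterate_succ_apply']
      rcases hstep _ hk with h | ⟨h, hlen⟩
      · rw [h]; exact ⟨hk, Or.inl h⟩
      · refine ⟨h, ?_⟩
        rcases hk' with h' | h'
        · left; rw [h', h']
        · right; omega
  obtain ⟨h1, h2⟩ := hall (2 ^ n)
  rcases h2 with h2 | h2
  · exact h2
  · exact absurd (noRepeat_length h1) (by omega)

/-! ### A unit-cost random access machine

Programs are structured programs over word variables `var x` and word arrays `arr a`, with a clock
and with output. A program mentions finitely many variables and arrays. With the word bound `B` below, it
uses at most a constant times `B` cells; a cell that has never been written holds 0. -/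

namespace Ram

/-- Machine state: variables, arrays, number of steps so far, and the bits output so far, each with
the time at which it was output. -/
structure State where
  var : ℕ → ℕ
  arr : ℕ → ℕ → ℕ
  clock : ℕ
  out : List (Bool × ℕ)

/-- The initial state on input `n`: variable 0 holds `n`, everything else is 0. -/
def State.init (n : ℕ) : State where
  var := Function.update (fun _ => 0) 0 n
  arr := fun _ _ => 0
  clock := 0
  out := []

/-- Let `t` steps pass. -/
def State.tick (t : ℕ) (s : State) : State := { s with clock := s.clock + t }

/-- Expressions: constants, variables, array cells, sum, truncated difference, and the
0/1-valued comparisons. -/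
inductive Expr where
  | const (k : ℕ)
  | var (x : ℕ)
  | get (a : ℕ) (i : Expr)
  | add (e f : Expr)
  | sub (e f : Expr)
  | lt (e f : Expr)
  | eq (e f : Expr)

/-- The value of an expression. -/
def Expr.eval (s : State) : Expr → ℕ
  | const k => k
  | var x => s.var x
  | get a i => s.arr a (i.eval s)
  | add e f => e.eval s + f.eval s
  | sub e f => e.eval s - f.eval s
  | lt e f => if e.eval s < f.eval s then 1 else 0
  | eq e f => if e.eval s = f.eval s then 1 else 0

/-- The number of steps that evaluating an expression takes: one for each operation. -/
def Expr.cost : Expr → ℕ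
  | const _ => 1
  | var _ => 1
  | get _ i => i.cost + 1
  | add e f => e.cost + f.cost + 1
  | sub e f => e.cost + f.cost + 1
  | lt e f => e.cost + f.cost + 1
  | eq e f => e.cost + f.cost + 1

/-- Commands: do nothing, `x := e`, `a[i] := e`, output a bit (1 iff `e ≠ 0`), composition,
`if e ≠ 0 then c else d`, and `while e ≠ 0 do c`. -/
inductive Cmd where
  | skip
  | assign (x : ℕ) (e : Expr)
  | store (a : ℕ) (i e : Expr)
  | output (e : Expr)
  | seq (c d : Cmd)
  | ite (e : Expr) (c d : Cmd)
  | loop (e : Expr) (c : Cmd)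

/-- `Exec B c s s'`: started in state `s`, the command `c` halts in state `s'`, every array cell
written having an index less than `B` and every word written to a variable or a cell being less than
`B`. A command that violates these bounds has no execution. -/
inductive Exec (B : ℕ) : Cmd → State → State → Prop
  | skip (s : State) : Exec B .skip s (s.tick 1)
  | assign (s : State) (x : ℕ) (e : Expr) (he : e.eval s < B) :
      Exec B (.assign x e) s
        { s.tick (e.cost + 1) with var := Function.update s.var x (e.eval s) }
  | store (s : State) (a : ℕ) (i e : Expr) (hi : i.eval s < B) (he : e.eval s < B) :
      Exec B (.store a i e) s
        { s.tick (i.cost + e.cost + 1) with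
          arr := Function.update s.arr a (Function.update (s.arr a) (i.eval s) (e.eval s)) }
  | output (s : State) (e : Expr) :
      Exec B (.output e) s
        { s.tick (e.cost + 1) with
          out := s.out ++ [(decide (e.eval s ≠ 0), s.clock + (e.cost + 1))] }
  | seq (s s' s'' : State) (c d : Cmd) (hc : Exec B c s s') (hd : Exec B d s' s'') :
      Exec B (.seq c d) s s''
  | ite_true (s s' : State) (e : Expr) (c d : Cmd) (he : e.eval s ≠ 0)
      (hc : Exec B c (s.tick (e.cost + 1)) s') : Exec B (.ite e c d) s s'
  | ite_false (s s' : State) (e : Expr) (c d : Cmd) (he : e.eval s = 0)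
      (hd : Exec B d (s.tick (e.cost + 1)) s') : Exec B (.ite e c d) s s'
  | loop_true (s s' s'' : State) (e : Expr) (c : Cmd) (he : e.eval s ≠ 0)
      (hc : Exec B c (s.tick (e.cost + 1)) s') (hl : Exec B (.loop e c) s' s'') :
      Exec B (.loop e c) s s''
  | loop_false (s : State) (e : Expr) (c : Cmd) (he : e.eval s = 0) :
      Exec B (.loop e c) s (s.tick (e.cost + 1))

/-- On input `n` the program `P` outputs exactly the bits of `s`, in order, and halts; at most `d`
steps pass before the first bit, between consecutive bits, and from the last bit to the end; and
only array cells with index less than `B` are written, with words less than `B`. -/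
def Generates (P : Cmd) (n d B : ℕ) (s : List Bool) : Prop :=
  ∃ final : State, Exec B P (State.init n) final ∧
    final.out.map Prod.fst = s ∧
    List.IsChain (fun t t' => t' ≤ t + d) (0 :: (final.out.map Prod.snd ++ [final.clock]))

end Ram

end PrefSame

/-! A string is determined by its first bit h and the word d of differences of adjacent bits (`dec h
d`). In these coordinates PRR moves the first letter c of d to its end and replaces h by h ⊕ c,
conjugation complements h and the first letter of d, and a larger run-length encoding means a
lexicographically smaller d. So a cycle of PRR belongs to a necklace D, the least rotation of its
words d. If the shortest period of D has odd parity (`IsOdd`), the cycle contains both (0, D) and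
(1, D); otherwise these lie on different cycles.

If D = γ01^i, then the LC-rep has the word 01^iγ and reaches D in i + 1 steps. Its conjugate lies on
a cycle with necklace γ1^(i+1) (`IsNeck.flip_last`), which has one zero less. The representatives
thus turn the cycles into a tree whose root is the cycle with d = 1^(n-1). The rule S exchanges the
successors of each representative and of its conjugate, which merges the cycles along the edges of
the tree (`reach_of_join`). Hence S is a single cycle through all strings, and X_n is a de Bruijn
sequence.

For the comparison with the greedy sequence, `key` assigns to each state an element of words × ℕ,
ordered lexicographically, such that (1) it never decreases along S, except possibly at the step
from the seed (`stringKey_le_stepS`); (2) if S appends a bit different from the last one, the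
conjugate has a strictly smaller key (`stringKey_conjugate_lt`). In the situation of (2) the
conjugate occurs earlier by (1). It was then followed by the same bit, so appending the same bit
again creates a duplicate and the greedy rule must take the opposite one. If S appends the same bit,
the resulting string is new because S is a single cycle. So both rules agree at every step.

The key follows the order in which S visits a cycle. The cycle is entered just behind its LC-rep,
and the states with word 1^mB on this first pass towards (1, D), where D = B1^m, get the word B0^m
instead of D: the gap between B0^m and B10^(m-1) has room for the subtrees entered in between. The
other states have first component D, and the second component puts the pass towards (0, D), which
exists if D is odd, before the last pass towards (1, D). A cycle without the state (1, D) has no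
children, and its states share one key (`leafKey`), inserted right after the state of the parent
from which it is entered. For the LC-rep this state lies on the parent's pass with first bit 0. Only
if D = (01^f)^y1^e does the flip of a second zero, the first one of D, also lead to the necklace of
the parent (`IsNeck.flip_eq`), and if f is odd this happens on the earlier pass with first bit 1.
These are the special strings, for which the RL-rep must replace the LC-rep.

For the time bound, S is evaluated by two linear tests, one for necklaces and their least period
(`PreNeck`) and one for the special form (`ZerosAt`), applied to only two rotations of one word
(`repState_iff_rotate`). The program stops when the seed reappears, which is after exactly 2^n bits.
-/

namespace PrefSame

open List

/-! ### Lexicographic order on words and necklaces -/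

/-- The word `1^k`. -/
abbrev ones (k : ℕ) : List Bool := List.replicate k true

/-- The word `0^k`. -/
abbrev zeros (k : ℕ) : List Bool := List.replicate k false

theorem append_lt_append_iff {a b c d : List Bool} (h : a.length = b.length) :
    a ++ c < b ++ d ↔ a < b ∨ a = b ∧ c < d := by
  induction a generalizing b with
  | nil =>
    obtain rfl : b = [] := by simpa using h.symm
    simp
  | cons x a ih =>
    cases b with
    | nil => simp at h
    | cons y b =>
      have := ih (b := b) (by simpa using h)
      simp only [List.cons_append, List.cons_lt_cons_iff, this, List.cons.injEq]
      tauto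

theorem append_lt_append_of_lt {a b : List Bool} (h : a.length = b.length) (hab : a < b)
    (c d : List Bool) : a ++ c < b ++ d :=
  (append_lt_append_iff h).2 (Or.inl hab)

theorem append_lt_append_left_iff (a : List Bool) {c d : List Bool} :
    a ++ c < a ++ d ↔ c < d := by
  simp [append_lt_append_iff rfl]

theorem append_le_append_left_iff (a : List Bool) {c d : List Bool} :
    a ++ c ≤ a ++ d ↔ c ≤ d := by
  rw [← not_lt, ← not_lt, append_lt_append_left_iff]

theorem le_of_append_le_append {a b c d : List Bool} (h : a.length = b.length)
    (hab : a ++ c ≤ b ++ d) : a ≤ b := by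
  by_contra hc
  exact absurd hab (not_le.2 (append_lt_append_of_lt h.symm (not_le.1 hc) _ _))

theorem false_cons_lt_true_cons (a b : List Bool) : false :: a < true :: b := by
  simp [List.cons_lt_cons_iff]

theorem eq_ones_of_count {y : List Bool} {k : ℕ} (hl : y.length = k) (hc : y.count true = k) :
    y = ones k := by
  rw [ones, List.eq_replicate_iff]
  refine ⟨hl, fun b hb => ?_⟩
  exact (List.count_eq_length.1 (hc.trans hl.symm) b hb).symm

theorem count_false_add_count_true (y : List Bool) :
    y.count false + y.count true = y.length := by
  have := List.length_eq_countP_add_countP (l := y) (p := (· == true))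
  rw [this, add_comm]
  congr 1
  apply List.countP_congr
  intro x _
  cases x <;> simp

/-- A word with a single zero is lexicographically smallest when the zero comes first. -/
theorem false_cons_ones_le {y : List Bool} {k : ℕ} (hl : y.length = k + 1)
    (hc : y.count true = k) : false :: ones k ≤ y := by
  cases y with
  | nil => simp at hl
  | cons b y =>
    cases b with
    | true => exact (false_cons_lt_true_cons _ _).le
    | false =>
      rw [eq_ones_of_count (y := y) (k := k) (by simpa using hl) (by simpa using hc)]

theorem exists_split_length {U : List Bool} {k : ℕ} (h : k ≤ U.length) :
    ∃ X Y, U = X ++ Y ∧ X.length = k :=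
  ⟨U.take k, U.drop k, by simp, by simp [h]⟩

/-- A word with the weight of `γ1^k` and with a prefix that is at least `γ` is at least `γ1^k`. -/
theorem append_ones_le {γ X Y : List Bool} {k : ℕ} (hl : X.length = γ.length)
    (hY : Y.length = k) (h : γ ≤ X) (hc : (X ++ Y).count true = (γ ++ ones k).count true) :
    γ ++ ones k ≤ X ++ Y := by
  rcases h.lt_or_eq with h | rfl
  · exact (append_lt_append_of_lt hl.symm h _ _).le
  · rw [eq_ones_of_count hY]
    simpa using hc

/-- A word above γ01^i has a prefix that is at least γ; if it is γ itself, the weight forces ones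
everywhere behind it. So nothing of this weight lies strictly between the necklace of a cycle and
that of its parent. -/
theorem append_ones_le_of_lt {γ U : List Bool} {i : ℕ}
    (hl : U.length = γ.length + i + 1) (h : γ ++ false :: ones i < U)
    (hc : U.count true = (γ ++ ones (i + 1)).count true) : γ ++ ones (i + 1) ≤ U := by
  obtain ⟨X, Y, rfl, hX⟩ := exists_split_length (U := U) (k := γ.length) (by omega)
  exact append_ones_le hX (by simp at hl; omega) (le_of_append_le_append hX.symm h.le) hc

/-- With equal weights the comparison is decided inside β: equality there would leave only ones for
the rest of U. This and the next lemma permit comparisons with the lowered words B0^m of the key. -/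
theorem lt_append_zeros_of_lt_append_ones {U β : List Bool} {m : ℕ}
    (hl : U.length = β.length + m) (h : U < β ++ ones m)
    (hc : U.count true = (β ++ ones m).count true) : U < β ++ zeros m := by
  obtain ⟨X, Y, rfl, hX⟩ := exists_split_length (U := U) (k := β.length) (by omega)
  rw [append_lt_append_iff hX] at h ⊢
  rcases h with h | ⟨rfl, h⟩
  · exact Or.inl h
  · rw [eq_ones_of_count (y := Y) (k := m) (by simp at hl; omega) (by simpa using hc)] at h
    exact absurd h (lt_irrefl _)

theorem lt_append_zeros_of_lt_append_false {U β : List Bool} {m : ℕ}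
    (hl : U.length = β.length + m + 1) (h : U < β ++ false :: ones m)
    (hc : U.count true = (β ++ false :: ones m).count true) : U < β ++ zeros (m + 1) := by
  obtain ⟨X, Y, rfl, hX⟩ := exists_split_length (U := U) (k := β.length) (by omega)
  rw [append_lt_append_iff hX] at h ⊢
  rcases h with h | ⟨rfl, h⟩
  · exact Or.inl h
  · exact absurd h (not_lt.2 (false_cons_ones_le (by simp at hl; omega) (by simpa using hc)))

theorem zeros_le {y : List Bool} {k : ℕ} (h : y.length = k) : zeros k ≤ y := by
  induction k generalizing y with
  | zero => simp at h; subst h; exact le_rfl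
  | succ k ih =>
    cases y with
    | nil => simp at h
    | cons b y =>
      cases b with
      | true => exact (false_cons_lt_true_cons _ _).le
      | false =>
        have := ih (y := y) (by simpa using h)
        rw [zeros, List.replicate_succ]
        exact (append_le_append_left_iff [false]).2 this

/-- `D` is lexicographically least among its rotations. -/
def IsNeck (D : List Bool) : Prop := ∀ E, D ~r E → D ≤ E

theorem isRotated_iff_append {D E : List Bool} :
    D ~r E ↔ ∃ A B, D = A ++ B ∧ E = B ++ A := by
  constructor
  · intro h
    obtain ⟨k, hk, rfl⟩ := List.isRotated_iff_mod.1 h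
    exact ⟨D.take k, D.drop k, by simp, List.rotate_eq_drop_append_take hk⟩
  · rintro ⟨A, B, rfl, rfl⟩
    exact List.isRotated_append

theorem IsNeck.le_append {A B : List Bool} (h : IsNeck (A ++ B)) : A ++ B ≤ B ++ A :=
  h _ List.isRotated_append

theorem IsNeck.eq_of_isRotated {D E : List Bool} (hD : IsNeck D) (hE : IsNeck E) (h : D ~r E) :
    D = E :=
  le_antisymm (hD E h) (hE D h.symm)

theorem isNeck_ones (k : ℕ) : IsNeck (ones k) := by
  intro E h
  have : E = ones k := by
    rw [ones, List.eq_replicate_iff]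
    refine ⟨by simpa using h.perm.length_eq.symm, fun b hb => ?_⟩
    exact List.eq_of_mem_replicate (h.perm.mem_iff.2 hb)
  rw [this]

theorem exists_isNeck (d : List Bool) : ∃ D, d ~r D ∧ IsNeck D := by
  have hfin : {E | d ~r E}.Finite :=
    (List.finite_toSet d.cyclicPermutations).subset fun E hE => by
      simpa using List.mem_cyclicPermutations_iff.2 (List.IsRotated.symm hE)
  obtain ⟨D, hD, hmin⟩ := Set.exists_min_image _ id hfin ⟨d, List.IsRotated.refl d⟩
  exact ⟨D, hD, fun E hE => hmin E (List.IsRotated.trans hD hE)⟩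

theorem IsNeck.eq_ones_of_true {D : List Bool} (h : IsNeck (true :: D)) :
    D = ones D.length := by
  rw [ones, List.eq_replicate_iff]
  refine ⟨rfl, fun b hb => ?_⟩
  cases b with
  | true => rfl
  | false =>
    obtain ⟨A, B, rfl⟩ := List.append_of_mem hb
    have := h.le_append (A := true :: A) (B := false :: B)
    exact absurd this (not_le.2 (false_cons_lt_true_cons _ _))

theorem IsNeck.head_of_mem {D : List Bool} (h : IsNeck D) (hf : false ∈ D) :
    ∃ E, D = false :: E := by
  cases D with
  | nil => simp at hf
  | cons b D =>
    cases b with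
    | false => exact ⟨D, rfl⟩
    | true =>
      rw [h.eq_ones_of_true] at hf
      simp at hf

theorem eq_ones_or_exists_last_false (D : List Bool) :
    D = ones D.length ∨ ∃ γ i, D = γ ++ false :: ones i := by
  induction D using List.reverseRecOn with
  | nil => simp
  | append_singleton D b ih =>
    cases b with
    | false => exact Or.inr ⟨D, 0, by simp⟩
    | true =>
      rcases ih with ih | ⟨γ, i, ih⟩
      · left
        rw [List.length_append, ones, List.replicate_add, ← ones, ← ih]
        rfl
      · right
        refine ⟨γ, i + 1, ?_⟩
        rw [ih, ones, ones, List.replicate_succ']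
        simp

/-- Changing the last zero of a necklace to a one gives a necklace. -/
theorem IsNeck.flip_last {β : List Bool} {i : ℕ} (h : IsNeck (β ++ false :: ones i)) :
    IsNeck (β ++ ones (i + 1)) := by
  intro E hE
  obtain ⟨A, B, hAB, rfl⟩ := isRotated_iff_append.1 hE
  rcases List.append_eq_append_iff.1 hAB with ⟨C, rfl, hC⟩ | ⟨C, rfl, rfl⟩
  · -- here the rotation begins inside the block of ones
    cases B with
    | nil => simp at hAB; simp [hAB]
    | cons b B =>
      have hb : b = true := by
        have : b ∈ ones (i + 1) := by rw [hC]; simp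
        exact List.eq_of_mem_replicate this
      subst hb
      cases β with
      | nil =>
        have := isNeck_ones (i + 1) (true :: B ++ C) (by
          rw [hC]; exact List.isRotated_append)
        simpa using this
      | cons c β =>
        obtain ⟨D, hD⟩ := h.head_of_mem (by simp)
        simp at hD
        obtain ⟨rfl, -⟩ := hD
        exact (false_cons_lt_true_cons _ _).le
  · cases A with
    | nil => simp
    | cons a A =>
      have h1 : a :: A ++ (C ++ false :: ones i) ≤ C ++ false :: ones i ++ a :: A := by
        have h' : IsNeck (a :: A ++ (C ++ false :: ones i)) := by simpa using h
        exact h'.le_append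
      -- The first |C| + 1 letters decide: they are not affected by the change of the last zero in
      -- the rotation's counterpart, and X ≤ C0 < C1.
      obtain ⟨X, Y, hXY, hX⟩ := exists_split_length (U := a :: A ++ C) (k := C.length + 1)
        (by simp)
      have h2 : X ≤ C ++ [false] := by
        apply le_of_append_le_append (c := Y ++ false :: ones i) (d := ones i ++ a :: A)
          (by simp [hX])
        calc X ++ (Y ++ false :: ones i) = a :: A ++ (C ++ false :: ones i) := by
              rw [← List.append_assoc, ← hXY]; simp
          _ ≤ _ := h1
          _ = _ := by simp
      have h3 : X < C ++ [true] := h2.trans_lt (by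
        rw [append_lt_append_left_iff]; exact false_cons_lt_true_cons _ _)
      have h4 := append_lt_append_of_lt (by simp [hX]) h3 (Y ++ ones (i + 1)) (ones i ++ a :: A)
      refine le_of_lt ?_
      calc a :: A ++ C ++ ones (i + 1) = X ++ (Y ++ ones (i + 1)) := by
            rw [← List.append_assoc, ← hXY]
        _ < _ := h4
        _ = _ := by simp [ones, List.replicate_succ]

/-- Changing a zero to a one strictly increases the least rotation. -/
theorem lt_of_flip {x D D' : List Bool} (hD : IsNeck D) (h : D ~r false :: x)
    (h' : true :: x ~r D') : D < D' := by
  obtain ⟨A, B, hAB, rfl⟩ := isRotated_iff_append.1 h'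
  cases A with
  | nil =>
    simp at hAB
    subst hAB
    exact (hD _ h).trans_lt (by simpa using false_cons_lt_true_cons x x)
  | cons a A =>
    simp at hAB
    obtain ⟨rfl, rfl⟩ := hAB
    have : D ≤ B ++ false :: A := hD _ (h.trans (isRotated_iff_append.2 ⟨false :: A, B, by simp, rfl⟩))
    exact this.trans_lt ((append_lt_append_left_iff B).2 (false_cons_lt_true_cons _ _))

/-- A word that commutes with `01^f` is one of its powers. -/
theorem eq_flatten_of_commute (f : ℕ) (γ : List Bool)
    (h : false :: ones f ++ γ = γ ++ false :: ones f) :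
    ∃ y, γ = (List.replicate y (false :: ones f)).flatten := by
  induction hn : γ.length using Nat.strong_induction_on generalizing γ with
  | _ n ih =>
    rcases List.append_eq_append_iff.1 h with ⟨δ, rfl, hδ⟩ | ⟨δ, hδ, hδ'⟩
    · obtain ⟨y, hy⟩ := ih δ.length (by simp at hn; omega) δ (by simpa using hδ) rfl
      refine ⟨y + 1, ?_⟩
      rw [List.replicate_succ, List.flatten_cons, ← hy]
    · cases γ with
      | nil => exact ⟨0, by simp⟩
      | cons c γ =>
        cases δ with
        | nil =>
          simp only [List.append_nil] at hδ
          exact ⟨1, by simp [hδ]⟩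
        | cons e δ =>
          -- Here 01^f splits into `c :: γ` and `e :: δ`; the letter `e` lies among the ones, but
          -- commutation makes it the initial zero.
          exfalso
          have h1 : e = false := by simp at hδ'; exact hδ'.1
          have h2 : e ∈ ones f := by
            simp only [List.cons_append, List.cons.injEq] at hδ
            rw [hδ.2]; simp
          simp [h1] at h2

/-- A necklace `γ01^i` that is a rotation of `γ1^e01^f` with `e ≥ 1` is `01^fγ1^e`. -/
theorem IsNeck.eq_of_isRotated_append {γ : List Bool} {e f : ℕ} (he : 1 ≤ e)
    (hD : IsNeck (γ ++ false :: ones (f + e))) (hγ : γ ≠ [])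
    (h : γ ++ ones e ++ false :: ones f ~r γ ++ false :: ones (f + e)) :
    γ ++ false :: ones (f + e) = false :: ones f ++ γ ++ ones e := by
  obtain ⟨e, rfl⟩ : ∃ k, e = k + 1 := ⟨e - 1, by omega⟩
  obtain ⟨Z, hZ⟩ := hD.head_of_mem (by simp)
  have hne : γ ++ ones (e + 1) ++ false :: ones f ≠ γ ++ false :: ones (f + (e + 1)) := by
    simp [ones, List.replicate_succ]
  obtain ⟨A, B, hAB, hBA⟩ := isRotated_iff_append.1 h
  rw [List.append_assoc] at hAB
  rcases List.append_eq_append_iff.1 hAB with ⟨A', rfl, hA'⟩ | ⟨B', rfl, rfl⟩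
  · rcases List.append_eq_append_iff.1 hA' with ⟨A₂, rfl, hA₂⟩ | ⟨B₂, hB₂, rfl⟩
    · cases A₂ with
      | nil =>
        simp only [List.nil_append] at hA₂
        rw [hBA, ← hA₂]; simp
      | cons a A₂ =>
        cases B with
        | nil => rw [hBA] at hne; simp at hne hA₂; simp [hA₂] at hne
        | cons b B =>
          have : b ∈ ones f := by
            simp only [List.cons_append, List.cons.injEq] at hA₂; rw [hA₂.2]; simp
          have hb := List.eq_of_mem_replicate this
          rw [hBA, hb] at hZ
          simp at hZ
    · cases B₂ with
      | nil =>
        simp only [List.nil_append] at hBA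
        simp only [List.append_nil] at hB₂
        rw [hBA, hB₂]; simp
      | cons b B₂ =>
        have : b ∈ ones (e + 1) := by rw [hB₂]; simp
        have hb := List.eq_of_mem_replicate this
        rw [hBA, hb] at hZ
        simp at hZ
  · cases A with
    | nil =>
      rw [hBA] at hne; simp at hne
    | cons a A =>
      exfalso
      have ha : a = false := by simp at hZ; exact hZ.1
      subst ha
      cases B' with
      | nil =>
        simp only [List.nil_append] at hBA
        rw [hBA] at hZ
        simp [ones, List.replicate_succ] at hZ
      | cons b B' =>
        -- compare the two factorizations of the necklace from the right
        have key : false :: A ++ (b :: B' ++ false :: ones (f + (e + 1))) =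
            b :: B' ++ (ones (e + 1) ++ false :: ones f) ++ false :: A := by
          rw [← hBA]; simp
        have hlen : ∃ A'', false :: A = A'' ++ false :: ones (f + (e + 1)) := by
          have h2 : (false :: A ++ (b :: B')) ++ false :: ones (f + (e + 1)) =
            (b :: B' ++ (ones (e + 1) ++ false :: ones f)) ++ false :: A := by
            rw [← key]; simp
          rcases List.append_eq_append_iff.1 h2 with ⟨C, hC, hC'⟩ | ⟨C, hC, hC'⟩
          · cases C with
            | nil => exact ⟨[], by simpa using hC'.symm⟩
            | cons c C =>
              have : false ∈ ones (f + (e + 1)) := by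
                simp only [List.cons_append, List.cons.injEq] at hC'
                rw [hC'.2]; simp
              simp at this
          · exact ⟨C, hC'⟩
        obtain ⟨A'', hA''⟩ := hlen
        -- Moving `false :: A` to the end gives a rotation that agrees with D on `b :: B'` and then
        -- has a 0 where D has a 1, contrary to minimality.
        have hle := hD (b :: B' ++ false :: ones (f + (e + 1)) ++ false :: A)
          (isRotated_iff_append.2 ⟨false :: A, b :: B' ++ false :: ones (f + (e + 1)),
            by simp, rfl⟩)
        rw [hBA] at hle
        have : b :: B' ++ (false :: ones (f + (e + 1)) ++ false :: A) <
            b :: B' ++ (ones (e + 1) ++ false :: ones f ++ false :: A) := by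
          rw [append_lt_append_left_iff]
          exact false_cons_lt_true_cons _ _
        refine absurd hle (not_le.2 ?_)
        simpa using this

/-- The zeros of a necklace `γ01^i` whose change to a one gives the least rotation `γ1^(i+1)`. -/
theorem IsNeck.flip_eq {γ x : List Bool} {i : ℕ} (hD : IsNeck (γ ++ false :: ones i))
    (h : false :: x ~r γ ++ false :: ones i) (h' : true :: x ~r γ ++ ones (i + 1)) :
    x = ones i ++ γ ∨ ∃ e f y, 1 ≤ e ∧ 1 ≤ y ∧ f + e = i ∧
      γ = (List.replicate y (false :: ones f)).flatten ∧
      false :: x = false :: ones f ++ γ ++ ones e ∧ false :: x = γ ++ false :: ones i := by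
  by_cases hγ : γ = []
  · left
    subst hγ
    have := h'.perm
    simp only [List.nil_append] at this
    have h2 := List.perm_replicate.1 this
    rw [List.replicate_succ] at h2
    simpa using h2
  obtain ⟨T, S, hTS, hTS'⟩ : ∃ T S, x = S ++ T ∧ γ ++ ones (i + 1) = T ++ true :: S := by
    obtain ⟨A, B, hAB, hBA⟩ := isRotated_iff_append.1 h'
    cases A with
    | nil => exact ⟨[], x, by simp, by simp [hBA, hAB]⟩
    | cons a A =>
      simp at hAB
      obtain ⟨rfl, rfl⟩ := hAB
      exact ⟨B, A, rfl, hBA⟩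
  subst hTS
  have hU : γ ++ false :: ones i ≤ T ++ false :: S :=
    hD _ (h.symm.trans (isRotated_iff_append.2 ⟨false :: S, T, by simp, rfl⟩))
  rcases List.append_eq_append_iff.1 hTS' with ⟨C, rfl, hC⟩ | ⟨C, rfl, hC⟩
  · -- the changed zero lies after `γ`
    have hlen : C.length + S.length = i := by
      have := congrArg List.length hC
      simp at this; omega
    have hCo : C = ones C.length := by
      rw [ones, List.eq_replicate_iff]
      exact ⟨rfl, fun b hb => List.eq_of_mem_replicate (n := i + 1) (by rw [← ones, hC]; simp [hb])⟩
    have hSo : S = ones S.length := by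
      rw [ones, List.eq_replicate_iff]
      exact ⟨rfl, fun b hb => List.eq_of_mem_replicate (n := i + 1) (by rw [← ones, hC]; simp [hb])⟩
    generalize hf : S.length = f at *
    generalize he : C.length = e at *
    subst hSo hCo
    rcases Nat.eq_zero_or_pos e with rfl | hepos
    · left
      obtain rfl : f = i := by omega
      simp
    · right
      obtain rfl : i = f + e := by omega
      have hrot : γ ++ ones e ++ false :: ones f ~r γ ++ false :: ones (f + e) :=
        List.IsRotated.trans (isRotated_iff_append.2 ⟨γ ++ ones e, false :: ones f, rfl, by simp⟩) h
      have heq := hD.eq_of_isRotated_append hepos hγ hrot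
      -- Cancelling 1^e in the two expressions for the necklace shows that γ commutes with 01^f,
      -- hence is a power of it.
      have hcomm : false :: ones f ++ γ = γ ++ false :: ones f := by
        have : (false :: ones f ++ γ) ++ ones e = (γ ++ false :: ones f) ++ ones e := by
          rw [← heq]; simp [ones]
        exact List.append_cancel_right this
      obtain ⟨y, hy⟩ := eq_flatten_of_commute f γ hcomm
      refine ⟨e, f, y, hepos, ?_, rfl, hy, by simp, by rw [heq]; simp⟩
      rcases Nat.eq_zero_or_pos y with rfl | hy'
      · simp at hy; exact absurd hy hγ
      · exact hy'
  · cases C with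
    | nil =>
      simp only [List.nil_append] at hC
      simp [ones, List.replicate_succ] at hC
      left; simp [hC]
    | cons c C =>
      simp only [List.cons_append, List.cons.injEq] at hC
      obtain ⟨rfl, rfl⟩ := hC
      exfalso
      -- If the changed position lay inside γ, restoring the zero there would give a rotation below
      -- the necklace.
      have : T ++ (false :: (C ++ ones (i + 1))) < T ++ (true :: C ++ false :: ones i) := by
        rw [append_lt_append_left_iff]
        exact false_cons_lt_true_cons _ _
      refine absurd hU (not_le.2 ?_)
      simpa using this

end PrefSame

namespace PrefSame

open List

/-! ### The state of the register: first bit and difference word -/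

/-- The parity of the number of ones. -/
def par (l : List Bool) : Bool := l.foldr xor false

@[simp] theorem par_nil : par [] = false := rfl

@[simp] theorem par_cons (b : Bool) (l : List Bool) : par (b :: l) = (b ^^ par l) := rfl

@[simp] theorem par_append (a b : List Bool) : par (a ++ b) = (par a ^^ par b) := by
  induction a with
  | nil => simp
  | cons x a ih => simp [ih]

theorem par_ones_succ (k : ℕ) : par (ones (k + 1)) = !par (ones k) := by
  simp [ones, List.replicate_succ]

/-- The action of `PRR` on pairs of a first bit and a difference word. -/
def stepState : Bool × List Bool → Bool × List Bool
  | (h, []) => (h, [])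
  | (h, c :: d) => (h ^^ c, d ++ [c])

theorem stepState_iterate (h : Bool) (A B : List Bool) :
    stepState^[A.length] (h, A ++ B) = (h ^^ par A, B ++ A) := by
  induction A generalizing h B with
  | nil => simp
  | cons c A ih =>
    rw [List.length_cons, Function.iterate_succ_apply]
    have := ih (h ^^ c) (B ++ [c])
    simp only [List.cons_append, stepState, List.append_assoc] at this ⊢
    rw [this]
    simp

theorem stepState_isRotated (v : Bool × List Bool) (k : ℕ) : v.2 ~r (stepState^[k] v).2 := by
  induction k with
  | zero => exact List.IsRotated.refl _
  | succ k ih =>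
    rw [Function.iterate_succ_apply']
    refine List.IsRotated.trans ih ?_
    rcases stepState^[k] v with ⟨h, _ | ⟨c, d⟩⟩
    · exact List.IsRotated.refl _
    · exact isRotated_iff_append.2 ⟨[c], d, rfl, rfl⟩

/-- The prefix `A` of `A ++ B` may be rotated away to reach the least rotation. -/
def IsSplit (A B : List Bool) : Prop :=
  A ≠ [] ∧ IsNeck (B ++ A) ∧ (B = [] ∨ ∃ E, B = false :: E)

/-- The least number of steps from `d` to its least rotation: it is at least 1, and it is the
length of `d` if `d` has no zero. -/
noncomputable def idx (d : List Bool) : ℕ :=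
  sInf {m | ∃ A B, d = A ++ B ∧ A.length = m ∧ IsSplit A B}

theorem isSplit_of_isNeck {A B : List Bool} (hA : A ≠ []) (h : IsNeck (B ++ A))
    (hf : false ∈ B ++ A) : IsSplit A B := by
  refine ⟨hA, h, ?_⟩
  obtain ⟨E, hE⟩ := h.head_of_mem hf
  cases B with
  | nil => exact Or.inl rfl
  | cons b B => simp at hE; exact Or.inr ⟨B, by rw [hE.1]⟩

theorem exists_isSplit {d : List Bool} (hd : d ≠ []) : ∃ A B, d = A ++ B ∧ IsSplit A B := by
  obtain ⟨D, hD, hN⟩ := exists_isNeck d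
  by_cases hf : false ∈ D
  · obtain ⟨A, B, rfl, rfl⟩ := isRotated_iff_append.1 hD
    cases A with
    | nil =>
      refine ⟨B, [], by simp, isSplit_of_isNeck (by simpa using hd) ?_ ?_⟩
      · simpa using hN
      · simpa using hf
    | cons a A => exact ⟨a :: A, B, rfl, isSplit_of_isNeck (by simp) hN hf⟩
  · refine ⟨d, [], by simp, hd, ?_, Or.inl rfl⟩
    have : d = ones d.length := by
      rw [ones, List.eq_replicate_iff]
      refine ⟨rfl, fun b hb => ?_⟩
      cases b with
      | true => rfl
      | false => exact absurd (hD.perm.mem_iff.1 hb) hf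
    rw [List.nil_append, this]
    exact isNeck_ones _

theorem exists_coord {d : List Bool} (hd : d ≠ []) :
    ∃ A B, d = A ++ B ∧ A.length = idx d ∧ IsSplit A B := by
  obtain ⟨A, B, h, hs⟩ := exists_isSplit hd
  exact Nat.sInf_mem (s := {m | ∃ A B, d = A ++ B ∧ A.length = m ∧ IsSplit A B})
    ⟨A.length, A, B, h, rfl, hs⟩

theorem idx_le {A B : List Bool} (h : IsSplit A B) : idx (A ++ B) ≤ A.length :=
  Nat.sInf_le ⟨A, B, rfl, rfl, h⟩

/-- A shorter split would have to begin its second part with a zero, but only ones are available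
there. -/
theorem idx_eq_of_ones {c : Bool} {m : ℕ} {B : List Bool} (h : IsSplit (c :: ones m) B) :
    idx (c :: ones m ++ B) = m + 1 := by
  refine le_antisymm ((idx_le h).trans (by simp)) ?_
  by_contra hc
  obtain ⟨A', B', hAB, hl, hs⟩ := exists_coord (d := c :: ones m ++ B) (by simp)
  rw [← hl] at hc
  rcases List.append_eq_append_iff.1 hAB with ⟨C, rfl, -⟩ | ⟨C, hC, rfl⟩
  · simp at hc
  · have hA := hs.1
    obtain ⟨a, A', rfl⟩ := List.exists_cons_of_ne_nil hA
    simp only [List.cons_append, List.cons.injEq] at hC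
    rcases hs.2.2 with h0 | ⟨E, hE⟩
    · simp at h0
      have := congrArg List.length hC.2
      simp [h0.1] at this hc
      omega
    · cases C with
      | nil =>
        have := congrArg List.length hC.2
        simp at this hc; omega
      | cons e C =>
        have : e ∈ ones m := by rw [hC.2]; simp
        have he := List.eq_of_mem_replicate this
        simp [he] at hE

/-- The cycle of a state with least rotation `D` contains two states with difference word `D`. -/
def IsOdd (D : List Bool) : Prop := false ∉ D ∨ par (D.take (idx D)) = true

/-- The return times to a necklace D are the multiples of `idx D`, since a nonzero remainder would
give a shorter split; each such return adds an even parity to the first bit. -/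
theorem eq_of_not_isOdd {D : List Bool} (hN : IsNeck D) (ho : ¬ IsOdd D) {h h' : Bool} {t : ℕ}
    (ht : stepState^[t] (h, D) = (h', D)) : h' = h := by
  simp only [IsOdd, not_or, not_not, Bool.not_eq_true] at ho
  obtain ⟨hf, ho⟩ := ho
  obtain ⟨A, B, hAB, hl, hs⟩ := exists_coord (d := D) (by rintro rfl; simp at hf)
  have hBA : B ++ A = D :=
    (hN.eq_of_isRotated hs.2.1 (isRotated_iff_append.2 ⟨A, B, hAB, rfl⟩)).symm
  have hpA : par A = false := by rw [← hl, hAB] at ho; simpa using ho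
  have hper : stepState^[A.length] (h, D) = (h, D) := by
    conv_lhs => rw [hAB]
    rw [stepState_iterate, hBA, hpA, Bool.xor_false]
  have hr : stepState^[t % A.length] (h, D) = (h', D) := by
    rw [← ht]
    conv_rhs => rw [← Nat.mod_add_div t A.length]
    rw [Function.iterate_add_apply, Function.iterate_mul,
      Function.iterate_fixed (f := stepState^[A.length]) hper]
  have hpos : 0 < A.length := List.length_pos_iff.2 hs.1
  rcases Nat.eq_zero_or_pos (t % A.length) with h0 | hpos'
  · rw [h0] at hr; simpa using hr.symm
  · exfalso
    have hlt := Nat.mod_lt t hpos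
    obtain ⟨X, Y, hXY, hX⟩ := exists_split_length (U := A) hlt.le
    have hD : D = X ++ (Y ++ B) := by rw [hAB, hXY]; simp
    rw [← hX, hD, stepState_iterate, ← hD] at hr
    have hYX : Y ++ B ++ X = D := congrArg Prod.snd hr
    have hsX : IsSplit X (Y ++ B) := by
      apply isSplit_of_isNeck
      · rintro rfl; simp at hX; omega
      · rwa [hYX]
      · rwa [hYX]
    have := idx_le hsX
    rw [← hD, ← hl, hX] at this
    omega

theorem par_of_not_isOdd {D : List Bool} (hN : IsNeck D) (ho : ¬ IsOdd D) : par D = false := by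
  have := stepState_iterate false D []
  simp only [List.append_nil, List.nil_append] at this
  simpa using eq_of_not_isOdd hN ho this

/-- The words `(01^f)^y 1^e` with odd `f`, `y ≥ 2` and `e ≥ 1`. -/
def SpecialForm (D : List Bool) : Prop :=
  ∃ f y e, f % 2 = 1 ∧ 2 ≤ y ∧ 1 ≤ e ∧ D = (List.replicate y (false :: ones f)).flatten ++ ones e

/-! ### A key that increases along the successor rule -/

open Classical in
/-- The key of the states on a cycle that contains no state `(1, D)`. -/
noncomputable def leafKey (D : List Bool) : List Bool ×ₗ ℕ :=
  if SpecialForm D then toLex (D.rotate ((D.tail.takeWhile id).length + 1), 0)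
  else
    let k := D.length - (D.reverse.takeWhile id).length - 1
    toLex (D.take k ++ ones (D.length - k), 3 + 2 * k)

open Classical in
/-- The key of a state in terms of its least rotation `D`, the number `m` of steps to `D`, the
first bit `s` that is reached with `D`, and whether the first `m` differences are all 1. -/
noncomputable def coordKey (D : List Bool) (m : ℕ) (s : Bool) (early : Prop) : List Bool ×ₗ ℕ :=
  if s = true then
    if early then toLex (D.take (D.length - m) ++ zeros m, 0)
    else toLex (D, 2 * D.length + 4)
  else if IsOdd D then
    if early then toLex (D, 2 + 2 * (D.length - m)) else toLex (D, 1)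
  else leafKey D

/-- The key of a state. -/
noncomputable def key (h : Bool) (d : List Bool) : List Bool ×ₗ ℕ :=
  coordKey (d.rotate (idx d)) (idx d) (h ^^ par (d.take (idx d))) (false ∉ d.take (idx d))

theorem key_append (h : Bool) {A B : List Bool} (hl : A.length = idx (A ++ B)) :
    key h (A ++ B) = coordKey (B ++ A) A.length (h ^^ par A) (false ∉ A) := by
  rw [key, ← hl, List.rotate_append_length_eq, List.take_left]

theorem leafKey_special {f y e : ℕ} (hf : f % 2 = 1) (hy : 1 ≤ y) (he : 1 ≤ e) :
    leafKey (false :: ones f ++ (List.replicate y (false :: ones f)).flatten ++ ones e) =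
      toLex ((List.replicate y (false :: ones f)).flatten ++ ones e ++ false :: ones f, 0) := by
  have hs : SpecialForm
      (false :: ones f ++ (List.replicate y (false :: ones f)).flatten ++ ones e) :=
    ⟨f, y + 1, e, hf, by omega, he, by simp [List.replicate_succ]⟩
  have hl : ((false :: ones f ++ (List.replicate y (false :: ones f)).flatten ++
      ones e).tail.takeWhile id).length + 1 = (false :: ones f).length := by
    -- Because y ≥ 1, the word has a second zero, and f is the number of ones between the first two
    -- zeros.
    obtain ⟨y, rfl⟩ : ∃ k, y = k + 1 := ⟨y - 1, by omega⟩
    have : ∀ R, List.takeWhile id (ones f ++ false :: R) = ones f := by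
      intro R
      rw [List.takeWhile_append_of_pos (by simp)]
      simp
    simp [List.replicate_succ, this]
  rw [leafKey, if_pos hs, hl, List.append_assoc, List.rotate_append_length_eq]

theorem leafKey_of_not_special {γ : List Bool} {i : ℕ}
    (h : ¬ SpecialForm (γ ++ false :: ones i)) :
    leafKey (γ ++ false :: ones i) = toLex (γ ++ ones (i + 1), 3 + 2 * γ.length) := by
  have hl : ((γ ++ false :: ones i).reverse.takeWhile id).length = i := by
    have : (γ ++ false :: ones i).reverse = ones i ++ false :: γ.reverse := by simp
    rw [this, List.takeWhile_append_of_pos (by simp)]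
    simp
  have hk : (γ ++ false :: ones i).length - i - 1 = γ.length := by simp; omega
  rw [leafKey, if_neg h, hl, hk]
  simp

theorem key_of_ones {m : ℕ} {B : List Bool} (h : Bool) (hN : IsNeck (B ++ ones (m + 1)))
    (hB : B = [] ∨ ∃ E, B = false :: E) :
    key h (ones (m + 1) ++ B) =
      coordKey (B ++ ones (m + 1)) (m + 1) (h ^^ par (ones (m + 1))) True := by
  have hs : IsSplit (true :: ones m) B := ⟨by simp, by simpa [ones, List.replicate_succ] using hN, hB⟩
  have hidx := idx_eq_of_ones hs
  have : ones (m + 1) = true :: ones m := List.replicate_succ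
  rw [this, key_append h (by rw [hidx]; simp), ← this]
  simp

theorem key_of_false_ones {i : ℕ} {γ : List Bool} (h : Bool)
    (hN : IsNeck (γ ++ false :: ones i)) :
    key h (false :: ones i ++ γ) =
      coordKey (γ ++ false :: ones i) (i + 1) (h ^^ par (ones i)) False := by
  have hs : IsSplit (false :: ones i) γ := isSplit_of_isNeck (by simp) hN (by simp)
  rw [key_append h (by rw [idx_eq_of_ones hs]; simp)]
  simp

theorem coordKey_early {B : List Bool} {m : ℕ} {p : Prop} (hp : p) :
    coordKey (B ++ ones m) m true p = toLex (B ++ zeros m, 0) := by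
  simp [coordKey, hp]

theorem coordKey_early_odd {B : List Bool} {m : ℕ} {p : Prop} (hp : p)
    (ho : IsOdd (B ++ ones m)) :
    coordKey (B ++ ones m) m false p = toLex (B ++ ones m, 2 + 2 * B.length) := by
  simp [coordKey, hp, ho]

theorem coordKey_late {D : List Bool} {m : ℕ} {p : Prop} (hp : ¬ p) :
    coordKey D m true p = toLex (D, 2 * D.length + 4) := by
  simp [coordKey, hp]

theorem coordKey_late_odd {D : List Bool} {m : ℕ} {p : Prop} (hp : ¬ p) (ho : IsOdd D) :
    coordKey D m false p = toLex (D, 1) := by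
  simp [coordKey, hp, ho]

theorem coordKey_leaf {D : List Bool} {m : ℕ} {p : Prop} (ho : ¬ IsOdd D) :
    coordKey D m false p = leafKey D := by
  simp [coordKey, ho]

theorem toLex_lt_of_fst {a b : List Bool} {i j : ℕ} (h : a < b) :
    (toLex (a, i) : List Bool ×ₗ ℕ) < toLex (b, j) :=
  Prod.Lex.toLex_lt_toLex.2 (Or.inl h)

theorem toLex_lt_of_snd {a : List Bool} {i j : ℕ} (h : i < j) :
    (toLex (a, i) : List Bool ×ₗ ℕ) < toLex (a, j) :=
  Prod.Lex.toLex_lt_toLex.2 (Or.inr ⟨rfl, h⟩)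

theorem toLex_le_of_snd {a : List Bool} {i j : ℕ} (h : i ≤ j) :
    (toLex (a, i) : List Bool ×ₗ ℕ) ≤ toLex (a, j) :=
  Prod.Lex.toLex_le_toLex.2 (Or.inr ⟨rfl, h⟩)

theorem toLex_lt_of_le {a b : List Bool} {i j : ℕ} (h : a ≤ b) (hij : i < j) :
    (toLex (a, i) : List Bool ×ₗ ℕ) < toLex (b, j) := by
  rcases h.lt_or_eq with h | rfl
  · exact toLex_lt_of_fst h
  · exact toLex_lt_of_snd hij

/-! ### Representatives in terms of difference words -/

/-- `(h, D)` is the state of an RL-rep. -/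
def RLState (h : Bool) (D : List Bool) : Prop := IsNeck D ∧ (IsOdd D → h = true)

/-- `(h, D)` is the state of a special string, provided that it is the state of an RL-rep. -/
def SpecialState (h : Bool) (D : List Bool) : Prop := h = false ∧ SpecialForm D

/-- `(h, d)` is the state of a same-rep whose run-length is not `n`. -/
def RepState (h : Bool) (d : List Bool) : Prop :=
  ∃ x, d = false :: x ∧ ((RLState h d ∧ SpecialState h d) ∨
    ∃ i γ, x = ones i ++ γ ∧ RLState (h ^^ par (ones i)) (γ ++ false :: ones i) ∧
      ¬ SpecialState (h ^^ par (ones i)) (γ ++ false :: ones i))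

/-- An even necklace has total parity 0, and the flip changes the total parity. So the parent of a
leaf is odd and has a pass with first bit 0, on which the leaf can be inserted. -/
theorem isOdd_flip_last {γ : List Bool} {i : ℕ} (hN : IsNeck (γ ++ false :: ones i))
    (ho : ¬ IsOdd (γ ++ false :: ones i)) : IsOdd (γ ++ ones (i + 1)) := by
  by_contra h
  have h1 := par_of_not_isOdd hN.flip_last h
  have h2 := par_of_not_isOdd hN ho
  simp [par_ones_succ] at h1 h2
  simp [h2] at h1

theorem SpecialForm.exists_eq {D : List Bool} (h : SpecialForm D) :
    ∃ f y e, f % 2 = 1 ∧ 1 ≤ y ∧ 1 ≤ e ∧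
      D = false :: ones f ++ (List.replicate y (false :: ones f)).flatten ++ ones e := by
  obtain ⟨f, y, e, hf, hy, he, rfl⟩ := h
  obtain ⟨y, rfl⟩ : ∃ k, y = k + 1 := ⟨y - 1, by omega⟩
  exact ⟨f, y, e, hf, by omega, he, by simp [List.replicate_succ]⟩

theorem flatten_commute (y f : ℕ) :
    false :: ones f ++ (List.replicate y (false :: ones f)).flatten =
      (List.replicate y (false :: ones f)).flatten ++ false :: ones f := by
  have h1 : List.replicate (y + 1) (false :: ones f) =
      (false :: ones f) :: List.replicate y (false :: ones f) := List.replicate_succ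
  have h2 : List.replicate (y + 1) (false :: ones f) =
      List.replicate y (false :: ones f) ++ [false :: ones f] := List.replicate_succ'
  have := congrArg List.flatten (h1.symm.trans h2)
  simpa using this

theorem special_eq (y f e : ℕ) :
    false :: ones f ++ (List.replicate y (false :: ones f)).flatten ++ ones e =
      (List.replicate y (false :: ones f)).flatten ++ false :: ones (f + e) := by
  rw [flatten_commute]; simp [ones]

theorem flatten_head {y f : ℕ} (hy : 1 ≤ y) :
    ∃ E, (List.replicate y (false :: ones f)).flatten = false :: E := by
  obtain ⟨y, rfl⟩ : ∃ k, y = k + 1 := ⟨y - 1, by omega⟩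
  exact ⟨ones f ++ (List.replicate y (false :: ones f)).flatten, by simp [List.replicate_succ]⟩

theorem par_ones_of_odd {f : ℕ} (hf : f % 2 = 1) : par (ones f) = true := by
  induction f using Nat.strong_induction_on with
  | _ f ih =>
    match f with
    | 1 => rfl
    | f + 2 => rw [par_ones_succ, par_ones_succ, Bool.not_not, ih f (by omega) (by omega)]

theorem par_ones_of_even {f : ℕ} (hf : f % 2 = 0) : par (ones f) = false := by
  cases f with
  | zero => rfl
  | succ f => rw [par_ones_succ, par_ones_of_odd (by omega)]; rfl

/-- The key of the state `(1, 11^fγ1^e)`, where `γ = (01^f)^y`. -/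
theorem key_conj_special {f y e : ℕ} (hf : f % 2 = 1) (hy : 1 ≤ y)
    (hN : IsNeck (false :: ones f ++ (List.replicate y (false :: ones f)).flatten ++ ones e)) :
    key true (true :: (ones f ++ (List.replicate y (false :: ones f)).flatten ++ ones e)) =
      toLex ((List.replicate y (false :: ones f)).flatten ++ ones e ++ zeros (f + 1), 0) := by
  rw [special_eq] at hN
  have hN' := hN.flip_last
  have e1 : (List.replicate y (false :: ones f)).flatten ++ ones (f + e + 1) =
      (List.replicate y (false :: ones f)).flatten ++ ones e ++ ones (f + 1) := by
    rw [List.append_assoc]; simp [ones]; omega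
  rw [e1] at hN'
  have hh := flatten_head (f := f) hy
  have := key_of_ones (m := f) true hN' (Or.inr (by obtain ⟨E, hE⟩ := hh; rw [hE]; simp))
  rw [show true :: (ones f ++ (List.replicate y (false :: ones f)).flatten ++ ones e) =
    ones (f + 1) ++ ((List.replicate y (false :: ones f)).flatten ++ ones e) by
      simp [ones, List.replicate_succ], this, par_ones_succ, par_ones_of_odd hf]
  exact coordKey_early trivial

/-- A special state that represents a cycle has the key of that cycle. -/
theorem key_special {f y e : ℕ} (hf : f % 2 = 1) (hy : 1 ≤ y) (he : 1 ≤ e)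
    (h : RLState false (false :: ones f ++ (List.replicate y (false :: ones f)).flatten ++ ones e)) :
    key false (false :: ones f ++ (List.replicate y (false :: ones f)).flatten ++ ones e) =
      toLex ((List.replicate y (false :: ones f)).flatten ++ ones e ++ false :: ones f, 0) := by
  obtain ⟨hN, ho⟩ := h
  rw [← leafKey_special hf hy he]
  set D := false :: ones f ++ (List.replicate y (false :: ones f)).flatten ++ ones e with hD
  have ho' : ¬ IsOdd D := fun h => by simpa using ho h
  obtain ⟨A, B, hAB, hl, hs⟩ := exists_coord (d := D) (by simp [hD])
  have hBA : B ++ A = D :=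
    (hN.eq_of_isRotated hs.2.1 (isRotated_iff_append.2 ⟨A, B, hAB, rfl⟩)).symm
  have hpA : par A = false := by
    simp only [IsOdd, not_or, Bool.not_eq_true] at ho'
    have := ho'.2
    rwa [← hl, hAB, List.take_left] at this
  have hk := key_append false (A := A) (B := B) (by rw [← hAB]; exact hl)
  rw [hAB, hk, hpA, ← hAB, hBA]
  exact coordKey_leaf ho'

theorem exists_last_false {D : List Bool} (hf : false ∈ D) : ∃ γ i, D = γ ++ false :: ones i := by
  rcases eq_ones_or_exists_last_false D with h | h
  · rw [h] at hf; simp at hf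
  · exact h

/-- In the special case g1^e0^(f+1) < g1^e01^f, as f ≥ 1. For an LC-rep the first bit and the parity
of the ones both change, so the conjugate reaches its necklace with the same bit s. If s = 1, its
word is lowered to γ0^(i+1) ≤ γ01^i. If s = 0, both keys have the word γ1^(i+1), and the numbers 2 +
2|γ| and 3 + 2|γ| were chosen for this comparison. -/
theorem RepState.key_conj_lt {h : Bool} {x : List Bool} (hr : RepState h (false :: x)) :
    key (!h) (true :: x) < key h (false :: x) := by
  obtain ⟨x', hx, ⟨h1, h2, h3⟩ | ⟨i, γ, rfl, h1, h2⟩⟩ := hr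
  · obtain rfl : x = x' := by simpa using hx
    subst h2
    obtain ⟨f, y, e, hf, hy, he, hD⟩ := h3.exists_eq
    rw [hD] at h1
    have hk := key_special hf hy he h1
    have hc := key_conj_special hf hy h1.1
    obtain rfl : x = ones f ++ (List.replicate y (false :: ones f)).flatten ++ ones e := by
      simpa using hD
    rw [hD, Bool.not_false, hk, hc]
    refine toLex_lt_of_fst ?_
    rw [append_lt_append_left_iff]
    obtain ⟨f, rfl⟩ : ∃ k, f = k + 1 := ⟨f - 1, by omega⟩
    exact (append_lt_append_left_iff [false]).2 (false_cons_lt_true_cons _ _)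
  · obtain rfl : x = ones i ++ γ := by simpa using hx
    obtain ⟨hN, ho⟩ := h1
    have hk := key_of_false_ones h hN
    have hB : γ = [] ∨ ∃ E, γ = false :: E :=
      (isSplit_of_isNeck (A := false :: ones i) (by simp) hN (by simp)).2.2
    have hc := key_of_ones (!h) hN.flip_last hB
    have hs : (!h ^^ par (ones (i + 1))) = (h ^^ par (ones i)) := by
      rw [par_ones_succ]; cases h <;> cases par (ones i) <;> rfl
    rw [hs] at hc
    rw [List.cons_append] at hk
    rw [hk, show true :: (ones i ++ γ) = ones (i + 1) ++ γ by simp [ones, List.replicate_succ], hc]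
    generalize (h ^^ par (ones i)) = s at *
    cases s with
    | true =>
      rw [coordKey_early trivial, coordKey_late not_false]
      refine toLex_lt_of_le ?_ (by omega)
      rw [append_le_append_left_iff]
      exact zeros_le (by simp)
    | false =>
      have ho' : ¬ IsOdd (γ ++ false :: ones i) := fun h => by simpa using ho h
      rw [coordKey_early_odd trivial (isOdd_flip_last hN ho'), coordKey_leaf ho',
        leafKey_of_not_special (fun h => h2 ⟨rfl, h⟩)]
      exact toLex_lt_of_snd (by omega)

end PrefSame

/-! ### Keys of a state and of its conjugate -/

namespace PrefSame

open List

/-- In the special case E is a rotation of D, hence at least D, and it has a 0 where γ1^(i+1) still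
has a 1. The bounds suffice whenever a leaf is compared with a cycle that is not its parent. -/
theorem leafKey_bounds (γ : List Bool) (i : ℕ) (hN : IsNeck (γ ++ false :: ones i)) :
    ∃ E j, leafKey (γ ++ false :: ones i) = toLex (E, j) ∧ γ ++ false :: ones i ≤ E ∧
      E ≤ γ ++ ones (i + 1) ∧ (SpecialForm (γ ++ false :: ones i) → E < γ ++ ones (i + 1)) := by
  have hlt : ∀ k : ℕ, false :: ones k < ones (k + 1) := fun k => by
    rw [ones, ones, List.replicate_succ]; exact false_cons_lt_true_cons _ _
  by_cases hs : SpecialForm (γ ++ false :: ones i)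
  · obtain ⟨f, y, e, hf, hy, he, hD⟩ := hs.exists_eq
    refine ⟨_, _, by rw [hD]; exact leafKey_special hf hy he, ?_⟩
    have hrot : γ ++ false :: ones i ~r
        (List.replicate y (false :: ones f)).flatten ++ ones e ++ false :: ones f :=
      isRotated_iff_append.2
        ⟨false :: ones f, (List.replicate y (false :: ones f)).flatten ++ ones e, by rw [hD]; simp, rfl⟩
    have hE : (List.replicate y (false :: ones f)).flatten ++ ones e ++ false :: ones f <
        γ ++ ones (i + 1) := by
      have hD' := hD
      rw [special_eq] at hD'
      have hγ : γ = (List.replicate y (false :: ones f)).flatten ∧ i = f + e := by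
        rcases List.append_eq_append_iff.1 hD' with ⟨C, h1, h2⟩ | ⟨C, h1, h2⟩
        · cases C with
          | nil =>
            simp only [List.nil_append, List.cons.injEq, true_and] at h2
            exact ⟨by simpa using h1.symm, by simpa using congrArg List.length h2⟩
          | cons c C =>
            exfalso
            simp only [List.cons_append, List.cons.injEq] at h2
            have : false ∈ ones i := by rw [h2.2]; simp
            simp at this
        · cases C with
          | nil =>
            simp only [List.nil_append, List.cons.injEq, true_and] at h2
            exact ⟨by simpa using h1, by simpa using congrArg List.length h2.symm⟩
          | cons c C =>
            exfalso
            simp only [List.cons_append, List.cons.injEq] at h2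
            have : false ∈ ones (f + e) := by rw [h2.2]; simp
            simp at this
      rw [hγ.1, hγ.2, show f + e + 1 = e + (f + 1) by omega, List.append_assoc,
        append_lt_append_left_iff, show ones (e + (f + 1)) = ones e ++ ones (f + 1) by simp [ones],
        append_lt_append_left_iff]
      exact hlt f
    exact ⟨hN _ hrot, hE.le, fun _ => hE⟩
  · refine ⟨_, _, leafKey_of_not_special hs, ?_, le_rfl, fun h => absurd h hs⟩
    rw [append_le_append_left_iff]
    exact (hlt i).le

/-- A rotation by one of a state with a zero in its difference word. -/
theorem step_coord {c : Bool} {d A B : List Bool} (hd : c :: d = A ++ B)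
    (hl : A.length = idx (c :: d)) (hs : IsSplit A B) (hf : false ∈ c :: d) :
    ∃ A₂ B₂, d ++ [c] = A₂ ++ B₂ ∧ A₂.length = idx (d ++ [c]) ∧ B₂ ++ A₂ = B ++ A ∧
      (A = c :: A₂ ∨
        A = [c] ∧ d ++ [c] = B ++ A ∧ false ∈ A₂ ∧ (par A₂ = true ↔ IsOdd (B ++ A))) := by
  obtain ⟨a, A', rfl⟩ := List.exists_cons_of_ne_nil hs.1
  simp only [List.cons_append, List.cons.injEq] at hd
  obtain ⟨rfl, rfl⟩ := hd
  have hfD : false ∈ B ++ c :: A' := by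
    simp only [List.mem_cons, List.mem_append] at hf ⊢; tauto
  cases A' with
  | cons a A' =>
    refine ⟨a :: A', B ++ [c], by simp, ?_, by simp, Or.inl rfl⟩
    have hs' : IsSplit (a :: A') (B ++ [c]) :=
      isSplit_of_isNeck (by simp) (by simpa using hs.2.1) (by simpa using hfD)
    have h1 := idx_le hs'
    rw [show a :: A' ++ B ++ [c] = a :: A' ++ (B ++ [c]) by simp]
    refine le_antisymm ?_ h1
    -- A split of the rotated word becomes, with `c` put back in front, a split of the old word that
    -- is longer by one; so the index drops by exactly one.
    obtain ⟨A₃, B₃, h3, hl3, hs3⟩ := exists_coord (d := a :: A' ++ (B ++ [c])) (by simp)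
    rw [hl3.symm] at h1 ⊢
    have : ∃ B₄, B₃ = B₄ ++ [c] ∧ A' ++ B = (A₃ ++ B₄).tail ∧ a :: A' ++ B = A₃ ++ B₄ := by
      rcases List.eq_nil_or_concat B₃ with rfl | ⟨B₄, b, rfl⟩
      · have := congrArg List.length h3
        simp at this h1
        omega
      · have h3' : (a :: A' ++ B) ++ [c] = (A₃ ++ B₄) ++ [b] := by simpa using h3
        obtain ⟨h5, h6⟩ := List.append_inj' h3' rfl
        refine ⟨B₄, by simpa using h6.symm, by rw [← h5]; simp, h5⟩
    obtain ⟨B₄, rfl, -, h4⟩ := this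
    have hsplit : IsSplit (c :: A₃) B₄ := by
      apply isSplit_of_isNeck (by simp) (by simpa using hs3.2.1)
      have : false ∈ (A₃ ++ B₄) ++ [c] := by
        rw [← h4]; simp only [List.mem_cons, List.mem_append] at hfD ⊢; simp; tauto
      simp only [List.mem_cons, List.mem_append] at this ⊢; simp at this; tauto
    have := idx_le hsplit
    rw [List.cons_append, ← h4] at this
    have := hl.le.trans this
    simpa using this
  | nil =>
    -- Here the rotated word is D itself, so the next return takes a full period, whose parity
    -- decides whether D is odd.
    obtain ⟨A₂, B₂, h2, hl2, hs2⟩ := exists_coord (d := B ++ [c]) (by simp)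
    have hN : IsNeck (B ++ [c]) := hs.2.1
    have hD : B₂ ++ A₂ = B ++ [c] :=
      (hN.eq_of_isRotated hs2.2.1 (isRotated_iff_append.2 ⟨A₂, B₂, h2, rfl⟩)).symm
    obtain ⟨E, hE⟩ := hN.head_of_mem hfD
    refine ⟨A₂, B₂, h2, hl2, hD, Or.inr ⟨rfl, rfl, ?_, ?_⟩⟩
    · obtain ⟨a, A₃, rfl⟩ := List.exists_cons_of_ne_nil hs2.1
      rw [h2] at hE
      simp at hE
      simp [hE.1]
    · rw [IsOdd, ← hl2]
      conv_rhs => rw [h2, List.take_left, ← h2]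
      simp only [not_not.2 hfD, false_or]

theorem count_true_of_isRotated {D E : List Bool} (h : D ~r E) :
    D.count true = E.count true := h.perm.count_eq true

/-- The number f is determined by the word, as the gap between its first two zeros. -/
theorem special_form_odd {f y e : ℕ} (hy : 1 ≤ y)
    (h : SpecialForm (false :: ones f ++ (List.replicate y (false :: ones f)).flatten ++ ones e)) :
    f % 2 = 1 := by
  obtain ⟨f', y', e', hf', hy', he', hD⟩ := h.exists_eq
  obtain ⟨E, hE⟩ := flatten_head (f := f) hy
  obtain ⟨E', hE'⟩ := flatten_head (f := f') hy'
  have := congrArg (fun l => (l.tail.takeWhile id).length) hD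
  have hw : ∀ k R, List.takeWhile id (ones k ++ false :: R) = ones k := by
    intro k R
    rw [List.takeWhile_append_of_pos (by simp)]
    simp
  simp [hE, hE', hw] at this
  omega

theorem exists_ones_of_not_mem {A : List Bool} (hA : A ≠ []) (h : false ∉ A) :
    ∃ m, A = ones (m + 1) := by
  obtain ⟨a, A', rfl⟩ := List.exists_cons_of_ne_nil hA
  refine ⟨A'.length, ?_⟩
  rw [ones, List.eq_replicate_iff]
  refine ⟨rfl, fun b hb => ?_⟩
  cases b with
  | true => rfl
  | false => exact absurd hb h

theorem ones_succ_append (m : ℕ) (B : List Bool) : ones (m + 1) ++ B = true :: (ones m ++ B) := by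
  simp [ones, List.replicate_succ]

theorem not_xor_par_succ (h : Bool) (m : ℕ) :
    (!h ^^ par (ones (m + 1))) = (h ^^ par (ones m)) := by
  rw [par_ones_succ]; cases h <;> cases par (ones m) <;> rfl

/-- If `(h, 0x)` is on no path between cycles, it has a smaller key than its conjugate. -/
theorem key_lt_conj {h : Bool} {x : List Bool} (hr : ¬ RepState h (false :: x)) :
    key h (false :: x) < key (!h) (true :: x) := by
  obtain ⟨A, B, hAB, hl, hs⟩ := exists_coord (d := false :: x) (by simp)
  obtain ⟨A', B', hAB', hl', hs'⟩ := exists_coord (d := true :: x) (by simp)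
  have hfA : false ∈ A := by
    obtain ⟨a, A₁, rfl⟩ := List.exists_cons_of_ne_nil hs.1
    simp at hAB; simp [hAB.1]
  have hrot : B ++ A ~r false :: x := isRotated_iff_append.2 ⟨B, A, rfl, hAB⟩
  have hrot' : true :: x ~r B' ++ A' := isRotated_iff_append.2 ⟨A', B', hAB', rfl⟩
  have hlt : B ++ A < B' ++ A' := lt_of_flip hs.2.1 hrot hrot'
  have hcnt : (B' ++ A').count true = (B ++ A).count true + 1 := by
    rw [← count_true_of_isRotated hrot', count_true_of_isRotated hrot]; simp
  have hlen : (B' ++ A').length = (B ++ A).length := by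
    rw [← hrot'.perm.length_eq, hrot.perm.length_eq]; simp
  have hk : key h (false :: x) = coordKey (B ++ A) A.length (h ^^ par A) (false ∉ A) := by
    rw [hAB]; exact key_append h (by rw [← hAB, hl])
  have hk' : key (!h) (true :: x) =
      coordKey (B' ++ A') A'.length (!h ^^ par A') (false ∉ A') := by
    rw [hAB']; exact key_append _ (by rw [← hAB', hl'])
  have hnA : ¬ false ∉ A := not_not.2 hfA
  -- the keys of the cycles without a state `(1, D)`
  by_cases hleaf : (h ^^ par A) = false ∧ ¬ IsOdd (B ++ A)
  · obtain ⟨hs0, ho⟩ := hleaf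
    rw [hs0, coordKey_leaf ho] at hk
    -- Two even necklaces would both have parity 0, but the two words differ in one letter.
    have ho' : IsOdd (B' ++ A') := by
      by_contra ho'
      have h1 := par_of_not_isOdd hs.2.1 ho
      have h2 := par_of_not_isOdd hs'.2.1 ho'
      have h3 := congrArg par hAB
      have h4 := congrArg par hAB'
      simp at h1 h2 h3 h4
      cases hx : par x <;> simp_all
    obtain ⟨γ, i, hD⟩ := exists_last_false (D := B ++ A) (by simp [hfA])
    have hN : IsNeck (γ ++ false :: ones i) := hD ▸ hs.2.1
    obtain ⟨E, j, hE, -, hEP, hEs⟩ := leafKey_bounds γ i hN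
    have hcP : (γ ++ ones (i + 1)).count true = (B ++ A).count true + 1 := by
      rw [hD]; simp; omega
    -- The necklace of the conjugate is above D and has weight one more, and γ1^(i+1) is the least
    -- such word.
    have hP : γ ++ ones (i + 1) ≤ B' ++ A' := by
      refine append_ones_le_of_lt ?_ ?_ ?_
      · rw [hlen, hD]; simp; omega
      · rw [← hD]; exact hlt
      · rw [hcnt, hcP]
    rcases hP.lt_or_eq with hP | hP
    · -- the least rotation of the conjugate exceeds that of the parent
      rw [hk, hk', hD, hE]
      cases hs1 : (!h ^^ par A') with
      | true =>
        by_cases he : false ∈ A'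
        · rw [coordKey_late (not_not.2 he)]
          exact toLex_lt_of_fst (hEP.trans_lt hP)
        · obtain ⟨m, rfl⟩ := exists_ones_of_not_mem hs'.1 he
          rw [show (ones (m + 1)).length = m + 1 by simp, coordKey_early he]
          -- Equal weights decide the comparison before the trailing ones, so it survives their
          -- replacement by zeros.
          refine toLex_lt_of_fst (hEP.trans_lt (lt_append_zeros_of_lt_append_ones ?_ hP ?_))
          · have : (γ ++ ones (i + 1)).length = (B ++ A).length := by rw [hD]; simp
            rw [this, ← hlen]; simp
          · rw [hcP, hcnt]
      | false =>
        by_cases he : false ∈ A'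
        · rw [coordKey_late_odd (not_not.2 he) ho']
          exact toLex_lt_of_fst (hEP.trans_lt hP)
        · obtain ⟨m, rfl⟩ := exists_ones_of_not_mem hs'.1 he
          rw [show (ones (m + 1)).length = m + 1 by simp, coordKey_early_odd he ho']
          exact toLex_lt_of_fst (hEP.trans_lt hP)
    · rw [← hP] at ho' hrot'
      -- The conjugate lies over the necklace of the parent. So the flipped zero is the last one of
      -- D, or D = (01^f)^(y+1)1^e and it is the first one.
      rcases hN.flip_eq (hD ▸ hrot.symm) hrot' with rfl | ⟨e, f, y, he, hy, rfl, hγ, hx, hx'⟩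
      · have hsm : (h ^^ par (ones i)) = false := by
          have hsp : IsSplit (false :: ones i) γ := isSplit_of_isNeck (by simp) hN (by simp)
          have : idx (false :: (ones i ++ γ)) = i + 1 := idx_eq_of_ones hsp
          have hA : A = false :: ones i := by
            refine (List.append_inj (s₁ := false :: ones i) hAB ?_).1.symm
            rw [hl, this]; simp
          rw [hA] at hs0
          simpa using hs0
        by_cases hsf : SpecialForm (γ ++ false :: ones i)
        · have hB : γ = [] ∨ ∃ E, γ = false :: E :=
            (isSplit_of_isNeck (A := false :: ones i) (by simp) hN (by simp)).2.2
          rw [hk, hD, hE, ← ones_succ_append, key_of_ones _ hN.flip_last hB, not_xor_par_succ, hsm,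
            coordKey_early_odd trivial ho']
          exact toLex_lt_of_fst (hEs hsf)
        · refine absurd ⟨_, rfl, Or.inr ⟨i, γ, rfl, ⟨hN, fun h => ?_⟩, ?_⟩⟩ hr
          · rw [hD] at ho; exact absurd h ho
          · exact fun h => hsf h.2
      · have hh : h = false := by
          have h1 : stepState^[A.length] (h, B ++ A) = (h ^^ par A, B ++ A) := by
            have := stepState_iterate h A B
            rwa [← hAB, hx', ← hD] at this
          rw [hs0] at h1
          exact (eq_of_not_isOdd hs.2.1 ho h1).symm
        subst hh
        have hRL : RLState false (false :: x) := by
          rw [hx', ← hD]; exact ⟨hs.2.1, fun h => absurd h ho⟩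
        -- For odd f the state would be a special RL-rep, hence a representative.
        have hfe : f % 2 = 0 := by
          by_contra hf
          refine hr ⟨x, rfl, Or.inl ⟨hRL, rfl, f, y + 1, e, by omega, by omega, he, ?_⟩⟩
          rw [hx, hγ]; simp [List.replicate_succ]
        have hns : ¬ SpecialForm (γ ++ false :: ones (f + e)) := by
          rw [← hx', hx, hγ]
          intro h
          have := special_form_odd hy h
          omega
        have hx2 : true :: x = ones (f + 1) ++ (γ ++ ones e) := by
          rw [ones_succ_append]; simp at hx; simp [hx]
        have hP2 : γ ++ ones (f + e + 1) = γ ++ ones e ++ ones (f + 1) := by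
          simp [ones]; omega
        have hN2 := hN.flip_last
        rw [hP2] at hN2 ho'
        have hB : γ ++ ones e = [] ∨ ∃ E, γ ++ ones e = false :: E := by
          obtain ⟨E, hE⟩ := flatten_head (f := f) hy
          right; rw [hγ, hE]; simp
        -- For even f the conjugate lies on the pass with first bit 0, behind γ1^e, and e ≥ 1 gives
        -- 3 + 2|γ| < 2 + 2(|γ| + e).
        rw [hk, hD, leafKey_of_not_special hns, hx2, key_of_ones _ hN2 hB, not_xor_par_succ,
          par_ones_of_even hfe, Bool.xor_false, coordKey_early_odd trivial ho', hP2]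
        exact toLex_lt_of_snd (by simp; omega)
  · -- the other cycles
    obtain ⟨j, hj⟩ : ∃ j, key h (false :: x) = toLex (B ++ A, j) := by
      rw [hk]
      cases hs0 : (h ^^ par A) with
      | true => exact ⟨_, coordKey_late hnA⟩
      | false =>
        refine ⟨_, coordKey_late_odd hnA ?_⟩
        by_contra ho
        exact hleaf ⟨hs0, ho⟩
    rw [hj, hk']
    by_cases he : false ∈ A'
    · cases hs1 : (!h ^^ par A') with
      | true => rw [coordKey_late (not_not.2 he)]; exact toLex_lt_of_fst hlt
      | false =>
        by_cases ho' : IsOdd (B' ++ A')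
        · rw [coordKey_late_odd (not_not.2 he) ho']; exact toLex_lt_of_fst hlt
        · obtain ⟨γ, i, hD⟩ := exists_last_false (D := B' ++ A') (by simp [he])
          obtain ⟨E, j, hE, hE1, -⟩ := leafKey_bounds γ i (hD ▸ hs'.2.1)
          rw [coordKey_leaf ho', hD, hE]
          rw [hD] at hlt
          exact toLex_lt_of_fst (hlt.trans_le hE1)
    · obtain ⟨m, rfl⟩ := exists_ones_of_not_mem hs'.1 he
      rw [show (ones (m + 1)).length = m + 1 by simp]
      cases hs1 : (!h ^^ par (ones (m + 1))) with
      | true =>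
        rw [coordKey_early he]
        refine toLex_lt_of_fst (lt_append_zeros_of_lt_append_false ?_ ?_ ?_)
        · rw [← hlen]; simp; omega
        · rw [ones_succ_append] at hAB'
          have hx : x = ones m ++ B' := by simpa using hAB'
          have hE : B ++ A ~r B' ++ false :: ones m :=
            hrot.trans (isRotated_iff_append.2 ⟨false :: ones m, B', by rw [hx]; rfl, rfl⟩)
          -- Equality would mean that the flipped zero is the last one of D; as the bit reached with
          -- D is 1, the state would be an LC-rep.
          refine lt_of_le_of_ne (hs.2.1 _ hE) fun heq => hr ?_
          rw [not_xor_par_succ] at hs1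
          refine ⟨x, rfl, Or.inr ⟨m, B', hx, ⟨heq ▸ hs.2.1, fun _ => hs1⟩, ?_⟩⟩
          rw [hs1]
          exact fun h => by simpa using h.1
        · have : (B' ++ ones (m + 1)).count true = (B' ++ false :: ones m).count true + 1 := by
            simp; omega
          omega
      | false =>
        by_cases ho' : IsOdd (B' ++ ones (m + 1))
        · rw [coordKey_early_odd he ho']; exact toLex_lt_of_fst hlt
        · have hf : false ∈ B' ++ ones (m + 1) := by
            by_contra hf; exact ho' (Or.inl hf)
          obtain ⟨γ, i, hD⟩ := exists_last_false hf
          obtain ⟨E, j, hE, hE1, -⟩ := leafKey_bounds γ i (hD ▸ hs'.2.1)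
          rw [coordKey_leaf ho', hD, hE]
          rw [hD] at hlt
          exact toLex_lt_of_fst (hlt.trans_le hE1)

end PrefSame

/-! ### Monotonicity of the key along the successor rule -/

namespace PrefSame

open List

theorem key_of_coord (h : Bool) {d A B : List Bool} (hd : d = A ++ B) (hl : A.length = idx d) :
    key h d = coordKey (B ++ A) A.length (h ^^ par A) (false ∉ A) := by
  subst hd; exact key_append h hl

/-- Only the bit reached with the necklace has to be preserved, and a full period of an even
necklace adds nothing to it. -/
theorem key_step_leaf {h c : Bool} {d A B : List Bool} (hd : c :: d = A ++ B)
    (hl : A.length = idx (c :: d)) (hs : IsSplit A B) (hf : false ∈ c :: d)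
    (h0 : (h ^^ par A) = false) (ho : ¬ IsOdd (B ++ A)) :
    key (h ^^ c) (d ++ [c]) = leafKey (B ++ A) := by
  obtain ⟨A₂, B₂, h2, hl2, hD, hA⟩ := step_coord hd hl hs hf
  have : (h ^^ c ^^ par A₂) = false := by
    rcases hA with rfl | ⟨rfl, -, -, hp⟩
    · simpa [Bool.xor_assoc] using h0
    · have : par A₂ = false := by simpa using mt hp.1 ho
      rw [this]; simpa using h0
  rw [key_of_coord _ h2 hl2, hD, this, coordKey_leaf ho]

theorem isNeck_false_ones (k : ℕ) : IsNeck (false :: ones k) := by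
  intro E hE
  refine false_cons_ones_le ?_ ?_
  · rw [← hE.perm.length_eq]; simp
  · rw [← count_true_of_isRotated hE]; simp

theorem toLex_le_of_le {a b : List Bool} {i j : ℕ} (h : a ≤ b) (hij : i ≤ j) :
    (toLex (a, i) : List Bool ×ₗ ℕ) ≤ toLex (b, j) := by
  rcases h.lt_or_eq with h | rfl
  · exact (toLex_lt_of_fst h).le
  · exact toLex_le_of_snd hij

/-- Along a cycle the key increases, except at the representative. -/
theorem key_le_step {h c : Bool} {d : List Bool} (h1 : ¬ RepState h (c :: d))
    (h2 : ¬ RepState (!h) ((!c) :: d))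
    (h3 : ¬ (h = false ∧ c :: d = par (ones d.length) :: ones d.length)) :
    key h (c :: d) ≤ key (h ^^ c) (d ++ [c]) := by
  obtain ⟨A, B, hAB, hl, hs⟩ := exists_coord (d := c :: d) (by simp)
  by_cases hf : false ∈ c :: d
  · obtain ⟨A₂, B₂, hd2, hl2, hD, hA⟩ := step_coord hAB hl hs hf
    -- A state 01^iB that reaches its necklace with bit 1 is an LC-rep, and representatives are
    -- excluded here.
    have hns : ∀ i, A = false :: ones i → (h ^^ par A) = true → False := by
      rintro i rfl ht
      simp only [List.cons_append, List.cons.injEq] at hAB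
      obtain ⟨rfl, rfl⟩ := hAB
      have ht' : (h ^^ par (ones i)) = true := by simpa using ht
      refine h1 ⟨_, rfl, Or.inr ⟨i, B, rfl, ⟨hs.2.1, fun _ => ht'⟩, ?_⟩⟩
      rw [ht']; exact fun h => by simpa using h.1
    rw [key_of_coord h hAB hl]
    cases h0 : (h ^^ par A) with
    | false =>
      by_cases ho : IsOdd (B ++ A)
      · rw [key_of_coord _ hd2 hl2, hD]
        rcases hA with rfl | ⟨rfl, hBA, hf2, hp⟩
        · have : (h ^^ c ^^ par A₂) = false := by simpa [Bool.xor_assoc] using h0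
          rw [this]
          by_cases he : false ∈ A₂
          · rw [coordKey_late_odd (by simp [he]) ho, coordKey_late_odd (by simp [he]) ho]
          · have hA2 : A₂ = ones A₂.length := by
              rw [ones, List.eq_replicate_iff]
              refine ⟨rfl, fun b hb => ?_⟩
              cases b with
              | true => rfl
              | false => exact absurd hb he
            cases c with
            | true =>
              simp only [coordKey, ho, he]
              simp only [Bool.false_eq_true, if_false, if_true, List.mem_cons,
                he, not_false_eq_true, or_false]
              exact toLex_le_of_snd (by simp; omega)
            | false =>
              simp only [coordKey, ho, he]
              simp only [Bool.false_eq_true, if_false, if_true, List.mem_cons,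
                he, not_false_eq_true, or_false, not_true_eq_false]
              exact toLex_le_of_snd (by omega)
        -- Passing D with bit 0 on an odd cycle starts the last pass, towards (1, D), which has the
        -- largest number.
        · have : (h ^^ c ^^ par A₂) = true := by
            rw [hp.2 ho]; simp at h0; simp [h0]
          rw [this, coordKey_late (not_not.2 hf2)]
          simp only [coordKey, ho, Bool.false_eq_true, if_false, if_true]
          split
          · exact toLex_le_of_snd (by omega)
          · exact toLex_le_of_snd (by omega)
      · rw [key_step_leaf hAB hl hs hf h0 ho, coordKey_leaf ho]
    | true =>
      rw [key_of_coord _ hd2 hl2, hD]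
      rcases hA with rfl | ⟨rfl, hBA, hf2, hp⟩
      · have : (h ^^ c ^^ par A₂) = true := by simpa [Bool.xor_assoc] using h0
        rw [this]
        by_cases he : false ∈ A₂
        · rw [coordKey_late (by simp [he]), coordKey_late (by simp [he])]
        · cases c with
          | false =>
            rcases List.eq_nil_or_concat A₂ with rfl | ⟨X, b, rfl⟩
            · exact (hns 0 rfl h0).elim
            · obtain ⟨m, hm⟩ := exists_ones_of_not_mem (by simp) he
              exact (hns (m + 1) (by rw [hm]) h0).elim
          | true =>
            have hf' : false ∉ true :: A₂ := by simp [he]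
            obtain ⟨m, hm⟩ := exists_ones_of_not_mem (by simp) hf'
            have hm' : A₂ = ones m := by
              rw [ones, List.replicate_succ] at hm; simpa using hm
            subst hm'
            rw [show (true :: ones m).length = m + 1 by simp,
              show B ++ true :: ones m = B ++ ones (m + 1) by simp [ones, List.replicate_succ],
              coordKey_early hf',
              show B ++ ones (m + 1) = (B ++ [true]) ++ ones m by simp [ones, List.replicate_succ],
              show (ones m).length = m by simp,
              coordKey_early he]
            -- One step restores one of the lowered letters: B0^(m+1) < B10^m.
            refine (toLex_lt_of_fst ?_).le
            rw [List.append_assoc, append_lt_append_left_iff]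
            exact false_cons_lt_true_cons _ _
      · cases c with
        | false => exact (hns 0 rfl h0).elim
        | true =>
          rw [show coordKey (B ++ [true]) [true].length true (false ∉ [true]) =
            toLex (B ++ zeros 1, 0) from coordKey_early (m := 1) (by simp)]
          have hB : B ++ zeros 1 < B ++ [true] := by
            rw [append_lt_append_left_iff]; exact false_cons_lt_true_cons _ _
          cases h5 : (h ^^ true ^^ par A₂) with
          | true =>
            rw [coordKey_late (not_not.2 hf2)]
            exact (toLex_lt_of_fst hB).le
          | false =>
            by_cases ho : IsOdd (B ++ [true])
            · rw [coordKey_late_odd (not_not.2 hf2) ho]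
              exact (toLex_lt_of_fst hB).le
            · have h6 : par A₂ = false := by simpa using mt hp.1 ho
              rw [h6] at h5
              simp at h0 h5
              simp [h0] at h5
  -- On the root cycle every state other than the seed is the conjugate of a representative, so no
  -- plain step of PRR is left to consider.
  · exfalso
    obtain ⟨m, hm⟩ := exists_ones_of_not_mem (by simp) hf
    rw [ones, List.replicate_succ, List.cons.injEq] at hm
    obtain ⟨rfl, rfl⟩ := hm
    by_cases hp : (!h ^^ par (ones m)) = false ∧ IsOdd (false :: ones m)
    · cases h with
      | true =>
        have hsp : IsSplit (false :: ones m) [] :=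
          isSplit_of_isNeck (by simp) (isNeck_false_ones m) (by simp)
        have hi := idx_eq_of_ones hsp
        rw [List.append_nil] at hi
        obtain ⟨hp1, hp2 | hp2⟩ := hp
        · simp at hp2
        · rw [hi] at hp2
          simp at hp1
          simp [hp1] at hp2
      | false =>
        refine h3 ⟨rfl, ?_⟩
        simp at hp
        simp [hp.1]
    · refine h2 ⟨_, rfl, Or.inr ⟨m, [], by simp, ⟨isNeck_false_ones m, fun ho => ?_⟩, ?_⟩⟩
      · by_contra hc
        exact hp ⟨by simpa using hc, ho⟩
      · rintro ⟨-, hsf⟩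
        obtain ⟨f, y, e, -, hy, -, hD⟩ := hsf.exists_eq
        obtain ⟨E, hE⟩ := flatten_head (f := f) hy
        rw [hE] at hD
        have : false ∈ ones m := by
          simp at hD; rw [hD]; simp
        simp at this

/-- This is the step from the parent into the child. A leaf has a constant key, so
`RepState.key_conj_lt` suffices. Otherwise the representative is an LC-rep that reaches its necklace
with bit 1. If i ≥ 1, the lowered words γ0^(i+1) of the parent and (γ0)0^i of the child coincide; if
i = 0, the child is entered at its necklace γ0. -/
theorem key_conj_le_step {h : Bool} {x : List Bool} (hr : RepState h (false :: x)) :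
    key (!h) (true :: x) ≤ key h (x ++ [false]) := by
  have hlt := hr.key_conj_lt
  obtain ⟨A, B, hAB, hl, hs⟩ := exists_coord (d := false :: x) (by simp)
  by_cases hleaf : (h ^^ par A) = false ∧ ¬ IsOdd (B ++ A)
  · have h1 := key_step_leaf hAB hl hs (by simp) hleaf.1 hleaf.2
    rw [Bool.xor_false] at h1
    rw [h1, ← coordKey_leaf hleaf.2, ← hleaf.1, ← key_of_coord h hAB hl]
    exact hlt.le
  · obtain ⟨x', hx, ⟨h1, h2, h3⟩ | ⟨i, γ, rfl, h1, h2⟩⟩ := hr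
    · obtain rfl : x = x' := by simpa using hx
      subst h2
      -- A special representative has first bit 0 on an even cycle, so it lies on a leaf.
      exfalso
      have ho : ¬ IsOdd (false :: x) := fun h => by simpa using h1.2 h
      have hD : B ++ A = false :: x := (h1.1.eq_of_isRotated hs.2.1
        (isRotated_iff_append.2 ⟨A, B, hAB, rfl⟩)).symm
      refine hleaf ⟨?_, hD ▸ ho⟩
      have := stepState_iterate false A B
      rw [← hAB, hD] at this
      simpa using eq_of_not_isOdd h1.1 ho this
    · obtain rfl : x = ones i ++ γ := by simpa using hx
      obtain ⟨hN, ho⟩ := h1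
      have hB : γ = [] ∨ ∃ E, γ = false :: E :=
        (isSplit_of_isNeck (A := false :: ones i) (by simp) hN (by simp)).2.2
      have hA : A = false :: ones i := by
        have hsp : IsSplit (false :: ones i) γ := isSplit_of_isNeck (by simp) hN (by simp)
        have : idx (false :: (ones i ++ γ)) = i + 1 := idx_eq_of_ones hsp
        refine (List.append_inj (s₁ := false :: ones i) hAB ?_).1.symm
        rw [hl, this]; simp
      subst hA
      obtain rfl : B = γ := by simpa using hAB.symm
      have hs1 : (h ^^ par (ones i)) = true := by
        by_contra hc
        refine hleaf ⟨by simpa using hc, fun ho' => hc (ho ho')⟩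
      rw [← ones_succ_append, key_of_ones _ hN.flip_last hB, not_xor_par_succ, hs1,
        coordKey_early trivial]
      cases i with
      | zero =>
        obtain ⟨A₂, B₂, hd2, hl2, hD, hA2⟩ := step_coord hAB hl hs (by simp)
        rcases hA2 with hA2 | ⟨-, hBA, hf2, hp⟩
        · have : A₂ = [] := by simpa using hA2.symm
          rw [this] at hl2
          obtain ⟨A₃, B₃, -, hl3, hs3⟩ :=
            exists_coord (d := ones 0 ++ B ++ [false]) (by simp)
          rw [← hl2] at hl3
          exact absurd (by simpa using hl3) hs3.1
        · rw [key_of_coord _ hd2 hl2, hD]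
          have hh : h = true := by simpa using hs1
          cases h5 : (h ^^ par A₂) with
          | true =>
            rw [coordKey_late (not_not.2 hf2)]
            exact toLex_le_of_le (by simp) (by omega)
          | false =>
            have ho : IsOdd (B ++ false :: ones 0) := by
              rw [← hp]; simpa [hh] using h5
            rw [coordKey_late_odd (not_not.2 hf2) ho]
            exact toLex_le_of_le (by simp) (by omega)
      | succ i =>
        have e1 : B ++ false :: ones (i + 1) = B ++ [false] ++ ones (i + 1) := by simp
        rw [e1] at hN
        rw [List.append_assoc, key_of_ones _ hN, hs1, coordKey_early trivial]
        · apply le_of_eq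
          congr 2
          simp [zeros, List.replicate_succ]
        · rcases hB with rfl | ⟨E, rfl⟩
          · simp
          · simp

/-- This is the step from the child back to the parent, which resumes one letter further on: with
the word γ10^i, or with a larger number on the pass with first bit 0. The excluded state is the seed
in case it represents a child of the root. -/
theorem key_le_conj_step {h : Bool} {x : List Bool} (hr : RepState h (false :: x))
    (hw : ¬ (h = false ∧ false :: x = par (ones x.length) :: ones x.length)) :
    key h (false :: x) ≤ key h (x ++ [true]) := by
  obtain ⟨x', hx, ⟨h1, h2, h3⟩ | ⟨i, γ, rfl, h1, h2⟩⟩ := hr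
  · obtain rfl : x = x' := by simpa using hx
    subst h2
    obtain ⟨f, y, e, hf, hy, he, hD⟩ := h3.exists_eq
    rw [hD] at h1
    have hk := key_special hf hy he h1
    rw [hD, hk]
    set g := (List.replicate y (false :: ones f)).flatten with hg
    obtain ⟨f, rfl⟩ : ∃ k, f = k + 1 := ⟨f - 1, by omega⟩
    have hx : x ++ [true] = ones (f + 1) ++ (g ++ ones e ++ [true]) := by
      have : x = ones (f + 1) ++ g ++ ones e := by simpa using hD
      rw [this]; simp
    have hN := h1.1
    rw [special_eq] at hN
    have hN' := hN.flip_last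
    have e1 : g ++ ones (f + 1 + e + 1) = g ++ ones e ++ [true] ++ ones (f + 1) := by
      have : ([true] : List Bool) = ones 1 := rfl
      rw [this, List.append_assoc, List.append_assoc]; simp only [ones, ← List.replicate_add]
      congr 2; omega
    rw [e1] at hN'
    obtain ⟨E, hE⟩ := flatten_head (f := f + 1) hy
    rw [hx, key_of_ones _ hN' (Or.inr ⟨E ++ ones e ++ [true], by rw [hg, hE]; simp⟩),
      par_ones_of_odd hf, Bool.false_xor, coordKey_early trivial]
    refine (toLex_lt_of_fst ?_).le
    rw [List.append_assoc (g ++ ones e), append_lt_append_left_iff]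
    exact false_cons_lt_true_cons _ _
  · obtain rfl : x = ones i ++ γ := by simpa using hx
    obtain ⟨hN, ho⟩ := h1
    have hB : γ = [] ∨ ∃ E, γ = false :: E :=
      (isSplit_of_isNeck (A := false :: ones i) (by simp) hN (by simp)).2.2
    have hk : key h (false :: (ones i ++ γ)) = _ := key_of_false_ones h hN
    have hP : γ ++ false :: ones i < γ ++ ones (i + 1) := by
      rw [append_lt_append_left_iff, ones, ones, List.replicate_succ]
      exact false_cons_lt_true_cons _ _
    rw [hk]
    have hleaf : (h ^^ par (ones i)) = false → ¬ IsOdd (γ ++ false :: ones i) ∧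
        IsOdd (γ ++ ones (i + 1)) ∧
        leafKey (γ ++ false :: ones i) = toLex (γ ++ ones (i + 1), 3 + 2 * γ.length) := by
      intro h0
      have ho' : ¬ IsOdd (γ ++ false :: ones i) := fun h => by
        have := ho h; rw [h0] at this; simp at this
      exact ⟨ho', isOdd_flip_last hN ho', leafKey_of_not_special fun h => h2 ⟨h0, h⟩⟩
    rcases eq_or_ne γ [] with rfl | hγ
    · -- the parent is the cycle of run-length `n`
      have e1 : ones i ++ [] ++ [true] = ones (i + 1) ++ [] := by
        simp [ones, List.replicate_succ']
      rw [e1, key_of_ones h hN.flip_last (Or.inl rfl), par_ones_succ]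
      cases h0 : (h ^^ par (ones i)) with
      | true =>
        have : (h ^^ !par (ones i)) = false := by simp [h0]
        rw [this, coordKey_late not_false, coordKey_early_odd trivial (Or.inl (by simp))]
        exact (toLex_lt_of_fst hP).le
      | false =>
        -- A leaf below the root has an even number of ones and first bit 0, so its representative
        -- is the seed.
        exfalso
        obtain ⟨ho', -, -⟩ := hleaf h0
        have hp := par_of_not_isOdd hN ho'
        have hp' : par (ones i) = false := by simpa using hp
        rw [hp'] at h0
        refine hw ⟨by simpa using h0, ?_⟩
        simp [hp']
    cases i with
    | zero =>
      -- For i = 0 the parent is resumed exactly at its necklace P = γ1, so the index of the new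
      -- state is a full period of P.
      have hNP := hN.flip_last
      have e1 : ones 0 ++ γ ++ [true] = γ ++ ones 1 := by simp [ones]
      rw [e1]
      obtain ⟨A, B, hAB, hl, hs⟩ := exists_coord (d := γ ++ ones 1) (by simp)
      have hBA : B ++ A = γ ++ ones 1 :=
        (hNP.eq_of_isRotated hs.2.1 (isRotated_iff_append.2 ⟨A, B, hAB, rfl⟩)).symm
      obtain ⟨E, hE⟩ : ∃ E, γ = false :: E := by
        rcases hB with h | h
        · exact absurd h hγ
        · exact h
      have hfA : false ∈ A := by
        obtain ⟨a, A', rfl⟩ := List.exists_cons_of_ne_nil hs.1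
        rw [hE] at hAB; simp at hAB; simp [hAB.1]
      rw [key_of_coord h hAB hl, hBA]
      cases h0 : (h ^^ par (ones 0)) with
      | true =>
        rw [coordKey_late not_false]
        cases h5 : (h ^^ par A) with
        | true => rw [coordKey_late (not_not.2 hfA)]; exact (toLex_lt_of_fst hP).le
        | false =>
          by_cases ho' : IsOdd (γ ++ ones 1)
          · rw [coordKey_late_odd (not_not.2 hfA) ho']; exact (toLex_lt_of_fst hP).le
          · obtain ⟨g, j, hg⟩ := exists_last_false (D := γ ++ ones 1) (by simp [hE])
            obtain ⟨E, j, hE, hE1, -⟩ := leafKey_bounds g j (hg ▸ hNP)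
            rw [coordKey_leaf ho', hg, hE]
            rw [zero_add, hg] at hP
            exact (toLex_lt_of_fst (hP.trans_le hE1)).le
      | false =>
        obtain ⟨h3, h4, h5⟩ := hleaf h0
        -- The parent of a leaf is odd, so after its necklace was passed with bit 0 the last pass
        -- begins.
        have hpA : par A = true := by
          rcases h4 with h4 | h4
          · simp [hE] at h4
          · rw [zero_add, ← hl, hAB, List.take_left] at h4; exact h4
        have hh : h = false := by simpa using h0
        rw [coordKey_leaf h3, h5, hpA, hh, Bool.false_xor, coordKey_late (not_not.2 hfA)]
        exact toLex_le_of_snd (by simp; omega)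
    | succ i =>
      have hNP := hN.flip_last
      have e1 : γ ++ ones (i + 1 + 1) = γ ++ [true] ++ ones (i + 1) := by
        simp [ones, List.replicate_succ]
      rw [List.append_assoc, key_of_ones h (by rwa [e1] at hNP)
        (by
          rcases hB with h | ⟨E, rfl⟩
          · exact absurd h hγ
          · right; simp)]
      cases h0 : (h ^^ par (ones (i + 1))) with
      | true =>
        rw [coordKey_late not_false, coordKey_early trivial]
        refine (toLex_lt_of_fst ?_).le
        rw [List.append_assoc, append_lt_append_left_iff]
        exact false_cons_lt_true_cons _ _
      | false =>
        obtain ⟨h3, h4, h5⟩ := hleaf h0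
        rw [e1] at h4
        rw [coordKey_leaf h3, h5, e1, coordKey_early_odd trivial h4]
        exact toLex_le_of_snd (by simp; omega)

end PrefSame

namespace PrefSame

open List

/-! ### Strings and their difference words -/

/-- The string with first bit `h` and difference word `d`. -/
def dec : Bool → List Bool → List Bool
  | h, [] => [h]
  | h, c :: d => h :: dec (h ^^ c) d

@[simp] theorem dec_length (h : Bool) (d : List Bool) : (dec h d).length = d.length + 1 := by
  induction d generalizing h with
  | nil => rfl
  | cons c d ih => simp [dec, ih]

theorem dec_head (h : Bool) (d : List Bool) : ∃ l, dec h d = h :: l := by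
  cases d
  · exact ⟨_, rfl⟩
  · exact ⟨_, rfl⟩

theorem dec_injective {h h' : Bool} {d d' : List Bool} (e : dec h d = dec h' d') :
    h = h' ∧ d = d' := by
  induction d generalizing h h' d' with
  | nil =>
    cases d' with
    | nil => simpa [dec] using e
    | cons c d' => exact absurd (congrArg List.length e) (by simp)
  | cons c d ih =>
    cases d' with
    | nil => exact absurd (congrArg List.length e) (by simp)
    | cons c' d' =>
      simp only [dec, List.cons.injEq] at e
      obtain ⟨rfl, e⟩ := e
      obtain ⟨h1, h2⟩ := ih e
      refine ⟨rfl, ?_⟩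
      rw [h2, Bool.xor_right_inj.1 h1]

theorem exists_dec {w : List Bool} (hw : w ≠ []) : ∃ h d, w = dec h d := by
  induction w with
  | nil => exact absurd rfl hw
  | cons a w ih =>
    cases w with
    | nil => exact ⟨a, [], rfl⟩
    | cons b w =>
      obtain ⟨h, d, e⟩ := ih (by simp)
      refine ⟨a, (a ^^ h) :: d, ?_⟩
      simp [dec, e]

theorem dec_append (h : Bool) (d : List Bool) (c : Bool) :
    dec h (d ++ [c]) = dec h d ++ [h ^^ par d ^^ c] := by
  induction d generalizing h with
  | nil => simp [dec]
  | cons b d ih => simp [dec, ih]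

theorem dec_getLast? (h : Bool) (d : List Bool) : (dec h d).getLast? = some (h ^^ par d) := by
  induction d using List.reverseRecOn with
  | nil => simp [dec]
  | append_singleton d c _ => simp [dec_append]

theorem prrFeedback_dec (h c : Bool) (d : List Bool) :
    prrFeedback (dec h (c :: d)) = (h ^^ par d) := by
  have h1 := dec_getLast? h (c :: d)
  rw [List.getLast?_eq_getElem?] at h1
  obtain ⟨l, hl⟩ := dec_head (h ^^ c) d
  rw [prrFeedback, List.getD_eq_getElem?_getD (i := (dec h (c :: d)).length - 1), h1]
  simp only [dec, hl, List.getD_cons_zero, List.getD_cons_succ, Option.getD_some, par_cons]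
  cases h <;> cases c <;> cases par d <;> rfl

theorem prr_dec (h c : Bool) (d : List Bool) :
    prr (dec h (c :: d)) = dec (h ^^ c) (d ++ [c]) := by
  rw [prr, shiftRegister, prrFeedback_dec, dec_append]
  simp only [dec, List.tail_cons]
  congr 2
  cases h <;> cases c <;> cases par d <;> rfl

theorem conjugate_dec (h c : Bool) (d : List Bool) :
    conjugate (dec h (c :: d)) = dec (!h) ((!c) :: d) := by
  simp [dec, conjugate]

theorem prr_iterate_dec (k : ℕ) (h : Bool) {d : List Bool} (hd : d ≠ []) :
    prr^[k] (dec h d) = dec (stepState^[k] (h, d)).1 (stepState^[k] (h, d)).2 := by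
  induction k with
  | zero => rfl
  | succ k ih =>
    rw [Function.iterate_succ_apply', Function.iterate_succ_apply', ih]
    have hne : (stepState^[k] (h, d)).2 ≠ [] := by
      have := (stepState_isRotated (h, d) k).perm.length_eq
      rw [← List.length_pos_iff] at hd ⊢
      simp only at this
      omega
    obtain ⟨c, e, he⟩ := List.exists_cons_of_ne_nil hne
    rcases hv : stepState^[k] (h, d) with ⟨a, b⟩
    rw [hv] at he
    simp only at he
    subst he
    exact prr_dec a c e

/-! ### Run-length encodings and difference words -/

/-- The run-length encoding of the strings with difference word `d`. -/
def runs : List Bool → List ℕ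
  | [] => [1]
  | true :: d => 1 :: runs d
  | false :: d => (runs d).modifyHead (· + 1)

theorem runs_eq_cons (d : List Bool) : ∃ a t, runs d = (a + 1) :: t := by
  induction d with
  | nil => exact ⟨0, [], rfl⟩
  | cons c d ih =>
    cases c with
    | true => exact ⟨0, _, rfl⟩
    | false =>
      obtain ⟨a, t, h⟩ := ih
      exact ⟨a + 1, t, by simp [runs, h]⟩

theorem rle_cons_cons_self (b : Bool) (l : List Bool) :
    rle (b :: b :: l) = (rle (b :: l)).modifyHead (· + 1) := by
  have hne : (b :: l).splitBy (· == ·) ≠ [] := by simp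
  obtain ⟨g, gs, hg⟩ := List.exists_cons_of_ne_nil hne
  have hspec := List.splitBy_eq_iff.1 hg
  obtain ⟨h1, h2, h3, h4⟩ := hspec
  have hgne : g ≠ [] := by rintro rfl; simp at h2
  obtain ⟨a, g', rfl⟩ := List.exists_cons_of_ne_nil hgne
  obtain rfl : b = a := by simp at h1; exact h1.1
  have hsplit : (b :: b :: l).splitBy (· == ·) = (b :: b :: g') :: gs := by
    rw [List.splitBy_eq_iff]
    refine ⟨by simp [h1], by simpa using h2, ?_, ?_⟩
    · intro m hm
      rcases List.mem_cons.1 hm with rfl | hm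
      · exact List.isChain_cons_cons.2 ⟨by simp, h3 _ (by simp)⟩
      · exact h3 m (by simp [hm])
    · cases gs with
      | nil => simp
      | cons g₂ gs =>
        rw [List.isChain_cons_cons] at h4 ⊢
        refine ⟨?_, h4.2⟩
        obtain ⟨h6, hb, h5⟩ := h4.1
        exact ⟨by simp, hb, by simpa using h5⟩
  rw [rle, rle, hsplit, hg]
  simp

theorem rle_cons_cons_not (b : Bool) (l : List Bool) :
    rle (b :: (!b) :: l) = 1 :: rle ((!b) :: l) := by
  have := List.splitBy_append_cons (r := (· == ·)) (l := [b]) (a := !b) l (by simp)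
  rw [List.singleton_append] at this
  rw [rle, this]
  simp [rle, List.splitBy, List.splitBy.loop]

theorem rle_dec (h : Bool) (d : List Bool) : rle (dec h d) = runs d := by
  induction d generalizing h with
  | nil => simp [dec, runs, rle, List.splitBy, List.splitBy.loop]
  | cons c d ih =>
    cases c with
    | true =>
      obtain ⟨l, hl⟩ := dec_head (!h) d
      have := ih (!h)
      simp only [dec, Bool.xor_true, runs]
      rw [hl] at this ⊢
      rw [rle_cons_cons_not, this]
    | false =>
      obtain ⟨l, hl⟩ := dec_head h d
      have := ih h
      simp only [dec, Bool.xor_false, runs]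
      rw [hl] at this ⊢
      rw [rle_cons_cons_self, this]

/-- A difference 0 prolongs the first run and a difference 1 ends it, so the order is reversed;
equal lengths rule out proper prefixes. -/
theorem runs_lt_runs_iff {d d' : List Bool} (hl : d.length = d'.length) :
    runs d < runs d' ↔ d' < d := by
  induction d generalizing d' with
  | nil =>
    obtain rfl : d' = [] := by simpa using hl.symm
    simp
  | cons c d ih =>
    cases d' with
    | nil => simp at hl
    | cons c' d' =>
      have ih' := ih (d' := d') (by simpa using hl)
      obtain ⟨a, t, ha⟩ := runs_eq_cons d
      obtain ⟨a', t', ha'⟩ := runs_eq_cons d'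
      rw [ha, ha'] at ih'
      cases c <;> cases c' <;> simp [runs, ha, ha', List.cons_lt_cons_iff] at ih' ⊢ <;> exact ih'

theorem runs_sum (d : List Bool) : (runs d).sum = d.length + 1 := by
  induction d with
  | nil => rfl
  | cons c d ih =>
    obtain ⟨a, t, ha⟩ := runs_eq_cons d
    rw [ha] at ih
    cases c <;> simp [runs, ha] at ih ⊢ <;> omega

theorem runs_injective {d d' : List Bool} (h : runs d = runs d') : d = d' := by
  have hl : d.length = d'.length := by
    have h1 := runs_sum d
    have h2 := runs_sum d'
    rw [h] at h1; omega
  rcases lt_trichotomy d d' with hlt | heq | hlt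
  · rw [← runs_lt_runs_iff hl.symm, h] at hlt
    exact absurd hlt (lt_irrefl _)
  · exact heq
  · rw [← runs_lt_runs_iff hl, h] at hlt
    exact absurd hlt (lt_irrefl _)

theorem runs_length (d : List Bool) : (runs d).length = d.count true + 1 := by
  induction d with
  | nil => rfl
  | cons c d ih => cases c <;> simp [runs, ih]

theorem rle_length_ne_iff (h : Bool) (d : List Bool) :
    (rle (dec h d)).length ≠ (dec h d).length ↔ false ∈ d := by
  have := count_false_add_count_true d
  rw [rle_dec, runs_length, dec_length, ← List.count_pos_iff]
  omega

theorem runs_ones_append (k : ℕ) (R : List Bool) :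
    runs (ones k ++ R) = List.replicate k 1 ++ runs R := by
  induction k with
  | zero => simp
  | succ k ih => rw [ones_succ_append, runs, ih]; simp [List.replicate_succ]

theorem runs_ones (k : ℕ) : runs (ones k) = List.replicate (k + 1) 1 := by
  have := runs_ones_append k []
  rw [List.append_nil] at this
  rw [this, List.replicate_succ']
  rfl

/-- The last zero produces the last run that is longer than 1, and each one behind it produces a run
of length 1. -/
theorem runs_append_false_ones (γ : List Bool) (i : ℕ) :
    ∃ R e, 2 ≤ e ∧ runs (γ ++ false :: ones i) = R ++ e :: List.replicate i 1 := by
  induction γ with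
  | nil => exact ⟨[], 2, le_rfl, by simp [runs, runs_ones, List.replicate_succ]⟩
  | cons c γ ih =>
    obtain ⟨R, e, he, h⟩ := ih
    cases c with
    | true => exact ⟨1 :: R, e, he, by simp [runs, h]⟩
    | false =>
      cases R with
      | nil => exact ⟨[], e + 1, by omega, by simp [runs, h]⟩
      | cons a R => exact ⟨(a + 1) :: R, e, he, by simp [runs, h]⟩

theorem trailingOnes_dec (h : Bool) (γ : List Bool) (i : ℕ) :
    trailingOnes (dec h (γ ++ false :: ones i)) = i := by
  obtain ⟨R, e, he, hr⟩ := runs_append_false_ones γ i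
  have : (R ++ e :: List.replicate i 1).reverse = List.replicate i 1 ++ e :: R.reverse := by simp
  rw [trailingOnes, rle_dec, hr, this, List.takeWhile_append_of_pos (by simp)]
  have he' : (e == 1) = false := by simp; omega
  simp [he']

/-- A block 01^(2x+1) is a run of length 2 followed by 2x runs of length 1, its last letter being
the border to the next block; a final 1^e separates e + 1 letters. -/
theorem runs_special (x y e : ℕ) :
    runs ((List.replicate y (false :: ones (2 * x + 1))).flatten ++ ones e) =
      (List.replicate y (2 :: List.replicate (2 * x) 1)).flatten ++ List.replicate (e + 1) 1 := by
  induction y with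
  | zero => simp [runs_ones]
  | succ y ih =>
    have : (List.replicate (y + 1) (false :: ones (2 * x + 1))).flatten ++ ones e =
        false :: true :: (ones (2 * x) ++
          ((List.replicate y (false :: ones (2 * x + 1))).flatten ++ ones e)) := by
      rw [List.replicate_succ, List.flatten_cons]
      simp [ones, List.replicate_succ]
    rw [this, runs, runs, runs_ones_append, ih]
    simp [List.replicate_succ]

theorem isSpecial_dec (h : Bool) (D : List Bool) :
    IsSpecial (dec h D) ↔ h = false ∧ par D = false ∧ SpecialForm D := by
  have hh : (dec h D).head? = some h := by
    obtain ⟨l, hl⟩ := dec_head h D; rw [hl]; rfl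
  rw [IsSpecial, hh, dec_getLast?, rle_dec]
  constructor
  · rintro ⟨h1, h2, x, y, z, hy, hz, hr⟩
    obtain rfl : h = false := by simpa using h1
    obtain ⟨z, rfl⟩ : ∃ k, z = k + 1 := ⟨z - 1, by omega⟩
    rw [← runs_special] at hr
    exact ⟨rfl, by simpa using h2, 2 * x + 1, y, z, by omega, hy, by omega, runs_injective hr⟩
  · rintro ⟨rfl, h2, f, y, e, hf, hy, he, rfl⟩
    obtain ⟨x, rfl⟩ : ∃ k, f = 2 * k + 1 := ⟨f / 2, by omega⟩
    exact ⟨rfl, by simp [h2], x, y, e + 1, hy, by omega, runs_special x y e⟩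

/-- The largest encoding belongs to the least difference word. It occurs twice on the cycle exactly
if the necklace is odd, and only then does the tie-break prescribe the first bit. -/
theorem isRLRep_dec {h : Bool} {d : List Bool} (hf : false ∈ d) :
    IsRLRep (dec h d) ↔ RLState h d := by
  have hd : d ≠ [] := by rintro rfl; simp at hf
  have hh : ∀ h, (dec h d).head? = some h := fun h => by
    obtain ⟨l, hl⟩ := dec_head h d; rw [hl]; rfl
  constructor
  · intro hr
    have key : ∀ A B, d = A ++ B → (dec (h ^^ par A) (B ++ A) = dec h d ∨ d < B ++ A ∨
        (B ++ A = d ∧ h = true)) := by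
      intro A B hAB
      have h1 := hr (dec (h ^^ par A) (B ++ A)) ⟨A.length, by
        rw [prr_iterate_dec _ _ hd, hAB, stepState_iterate]⟩
      rw [rle_dec, rle_dec, hh, runs_lt_runs_iff (by rw [hAB]; simp; omega)] at h1
      rcases h1 with h1 | h1 | ⟨h1, h2⟩
      · exact Or.inl h1
      · exact Or.inr (Or.inl h1)
      · exact Or.inr (Or.inr ⟨runs_injective h1, by simpa using h2⟩)
    have hN : IsNeck d := by
      intro E hE
      obtain ⟨A, B, hAB, rfl⟩ := isRotated_iff_append.1 hE
      rcases key A B hAB with h1 | h1 | h1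
      · exact (dec_injective h1).2.ge
      · exact h1.le
      · exact h1.1.ge
    refine ⟨hN, fun ho => ?_⟩
    obtain ⟨A, B, hAB, hl, hs⟩ := exists_coord hd
    have hBA : B ++ A = d :=
      (hN.eq_of_isRotated hs.2.1 (isRotated_iff_append.2 ⟨A, B, hAB, rfl⟩)).symm
    have hp : par A = true := by
      rcases ho with ho | ho
      · exact absurd hf ho
      · rwa [← hl, hAB, List.take_left] at ho
    rcases key A B hAB with h1 | h1 | h1
    · have := (dec_injective h1).1
      rw [hp] at this
      simp at this
    · rw [hBA] at h1; exact absurd h1 (lt_irrefl _)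
    · exact h1.2
  · rintro ⟨hN, ho⟩ v ⟨k, rfl⟩
    rw [prr_iterate_dec _ _ hd]
    have hrot := stepState_isRotated (h, d) k
    rcases hv : stepState^[k] (h, d) with ⟨h', d'⟩
    rw [hv] at hrot
    simp only at hrot ⊢
    rw [rle_dec, rle_dec, runs_lt_runs_iff hrot.perm.length_eq.symm, hh]
    rcases (hN d' hrot).lt_or_eq with hlt | rfl
    · exact Or.inr (Or.inl hlt)
    · by_cases he : h' = h
      · left; rw [he]
      · right; right
        refine ⟨rfl, ?_⟩
        rw [ho]
        by_contra hodd
        exact he (eq_of_not_isOdd hN hodd hv)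

/-- For an RL-rep the condition that a special string ends with 0 is automatic: first bit 0 makes
the cycle even, so the parity of D vanishes. In the LC case, going i + 1 steps back from γ01^i leads
to 01^iγ. -/
theorem mem_sameReps_dec {h : Bool} {d : List Bool} (hd : d ≠ []) :
    dec h d ∈ sameReps ↔ RepState h d := by
  have hsp : ∀ {s D}, RLState s D → (IsSpecial (dec s D) ↔ SpecialState s D) := by
    intro s D hRL
    rw [isSpecial_dec]
    constructor
    · exact fun h => ⟨h.1, h.2.2⟩
    · rintro ⟨rfl, h2⟩
      exact ⟨rfl, par_of_not_isOdd hRL.1 fun ho => by simpa using hRL.2 ho, h2⟩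
  rw [sameReps, Set.mem_ofPred_eq, rle_length_ne_iff]
  constructor
  · rintro ⟨⟨σ, ⟨k, hk⟩, hRL, hcase⟩, hf⟩
    rw [prr_iterate_dec _ _ hd] at hk
    have hrot := stepState_isRotated (h, d) k
    obtain ⟨s, D, hsD⟩ : ∃ s D, stepState^[k] (h, d) = (s, D) := ⟨_, _, rfl⟩
    rw [hsD] at hk hrot
    simp only at hk hrot
    subst hk
    have hfD : false ∈ D := hrot.perm.mem_iff.1 hf
    rw [isRLRep_dec hfD] at hRL
    rw [hsp hRL] at hcase
    rcases hcase with ⟨h1, h2⟩ | ⟨h1, h2⟩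
    · obtain ⟨rfl, rfl⟩ := dec_injective h2
      obtain ⟨f, y, e, -, -, -, hD⟩ := h1.2.exists_eq
      exact ⟨_, hD, Or.inl ⟨hRL, h1⟩⟩
    · obtain ⟨γ, i, rfl⟩ := exists_last_false hfD
      rw [IsLCRepFor, trailingOnes_dec, prr_iterate_dec _ _ hd] at h2
      obtain ⟨X, Y, rfl, hX⟩ := exists_split_length (U := d) (k := i + 1) (by
        rw [hrot.perm.length_eq]; simp)
      rw [← hX, stepState_iterate] at h2
      obtain ⟨h3, h4⟩ := dec_injective h2
      obtain ⟨rfl, rfl⟩ := List.append_inj' h4 (by simp [hX])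
      have h3' : (h ^^ par (ones i)) = s := by simpa using h3
      refine ⟨ones i ++ Y, rfl, Or.inr ⟨i, Y, rfl, ?_, ?_⟩⟩
      · rw [h3']; exact hRL
      · rw [h3']; exact h1
  · rintro ⟨x, rfl, ⟨h1, h2⟩ | ⟨i, γ, rfl, h1, h2⟩⟩
    · exact ⟨⟨_, ⟨0, rfl⟩, (isRLRep_dec (by simp)).2 h1, Or.inl ⟨(hsp h1).2 h2, rfl⟩⟩, by simp⟩
    · have hk : prr^[i + 1] (dec h (false :: (ones i ++ γ))) =
          dec (h ^^ par (ones i)) (γ ++ false :: ones i) := by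
        rw [prr_iterate_dec _ _ hd]
        have := stepState_iterate h (false :: ones i) γ
        rw [show (false :: ones i).length = i + 1 by simp] at this
        rw [List.cons_append] at this
        rw [this]; simp
      refine ⟨⟨_, ⟨i + 1, hk⟩, (isRLRep_dec (by simp)).2 h1, Or.inr ⟨?_, ?_⟩⟩, by simp⟩
      · rwa [hsp h1]
      · rw [IsLCRepFor, trailingOnes_dec, hk]

end PrefSame

namespace PrefSame

open List Function

/-! ### Joining the cycles of a permutation -/

/-- `w` is reached from `v` by iterating `g`. -/
def Reach {V : Type*} (g : V → V) (v w : V) : Prop := ∃ k, g^[k] v = w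

theorem Reach.refl {V : Type*} (g : V → V) (v : V) : Reach g v v := ⟨0, rfl⟩

theorem Reach.trans {V : Type*} {g : V → V} {u v w : V} (h : Reach g u v) (h' : Reach g v w) :
    Reach g u w := by
  obtain ⟨k, rfl⟩ := h
  obtain ⟨l, rfl⟩ := h'
  exact ⟨l + k, iterate_add_apply g l k u⟩

theorem reach_apply {V : Type*} (g : V → V) (v : V) : Reach g v (g v) := ⟨1, rfl⟩

theorem Reach.symm {V : Type*} [Finite V] {g : V → V} (hg : Injective g) {v w : V}
    (h : Reach g v w) : Reach g w v := by
  obtain ⟨k, rfl⟩ := h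
  obtain ⟨p, hp, hv⟩ := hg.mem_periodicPts v
  refine ⟨p * k - k, ?_⟩
  have hle : k ≤ p * k := Nat.le_mul_of_pos_left k hp
  rw [← iterate_add_apply, Nat.sub_add_cancel hle]
  exact (hv.mul_const k)

/-- If every cycle of `f` that is not of level 0 has a representative, whose conjugate lies on a
cycle of lower level, then exchanging the successors of the representatives and of their
conjugates joins all cycles. -/
theorem reach_of_join {V : Type*} [Finite V] {f c g : V → V} {R : V → Prop} {lvl : V → ℕ}
    (hf : Injective f) (hg : Injective g) (hc : ∀ v, c (c v) = v)
    (hg1 : ∀ v, R v ∨ R (c v) → g v = f (c v)) (hg2 : ∀ v, ¬ R v → ¬ R (c v) → g v = f v)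
    (hlf : ∀ v, lvl (f v) = lvl v) (hRc : ∀ v, R v → lvl (c v) < lvl v ∧ ¬ R (c v))
    (hex : ∀ v, 0 < lvl v → ∃ r, R r ∧ Reach f v r)
    (huniq : ∀ r r', R r → R r' → Reach f r r' → r' = r)
    (hroot : ∀ v w, lvl v = 0 → lvl w = 0 → Reach f v w) (v w : V) : Reach g v w := by
  have hlf' : ∀ u v, Reach f u v → lvl v = lvl u := by
    rintro u v ⟨k, rfl⟩
    induction k with
    | zero => rfl
    | succ k ih => rw [iterate_succ_apply', hlf, ih]
  obtain ⟨M, hM⟩ : ∃ M, ∀ v, lvl v ≤ M := by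
    obtain ⟨M, hM⟩ := (Set.finite_range lvl).bddAbove
    exact ⟨M, fun v => hM ⟨v, rfl⟩⟩
  -- Downward induction on the level: if `c v` is a representative, then g leaves for its cycle,
  -- which has a higher level, runs around it and comes back to f v.
  have hA : ∀ k v, M ≤ lvl v + k → ¬ R v → Reach g v (f v) := by
    intro k
    induction k with
    | zero =>
      intro v hv hR
      by_cases hRcv : R (c v)
      · have := (hRc _ hRcv).1
        rw [hc] at this
        exact absurd (hM (c v)) (by omega)
      · exact ⟨1, by simpa using hg2 v hR hRcv⟩
    | succ k ih =>
      intro v hv hR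
      by_cases hRcv : R (c v)
      · have hlt := (hRc _ hRcv).1
        rw [hc] at hlt
        -- The walk around the higher cycle can be diverted only at a representative, which is `c v`
        -- by uniqueness, and that is the goal of the walk.
        have hstep : ∀ j, Reach g (f (c v)) (c v) ∨ Reach g (f (c v)) (f^[j] (f (c v))) := by
          intro j
          induction j with
          | zero => exact Or.inr (Reach.refl _ _)
          | succ j ihj =>
            rcases ihj with h | h
            · exact Or.inl h
            · have hr : Reach f (c v) (f^[j] (f (c v))) := ⟨j + 1, rfl⟩
              by_cases hRu : R (f^[j] (f (c v)))
              · left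
                have := huniq _ _ hRcv hRu hr
                rwa [this] at h
              · right
                refine h.trans ?_
                rw [iterate_succ_apply']
                refine ih _ ?_ hRu
                rw [hlf' _ _ hr]; omega
        have hback : Reach g (f (c v)) (c v) := by
          obtain ⟨j, hj⟩ := (reach_apply f (c v)).symm hf
          rcases hstep j with h | h
          · exact h
          · rwa [hj] at h
        have h1 : Reach g v (f (c v)) := ⟨1, hg1 v (Or.inr hRcv)⟩
        have h2 : Reach g (c v) (f v) := ⟨1, by
          have := hg1 (c v) (Or.inl hRcv)
          rwa [hc] at this⟩
        exact (h1.trans hback).trans h2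
      · exact ⟨1, by simpa using hg2 v hR hRcv⟩
  have hA' : ∀ v, ¬ R v → Reach g v (f v) := fun v => hA M v (by omega)
  -- Each representative offers an exit to a lower level, so level 0 is reached from everywhere.
  have hB : ∀ l v, lvl v ≤ l → ∃ u, lvl u = 0 ∧ Reach g v u := by
    intro l
    induction l with
    | zero => exact fun v hv => ⟨v, by omega, Reach.refl _ _⟩
    | succ l ih =>
      intro v hv
      rcases Nat.eq_zero_or_pos (lvl v) with h0 | hpos
      · exact ⟨v, h0, Reach.refl _ _⟩
      · obtain ⟨r, hr, k, hk⟩ := hex v hpos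
        have hstep : ∀ j, (∃ r, R r ∧ lvl r = lvl v ∧ Reach g v r) ∨ Reach g v (f^[j] v) := by
          intro j
          induction j with
          | zero => exact Or.inr (Reach.refl _ _)
          | succ j ihj =>
            rcases ihj with h | h
            · exact Or.inl h
            · by_cases hRu : R (f^[j] v)
              · exact Or.inl ⟨_, hRu, hlf' _ _ ⟨j, rfl⟩, h⟩
              · right
                rw [iterate_succ_apply']
                exact h.trans (hA' _ hRu)
        have : ∃ r, R r ∧ lvl r = lvl v ∧ Reach g v r := by
          rcases hstep k with h | h
          · exact h
          · rw [hk] at h; exact ⟨r, hr, hlf' _ _ ⟨k, hk⟩, h⟩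
        obtain ⟨r, hr, hl, hreach⟩ := this
        have h1 := hRc r hr
        obtain ⟨u, hu, hreach'⟩ := ih (f (c r)) (by rw [hlf]; omega)
        exact ⟨u, hu, (hreach.trans ⟨1, hg1 r (Or.inl hr)⟩).trans hreach'⟩
  have hC : ∀ u w, lvl u = 0 → lvl w = 0 → Reach g u w := by
    intro u w hu hw
    obtain ⟨k, rfl⟩ := hroot u w hu hw
    clear hw
    induction k with
    | zero => exact Reach.refl _ _
    | succ k ih =>
      rw [iterate_succ_apply']
      refine ih.trans (hA' _ fun hR => ?_)
      have := (hRc _ hR).1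
      rw [hlf' u _ ⟨k, rfl⟩] at this
      omega
  obtain ⟨v₀, hv₀, hv⟩ := hB _ v le_rfl
  obtain ⟨w₀, hw₀, hw⟩ := hB _ w le_rfl
  exact (hv.trans (hC _ _ hv₀ hw₀)).trans (hw.symm hg)

theorem iterate_of_transitive {V : Type*} [Fintype V] {g : V → V} (hg : Injective g)
    (h : ∀ v w, Reach g v w) (v : V) :
    g^[Fintype.card V] v = v ∧
      (∀ i j, i < Fintype.card V → j < Fintype.card V → g^[i] v = g^[j] v → i = j) ∧
      ∀ w, ∃ i < Fintype.card V, g^[i] v = w := by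
  have hv := hg.mem_periodicPts v
  have hpos := minimalPeriod_pos_of_mem_periodicPts hv
  have hsurj : ∀ w, ∃ i < minimalPeriod g v, g^[i] v = w := by
    intro w
    obtain ⟨k, hk⟩ := h v w
    exact ⟨k % minimalPeriod g v, Nat.mod_lt _ hpos, by rw [iterate_mod_minimalPeriod_eq, hk]⟩
  have hinj : ∀ i j, i < minimalPeriod g v → j < minimalPeriod g v →
      g^[i] v = g^[j] v → i = j := fun i j hi hj hij =>
    (iterate_eq_iterate_iff_of_lt_minimalPeriod hi hj).1 hij
  have hcard : Fintype.card V = minimalPeriod g v := by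
    have hb : Bijective (fun i : Fin (minimalPeriod g v) => g^[i] v) :=
      ⟨fun i j hij => Fin.ext (hinj i j i.2 j.2 hij), fun w => by
        obtain ⟨i, hi, hw⟩ := hsurj w
        exact ⟨⟨i, hi⟩, hw⟩⟩
    rw [← Fintype.card_of_bijective hb, Fintype.card_fin]
  rw [hcard]
  exact ⟨iterate_minimalPeriod, hinj, hsurj⟩

/-! ### The successor rule on the strings of length `n` -/

/-- The difference word of a string. -/
def diffWord : List Bool → List Bool
  | a :: b :: l => (a ^^ b) :: diffWord (b :: l)
  | _ => []

theorem diffWord_dec (h : Bool) (d : List Bool) : diffWord (dec h d) = d := by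
  induction d generalizing h with
  | nil => rfl
  | cons c d ih =>
    have := ih (h ^^ c)
    obtain ⟨l, hl⟩ := dec_head (h ^^ c) d
    rw [dec, hl, diffWord, ← hl, this]
    simp

/-- The key of a string. -/
noncomputable def stringKey (w : List Bool) : List Bool ×ₗ ℕ := key (w.headD false) (diffWord w)

theorem stringKey_dec (h : Bool) (d : List Bool) : stringKey (dec h d) = key h d := by
  obtain ⟨l, hl⟩ := dec_head h d
  rw [stringKey, diffWord_dec, hl]
  rfl

theorem exists_dec_cons {w : List Bool} (hw : 2 ≤ w.length) : ∃ h c d, w = dec h (c :: d) := by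
  obtain ⟨h, d, rfl⟩ := exists_dec (w := w) (by rintro rfl; simp at hw)
  cases d with
  | nil => simp at hw
  | cons c d => exact ⟨h, c, d, rfl⟩

/-- One step of the successor rule. -/
noncomputable def stepS (w : List Bool) : List Bool := shiftRegister succS w

theorem stepS_eq (w : List Bool) : stepS w = w.tail ++ [succS w] := rfl

theorem stepS_of_mem {h c : Bool} {d : List Bool}
    (hr : RepState h (c :: d) ∨ RepState (!h) ((!c) :: d)) :
    stepS (dec h (c :: d)) = prr (conjugate (dec h (c :: d))) := by
  rw [conjugate_dec, prr_dec, stepS, shiftRegister, succS, if_pos, prrFeedback_dec, dec_append]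
  · simp only [dec, List.tail_cons]
    cases h <;> cases c <;> cases par d <;> rfl
  · rwa [conjugate_dec, mem_sameReps_dec (by simp), mem_sameReps_dec (by simp)]

theorem stepS_of_not_mem {h c : Bool} {d : List Bool} (h1 : ¬ RepState h (c :: d))
    (h2 : ¬ RepState (!h) ((!c) :: d)) : stepS (dec h (c :: d)) = prr (dec h (c :: d)) := by
  rw [stepS, shiftRegister, succS, if_neg, prr, shiftRegister]
  rw [conjugate_dec, mem_sameReps_dec (by simp), mem_sameReps_dec (by simp)]
  exact not_or.2 ⟨h1, h2⟩

theorem stepS_length {w : List Bool} (hw : w ≠ []) : (stepS w).length = w.length := by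
  have := List.length_pos_iff.2 hw
  rw [stepS_eq]; simp; omega

theorem RepState.head_false {h c : Bool} {d : List Bool} (hr : RepState h (c :: d)) :
    c = false := by
  obtain ⟨x, hx, -⟩ := hr
  simp at hx; exact hx.1

theorem alt_succ (k : ℕ) : alt (k + 1) = dec (decide (k % 2 = 1)) (ones k) := by
  induction k with
  | zero => rfl
  | succ k ih =>
    rw [alt, ih, ones, ones, List.replicate_succ, dec]
    congr 2
    rcases Nat.mod_two_eq_zero_or_one k with h | h
    · simp [h, Nat.add_mod]
    · simp [h, Nat.add_mod]

theorem seed_eq (k : ℕ) : false :: alt (k + 1) = dec false (par (ones k) :: ones k) := by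
  rw [alt_succ, dec]
  congr 2
  rcases Nat.mod_two_eq_zero_or_one k with h | h
  · simp [par_ones_of_even h, h]
  · simp [par_ones_of_odd h, h]

/-- The key increases along the successor rule, except at the seed. -/
theorem stringKey_le_stepS {n : ℕ} (hn : 2 ≤ n) {w : List Bool} (hw : w.length = n)
    (hseed : w ≠ false :: alt (n - 1)) : stringKey w ≤ stringKey (stepS w) := by
  obtain ⟨h, c, d, rfl⟩ := exists_dec_cons (w := w) (by omega)
  have hseed' : ¬ (h = false ∧ c :: d = par (ones d.length) :: ones d.length) := by
    rintro ⟨rfl, h2⟩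
    apply hseed
    obtain rfl : n = d.length + 1 + 1 := by simpa using hw.symm
    rw [Nat.add_sub_cancel, seed_eq, ← h2]
  by_cases h1 : RepState h (c :: d)
  · obtain rfl := h1.head_false
    rw [stepS_of_mem (Or.inl h1), conjugate_dec, prr_dec, stringKey_dec, stringKey_dec]
    simpa using key_le_conj_step h1 hseed'
  by_cases h2 : RepState (!h) ((!c) :: d)
  · have hc : c = true := by simpa using h2.head_false
    subst hc
    rw [stepS_of_mem (Or.inr h2), conjugate_dec, prr_dec, stringKey_dec, stringKey_dec]
    have := key_conj_le_step h2
    simpa using this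
  · rw [stepS_of_not_mem h1 h2, prr_dec, stringKey_dec, stringKey_dec]
    exact key_le_step h1 h2 hseed'

/-- A string that is followed by a new bit has a larger key than its conjugate. -/
theorem stringKey_conjugate_lt {w : List Bool} (hw : 2 ≤ w.length)
    (hstep : stepS w = w.tail ++ [!(w.getLastD false)]) :
    stringKey (conjugate w) < stringKey w := by
  obtain ⟨h, c, d, rfl⟩ := exists_dec_cons hw
  have hlast : (dec h (c :: d)).getLastD false = (h ^^ c ^^ par d) := by
    rw [List.getLastD_eq_getLast?, dec_getLast?]; simp
  rw [hlast] at hstep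
  rw [conjugate_dec, stringKey_dec, stringKey_dec]
  by_cases h1 : RepState h (c :: d)
  · obtain rfl := h1.head_false
    exact h1.key_conj_lt
  by_cases h2 : RepState (!h) ((!c) :: d)
  · exfalso
    have hc : c = true := by simpa using h2.head_false
    subst hc
    rw [stepS_of_mem (Or.inr h2), conjugate_dec, prr_dec, dec_append] at hstep
    simp only [dec, List.tail_cons] at hstep
    have := congrArg List.getLast? hstep
    simp at this
  · rw [stepS_of_not_mem h1 h2, prr_dec, dec_append] at hstep
    simp only [dec, List.tail_cons] at hstep
    have := congrArg List.getLast? hstep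
    simp only [List.getLast?_append, List.getLast?_singleton, Option.some_or] at this
    cases c with
    | false =>
      exfalso; revert this
      cases h <;> cases par d <;> simp
    | true =>
      have := key_lt_conj h2
      simpa using this

/-! ### The successor rule is a cyclic permutation -/

theorem conjugate_conjugate (w : List Bool) : conjugate (conjugate w) = w := by
  cases w <;> simp [conjugate]

theorem conjugate_length (w : List Bool) : (conjugate w).length = w.length := by
  cases w <;> simp [conjugate]

theorem conjugate_tail (w : List Bool) : (conjugate w).tail = w.tail := by
  cases w <;> rfl

theorem prr_length {w : List Bool} (hw : w ≠ []) : (prr w).length = w.length := by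
  have := List.length_pos_iff.2 hw
  rw [prr, shiftRegister]; simp; omega

theorem prr_injective {w w' : List Bool} (hw : 2 ≤ w.length) (hw' : 2 ≤ w'.length)
    (h : prr w = prr w') : w = w' := by
  obtain ⟨h, c, d, rfl⟩ := exists_dec_cons hw
  obtain ⟨h', c', d', rfl⟩ := exists_dec_cons hw'
  rw [prr_dec, prr_dec] at h
  obtain ⟨h1, h2⟩ := dec_injective h
  obtain ⟨rfl, h3⟩ := List.append_inj' h2 rfl
  obtain rfl : c = c' := by simpa using h3
  rw [Bool.xor_left_inj.1 h1]

theorem prr_iterate_length {w : List Bool} (hw : w ≠ []) (k : ℕ) :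
    (prr^[k] w).length = w.length := by
  induction k with
  | zero => rfl
  | succ k ih =>
    have := List.length_pos_iff.2 hw
    rw [iterate_succ_apply', prr_length (List.length_pos_iff.1 (by omega)), ih]

theorem prr_iterate_injective {k : ℕ} {w w' : List Bool} (hw : 2 ≤ w.length)
    (hw' : 2 ≤ w'.length) (h : prr^[k] w = prr^[k] w') : w = w' := by
  induction k generalizing w w' with
  | zero => exact h
  | succ k ih =>
    have e : ∀ {u : List Bool}, 2 ≤ u.length → (prr u).length = u.length := fun {u} hu =>
      prr_length (List.length_pos_iff.1 (by omega))
    exact prr_injective hw hw' (ih (by rw [e hw]; exact hw) (by rw [e hw']; exact hw') h)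

/-- Strings with the same tail are equal or conjugate, and S complements the feedback for both
members of a conjugate pair or for neither; so injectivity is inherited from PRR. -/
theorem stepS_injective {w w' : List Bool} (hw : 2 ≤ w.length) (hl : w'.length = w.length)
    (h : stepS w = stepS w') : w = w' := by
  obtain ⟨b, c, d, rfl⟩ := exists_dec_cons hw
  obtain ⟨b', c', d', rfl⟩ := exists_dec_cons (w := w') (by omega)
  have ht : dec (b ^^ c) d = dec (b' ^^ c') d' := by
    have := (List.append_inj' h rfl).1
    simpa [dec] using this
  obtain ⟨h1, rfl⟩ := dec_injective ht
  by_contra hne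
  have hbc : b' = !b ∧ c' = !c := by
    cases b <;> cases b' <;> cases c <;> cases c' <;> simp_all
  obtain ⟨rfl, rfl⟩ := hbc
  by_cases hr : RepState b (c :: d) ∨ RepState (!b) ((!c) :: d)
  · have hr' : RepState (!b) ((!c) :: d) ∨ RepState (!(!b)) ((!(!c)) :: d) := by
      simpa using hr.symm
    rw [stepS_of_mem hr, stepS_of_mem hr', conjugate_dec, conjugate_dec] at h
    have := prr_injective (by simp) (by simp) h
    rw [Bool.not_not, Bool.not_not] at this
    exact hne this.symm
  · rw [not_or] at hr
    rw [stepS_of_not_mem hr.1 hr.2, stepS_of_not_mem hr.2 (by simpa using hr.1)] at h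
    exact hne (prr_injective (by simp) (by simp) h)

theorem rle_length_prr {w : List Bool} (hw : 2 ≤ w.length) :
    (rle (prr w)).length = (rle w).length := by
  obtain ⟨h, c, d, rfl⟩ := exists_dec_cons hw
  rw [prr_dec, rle_dec, rle_dec, runs_length, runs_length]
  simp [List.count_cons]

/-- Two RL-reps on a cycle are equal. -/
theorem IsRLRep.eq {σ σ' : List Bool} (h : IsRLRep σ) (h' : IsRLRep σ') (hc : OnCycle σ σ')
    (hc' : OnCycle σ' σ) (hσ : σ ≠ []) (hσ' : σ' ≠ []) : σ = σ' := by
  rcases h σ' hc with h1 | h1 | ⟨h1, h2⟩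
  · exact h1.symm
  · rcases h' σ hc' with h3 | h3 | ⟨h3, h4⟩
    · exact h3
    · exact absurd h1 (lt_asymm h3)
    · rw [h3] at h1; exact absurd h1 (lt_irrefl _)
  · rcases h' σ hc' with h3 | h3 | ⟨h3, h4⟩
    · exact h3
    · rw [h1] at h3; exact absurd h3 (lt_irrefl _)
    · obtain ⟨b, d, rfl⟩ := exists_dec hσ
      obtain ⟨b', d', rfl⟩ := exists_dec hσ'
      rw [rle_dec, rle_dec] at h1
      obtain rfl := runs_injective h1
      obtain ⟨l, hl⟩ := dec_head b d'
      obtain ⟨l', hl'⟩ := dec_head b' d'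
      rw [hl] at h2
      rw [hl'] at h4
      have e1 : b = true := by simpa using h2
      have e2 : b' = true := by simpa using h4
      rw [e1, e2]

/-- The strings of length `n`. -/
abbrev Str (n : ℕ) : Type := {w : List Bool // w.length = n}

instance (n : ℕ) : Fintype (Str n) := inferInstanceAs (Fintype (List.Vector Bool n))

theorem card_str (n : ℕ) : Fintype.card (Str n) = 2 ^ n := by
  have := card_vector (α := Bool) n
  rwa [Fintype.card_bool] at this

/-- `PRR` on the strings of length `n`. -/
def prrStr {n : ℕ} (hn : 2 ≤ n) (v : Str n) : Str n :=
  ⟨prr v.1, by rw [prr_length (List.length_pos_iff.1 (by rw [v.2]; omega)), v.2]⟩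

/-- The successor rule on the strings of length `n`. -/
noncomputable def stepStr {n : ℕ} (hn : 2 ≤ n) (v : Str n) : Str n :=
  ⟨stepS v.1, by rw [stepS_length (List.length_pos_iff.1 (by rw [v.2]; omega)), v.2]⟩

theorem prrStr_iterate {n : ℕ} (hn : 2 ≤ n) (k : ℕ) (v : Str n) :
    ((prrStr hn)^[k] v).1 = prr^[k] v.1 := by
  induction k generalizing v with
  | zero => rfl
  | succ k ih => rw [iterate_succ_apply, iterate_succ_apply, ih]; rfl

theorem stepStr_iterate {n : ℕ} (hn : 2 ≤ n) (k : ℕ) (v : Str n) :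
    ((stepStr hn)^[k] v).1 = stepS^[k] v.1 := by
  induction k generalizing v with
  | zero => rfl
  | succ k ih => rw [iterate_succ_apply, iterate_succ_apply, ih]; rfl

theorem prrStr_injective {n : ℕ} (hn : 2 ≤ n) : Injective (prrStr hn) := fun v w h =>
  Subtype.ext (prr_injective (by rw [v.2]; omega) (by rw [w.2]; omega) (congrArg Subtype.val h))

theorem stepStr_injective {n : ℕ} (hn : 2 ≤ n) : Injective (stepStr hn) := fun v w h =>
  Subtype.ext (stepS_injective (by rw [v.2]; omega) (by rw [v.2, w.2]) (congrArg Subtype.val h))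

theorem onCycle_iff_reach {n : ℕ} (hn : 2 ≤ n) {v w : Str n} :
    OnCycle v.1 w.1 ↔ Reach (prrStr hn) v w := by
  constructor
  · rintro ⟨k, hk⟩
    exact ⟨k, Subtype.ext (by rw [prrStr_iterate, hk])⟩
  · rintro ⟨k, rfl⟩
    exact ⟨k, (prrStr_iterate hn k v).symm⟩

/-- A cycle that is not of run-length `n` contains a same-rep. -/
theorem exists_repState {h : Bool} {d : List Bool} (hf : false ∈ d) :
    ∃ h' d' k l, RepState h' d' ∧ stepState^[k] (h, d) = stepState^[l] (h', d') := by
  obtain ⟨A, B, hAB, hl, hs⟩ := exists_coord (d := d) (by rintro rfl; simp at hf)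
  have hfD : false ∈ B ++ A := by
    rw [hAB] at hf; simp only [List.mem_append] at hf ⊢; tauto
  have h1 : stepState^[A.length] (h, d) = (h ^^ par A, B ++ A) := by
    rw [hAB]; exact stepState_iterate h A B
  -- If an odd cycle meets D with bit 0, one further period leads to D with bit 1.
  obtain ⟨s, k, hk, hRL⟩ : ∃ s k, stepState^[k] (h, d) = (s, B ++ A) ∧ RLState s (B ++ A) := by
    by_cases ho : IsOdd (B ++ A) ∧ (h ^^ par A) = false
    · obtain ⟨A₂, B₂, hAB₂, hl₂, hs₂⟩ := exists_coord (d := B ++ A) (by rintro h; simp [h] at hfD)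
      have hD : B₂ ++ A₂ = B ++ A :=
        (hs.2.1.eq_of_isRotated hs₂.2.1 (isRotated_iff_append.2 ⟨A₂, B₂, hAB₂, rfl⟩)).symm
      have hp : par A₂ = true := by
        rcases ho.1 with h2 | h2
        · exact absurd hfD h2
        · rwa [← hl₂, hAB₂, List.take_left] at h2
      refine ⟨true, A₂.length + A.length, ?_, hs.2.1, fun _ => rfl⟩
      rw [iterate_add_apply, h1, ho.2, hAB₂, stepState_iterate, hp, ← hAB₂, hD]
      rfl
    · refine ⟨_, _, h1, hs.2.1, fun h => ?_⟩
      by_contra hc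
      exact ho ⟨h, by simpa using hc⟩
  by_cases hsp : SpecialState s (B ++ A)
  · obtain ⟨f, y, e, -, -, -, hD⟩ := hsp.2.exists_eq
    exact ⟨s, B ++ A, k, 0, ⟨_, hD, Or.inl ⟨hRL, hsp⟩⟩, hk⟩
  · obtain ⟨γ, i, hD⟩ := exists_last_false hfD
    have e1 : (s ^^ par (ones i) ^^ par (ones i)) = s := by simp
    refine ⟨s ^^ par (ones i), false :: ones i ++ γ, k, (false :: ones i).length,
      ⟨ones i ++ γ, rfl, Or.inr ⟨i, γ, rfl, ?_⟩⟩, ?_⟩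
    · rw [e1, ← hD]; exact ⟨hRL, hsp⟩
    · rw [stepState_iterate, hk, hD, par_cons, Bool.false_xor, e1]

/-- `reach_of_join` applies with the number of zeros of the difference word as level: PRR preserves
it, the flip at a representative lowers it, and level 0 is the single cycle of run-length n. -/
theorem reach_stepStr {n : ℕ} (hn : 2 ≤ n) (v w : Str n) : Reach (stepStr hn) v w := by
  have hlen : ∀ v : Str n, 2 ≤ v.1.length := fun v => by rw [v.2]; omega
  have hdec : ∀ v : Str n, ∃ h c d, v.1 = dec h (c :: d) := fun v => exists_dec_cons (hlen v)
  have hlvl : ∀ {h : Bool} {d : List Bool} (v : Str n), v.1 = dec h d →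
      n - (rle v.1).length = d.count false := by
    intro h d v hv
    have h1 := v.2
    have h2 := count_false_add_count_true d
    rw [hv, dec_length] at h1
    rw [hv, rle_dec, runs_length]
    omega
  refine reach_of_join (f := prrStr hn) (c := fun v => ⟨conjugate v.1, by
    rw [conjugate_length, v.2]⟩) (R := fun v => v.1 ∈ sameReps)
    (lvl := fun v => n - (rle v.1).length) (prrStr_injective hn) (stepStr_injective hn)
    ?_ ?_ ?_ ?_ ?_ ?_ ?_ ?_ v w
  · exact fun v => Subtype.ext (conjugate_conjugate v.1)
  · intro v hR
    obtain ⟨h, c, d, hv⟩ := hdec v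
    refine Subtype.ext ?_
    simp only [hv, conjugate_dec] at hR
    rw [mem_sameReps_dec (by simp), mem_sameReps_dec (by simp)] at hR
    simp only [stepStr, prrStr, hv]
    exact stepS_of_mem hR
  · intro v h1 h2
    obtain ⟨h, c, d, hv⟩ := hdec v
    refine Subtype.ext ?_
    simp only [hv, conjugate_dec] at h1 h2
    rw [mem_sameReps_dec (by simp)] at h1 h2
    simp only [stepStr, prrStr, hv]
    exact stepS_of_not_mem h1 h2
  · intro v
    simp only [prrStr, rle_length_prr (hlen v)]
  · intro v hR
    obtain ⟨h, c, d, hv⟩ := hdec v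
    simp only [hv] at hR
    rw [mem_sameReps_dec (by simp)] at hR
    obtain rfl := hR.head_false
    refine ⟨?_, ?_⟩
    · simp only
      have h1 := hlvl (h := !h) (d := true :: d) ⟨conjugate v.1, by rw [conjugate_length, v.2]⟩
        (by simp [hv, conjugate_dec])
      simp only at h1
      rw [hlvl v hv, h1]
      simp
    · intro h2
      simp only [hv, conjugate_dec] at h2
      rw [mem_sameReps_dec (by simp)] at h2
      simpa using h2.head_false
  · intro v hpos
    obtain ⟨h, c, d, hv⟩ := hdec v
    simp only [hlvl v hv, List.count_pos_iff] at hpos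
    obtain ⟨h', d', k, l, hR, hkl⟩ := exists_repState (h := h) hpos
    have hrl := (stepState_isRotated (h, c :: d) k).perm.length_eq
    have hrl' := (stepState_isRotated (h', d') l).perm.length_eq
    rw [hkl, ← hrl'] at hrl
    have hd' : d' ≠ [] := by rintro rfl; simp at hrl
    have hr : (dec h' d').length = n := by
      have := v.2
      rw [hv] at this
      simp at this hrl ⊢; omega
    refine ⟨⟨dec h' d', hr⟩, (mem_sameReps_dec hd').2 hR, ?_⟩
    have hb : Reach (prrStr hn) ((prrStr hn)^[l] ⟨dec h' d', hr⟩) ⟨dec h' d', hr⟩ :=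
      Reach.symm (prrStr_injective hn) ⟨l, rfl⟩
    refine Reach.trans ⟨k, ?_⟩ hb
    refine Subtype.ext ?_
    rw [prrStr_iterate, prrStr_iterate, hv, prr_iterate_dec _ _ (by simp), hkl,
      prr_iterate_dec _ _ hd']
  · intro r r' hR hR' hreach
    obtain ⟨⟨σ, hc, hRL, hcase⟩, -⟩ := hR
    obtain ⟨⟨σ', hc', hRL', hcase'⟩, -⟩ := hR'
    have hne : ∀ v : Str n, v.1 ≠ [] := fun v => List.length_pos_iff.1 (by have := hlen v; omega)
    have hlσ : ∀ {v : Str n} {σ}, OnCycle v.1 σ → σ.length = n := by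
      rintro v σ ⟨k, rfl⟩
      rw [prr_iterate_length (hne v), v.2]
    let s : Str n := ⟨σ, hlσ hc⟩
    let s' : Str n := ⟨σ', hlσ hc'⟩
    have h1 : Reach (prrStr hn) r s := (onCycle_iff_reach hn (v := r) (w := s)).1 hc
    have h2 : Reach (prrStr hn) r' s' := (onCycle_iff_reach hn (v := r') (w := s')).1 hc'
    have h3 : Reach (prrStr hn) s s' :=
      ((h1.symm (prrStr_injective hn)).trans hreach).trans h2
    have hσ : σ = σ' := hRL.eq hRL' ((onCycle_iff_reach hn (v := s) (w := s')).2 h3)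
      ((onCycle_iff_reach hn (v := s') (w := s)).2 (h3.symm (prrStr_injective hn)))
      (hne s) (hne s')
    subst hσ
    refine Subtype.ext ?_
    rcases hcase with ⟨h4, h5⟩ | ⟨h4, h5⟩
    · rcases hcase' with ⟨h6, h7⟩ | ⟨h6, h7⟩
      · rw [h5, h7]
      · exact absurd h4 h6
    · rcases hcase' with ⟨h6, h7⟩ | ⟨h6, h7⟩
      · exact absurd h6 h4
      · exact prr_iterate_injective (hlen _) (hlen _) (h7.trans h5.symm)
  · intro v w hv hw
    have hones : ∀ v : Str n, n - (rle v.1).length = 0 → ∃ h, v.1 = dec h (ones (n - 1)) := by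
      intro v hv
      obtain ⟨h, c, d, hd⟩ := hdec v
      rw [hlvl v hd] at hv
      have h1 := v.2
      have h2 := count_false_add_count_true (c :: d)
      rw [hd, dec_length] at h1
      exact ⟨h, by rw [hd, ← eq_ones_of_count (y := c :: d) (k := n - 1) (by omega) (by omega)]⟩
    obtain ⟨h, hv⟩ := hones v hv
    obtain ⟨h', hw⟩ := hones w hw
    by_cases he : h = h'
    · exact ⟨0, Subtype.ext (by rw [iterate_zero, id, hv, hw, he])⟩
    · refine ⟨1, Subtype.ext ?_⟩
      obtain ⟨k, rfl⟩ : ∃ k, n = k + 1 + 1 := ⟨n - 2, by omega⟩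
      have e1 : ones (k + 1 + 1 - 1) = true :: ones k := List.replicate_succ
      have e2 : ones k ++ [true] = true :: ones k := by
        rw [← e1]; exact List.replicate_succ'.symm
      rw [iterate_one]
      simp only [prrStr]
      rw [hv, hw, e1, prr_dec, e2]
      congr 1
      cases h <;> cases h' <;> simp_all

end PrefSame

namespace PrefSame

open List Function

/-! ### The sequence produced by the successor rule -/

theorem bitsFrom_length (g : List Bool → Bool) (k : ℕ) (w : List Bool) :
    (bitsFrom g k w).length = k := by
  induction k generalizing w with
  | zero => rfl
  | succ k ih => simp [bitsFrom, ih]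

theorem bitsFrom_add (g : List Bool → Bool) (j m : ℕ) (w : List Bool) :
    bitsFrom g (j + m) w = bitsFrom g j w ++ bitsFrom g m ((shiftRegister g)^[j] w) := by
  induction j generalizing w with
  | zero => simp [bitsFrom]
  | succ j ih =>
    rw [Nat.succ_add, bitsFrom, bitsFrom, ih, iterate_succ_apply, List.cons_append]

theorem append_bitsFrom (g : List Bool → Bool) (k : ℕ) {w : List Bool} (hw : w ≠ []) :
    ∃ P, w ++ bitsFrom g k w = P ++ (shiftRegister g)^[k] w ∧ P.length = k := by
  induction k generalizing w with
  | zero => exact ⟨[], by simp [bitsFrom], rfl⟩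
  | succ k ih =>
    obtain ⟨a, l, rfl⟩ := List.exists_cons_of_ne_nil hw
    obtain ⟨P, hP, hl⟩ := ih (w := shiftRegister g (a :: l)) (by simp [shiftRegister])
    refine ⟨a :: P, ?_, by simp [hl]⟩
    rw [iterate_succ_apply, List.cons_append, List.cons_append, ← hP]
    simp [bitsFrom, shiftRegister]

theorem take_bitsFrom (g : List Bool → Bool) {n k : ℕ} {w : List Bool} (hw : w.length = n)
    (hn : 0 < n) (hk : n ≤ k) : (bitsFrom g k w).take n = (shiftRegister g)^[n] w := by
  obtain ⟨m, rfl⟩ := Nat.exists_eq_add_of_le hk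
  rw [bitsFrom_add, List.take_left' (bitsFrom_length g n w)]
  obtain ⟨P, hP, hl⟩ := append_bitsFrom g n (w := w) (List.length_pos_iff.1 (by omega))
  exact (List.append_inj hP (by omega)).2

/-- The seed of `seqX`, as a string of length `n`. -/
def seed (n : ℕ) : List Bool := false :: alt (n - 1)

theorem seed_length {n : ℕ} (hn : 2 ≤ n) : (seed n).length = n := by
  simp [seed, alt_length]; omega

theorem seed_getLast {n : ℕ} (hn : 2 ≤ n) : (seed n).getLastD false = false := by
  obtain ⟨k, rfl⟩ : ∃ k, n = k + 2 := ⟨n - 2, by omega⟩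
  rw [seed, show k + 2 - 1 = k + 1 from rfl, seed_eq, List.getLastD_eq_getLast?, dec_getLast?]
  simp

theorem stepS_iterate_facts {n : ℕ} (hn : 2 ≤ n) {w : List Bool} (hw : w.length = n) :
    stepS^[2 ^ n] w = w ∧
      (∀ i j, i < 2 ^ n → j < 2 ^ n → stepS^[i] w = stepS^[j] w → i = j) ∧
      ∀ v : List Bool, v.length = n → ∃ i < 2 ^ n, stepS^[i] w = v := by
  obtain ⟨h1, h2, h3⟩ := iterate_of_transitive (stepStr_injective hn) (reach_stepStr hn) ⟨w, hw⟩
  rw [card_str] at h1 h2 h3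
  refine ⟨?_, fun i j hi hj hij => h2 i j hi hj (Subtype.ext ?_), fun v hv => ?_⟩
  · have := congrArg Subtype.val h1
    rwa [stepStr_iterate] at this
  · rw [stepStr_iterate, stepStr_iterate]; exact hij
  · obtain ⟨i, hi, hiv⟩ := h3 ⟨v, hv⟩
    have := congrArg Subtype.val hiv
    rw [stepStr_iterate] at this
    exact ⟨i, hi, this⟩

theorem stepS_iterate_length {n : ℕ} (hn : 2 ≤ n) {w : List Bool} (hw : w.length = n) (k : ℕ) :
    (stepS^[k] w).length = n := by
  have := stepStr_iterate hn k ⟨w, hw⟩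
  rw [← this]
  exact ((stepStr hn)^[k] ⟨w, hw⟩).2

theorem seqX_eq {n : ℕ} (hn : 2 ≤ n) : seqX n = bitsFrom succS (2 ^ n) (seed n) := by
  change bitsFrom succS (2 ^ (seed n).length) (seed n) = _
  rw [seed_length hn]

/-- The cyclic window at position i is the state after n + i steps, and the states run through all
strings once before they repeat. -/
theorem isDeBruijn_seqX {n : ℕ} (hn : 2 ≤ n) : IsDeBruijn n (seqX n) := by
  have hw := seed_length hn
  obtain ⟨hper, -, -⟩ := stepS_iterate_facts hn hw
  have hX := seqX_eq hn
  have hrot : ∀ i < 2 ^ n, ((seqX n).rotate i).take n = stepS^[i] (stepS^[n] (seed n)) := by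
    intro i hi
    obtain ⟨m, hm⟩ := Nat.exists_eq_add_of_le hi.le
    have e1 : (seqX n).rotate i = bitsFrom succS (2 ^ n) (stepS^[i] (seed n)) := by
      have h2 : stepS^[m] (stepS^[i] (seed n)) = seed n := by
        rw [← iterate_add_apply, Nat.add_comm, ← hm, hper]
      have h3 := bitsFrom_add succS m i (stepS^[i] (seed n))
      rw [show (shiftRegister succS)^[m] = stepS^[m] from rfl, h2] at h3
      have h4 := List.rotate_append_length_eq (bitsFrom succS i (seed n))
        (bitsFrom succS m (stepS^[i] (seed n)))
      rw [bitsFrom_length] at h4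
      rw [hX, hm, bitsFrom_add, Nat.add_comm i m, h3]
      exact h4
    rw [e1, take_bitsFrom succS (stepS_iterate_length hn hw i) (by omega) Nat.lt_two_pow_self.le]
    change stepS^[n] (stepS^[i] (seed n)) = _
    rw [← iterate_add_apply, ← iterate_add_apply, Nat.add_comm]
  refine ⟨by rw [hX, bitsFrom_length], fun w hlw => ?_⟩
  obtain ⟨-, hinj, hsurj⟩ := stepS_iterate_facts hn (stepS_iterate_length hn hw n)
  obtain ⟨i, hi, hiw⟩ := hsurj w hlw
  refine ⟨i, ⟨hi, by rw [hrot i hi, hiw]⟩, ?_⟩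
  rintro j ⟨hj, hjw⟩
  rw [hrot j hj] at hjw
  exact hinj j i hj hi (hjw.trans hiw.symm)

/-! ### The greedy construction follows the successor rule -/

/-- The seed is counted as state 2^n instead of state 0, which avoids the only step at which the key
may drop. -/
theorem stringKey_mono {n : ℕ} (hn : 2 ≤ n) {i j : ℕ} (hi : 1 ≤ i) (hij : i ≤ j) (hj : j ≤ 2 ^ n) :
    stringKey (stepS^[i] (seed n)) ≤ stringKey (stepS^[j] (seed n)) := by
  have hw := seed_length hn
  obtain ⟨hper, hinj, -⟩ := stepS_iterate_facts hn hw
  induction j, hij using Nat.le_induction with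
  | base => exact le_rfl
  | succ j hij ih =>
    refine (ih (by omega)).trans ?_
    rw [iterate_succ_apply']
    refine stringKey_le_stepS hn (stepS_iterate_length hn hw j) fun h => ?_
    have := hinj j 0 (by omega) (by omega) h
    omega

theorem exists_iterate_eq {n : ℕ} (hn : 2 ≤ n) {w : List Bool} (hw : w.length = n) :
    ∃ j, 1 ≤ j ∧ j ≤ 2 ^ n ∧ stepS^[j] (seed n) = w := by
  obtain ⟨hper, -, hsurj⟩ := stepS_iterate_facts hn (seed_length hn)
  obtain ⟨j, hj, h⟩ := hsurj w hw
  rcases Nat.eq_zero_or_pos j with rfl | hpos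
  · exact ⟨2 ^ n, Nat.one_le_two_pow, le_rfl, by rw [hper, ← h]; rfl⟩
  · exact ⟨j, hpos, hj.le, h⟩

theorem iterate_injective {n : ℕ} (hn : 2 ≤ n) {i j : ℕ} (hi : 1 ≤ i) (hi' : i ≤ 2 ^ n) (hj : 1 ≤ j) (hj' : j ≤ 2 ^ n)
    (h : stepS^[i] (seed n) = stepS^[j] (seed n)) : i = j := by
  obtain ⟨hper, hinj, -⟩ := stepS_iterate_facts hn (seed_length hn)
  have h0 : ∀ k, k = 2 ^ n → stepS^[k] (seed n) = stepS^[0] (seed n) := by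
    rintro k rfl; exact hper
  rcases hi'.lt_or_eq with h1 | h1 <;> rcases hj'.lt_or_eq with h2 | h2
  · exact hinj i j h1 h2 h
  · rw [h0 j h2] at h
    have := hinj i 0 h1 (by omega) h; omega
  · rw [h0 i h1] at h
    have := hinj 0 j (by omega) h2 h; omega
  · omega

/-- The conjugate of a string that is followed by a new bit occurs earlier. -/
theorem exists_earlier {n : ℕ} (hn : 2 ≤ n) {j : ℕ} (hj : 1 ≤ j)
    (h : stepS (stepS^[j] (seed n)) =
      (stepS^[j] (seed n)).tail ++ [!((stepS^[j] (seed n)).getLastD false)]) :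
    ∃ i, 1 ≤ i ∧ i < j ∧ stepS^[i] (seed n) = conjugate (stepS^[j] (seed n)) := by
  have hl := stepS_iterate_length hn (seed_length hn) j
  have hlt := stringKey_conjugate_lt (w := stepS^[j] (seed n)) (by omega) h
  obtain ⟨i, hi, hi', he⟩ := exists_iterate_eq hn (w := conjugate (stepS^[j] (seed n)))
    (by rw [conjugate_length, hl])
  refine ⟨i, hi, ?_, he⟩
  by_contra hc
  have := stringKey_mono hn hj (by omega) hi'
  rw [he] at this
  exact absurd hlt (not_lt.2 this)

theorem stepS_cases (w : List Bool) : stepS w = w.tail ++ [w.getLastD false] ∨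
    stepS w = w.tail ++ [!(w.getLastD false)] := by
  rw [stepS_eq]
  cases succS w <;> cases w.getLastD false <;> simp

/-- Conjugates have the same tail, so injectivity of the rule forces different new bits. -/
theorem stepS_conjugate {n : ℕ} (hn : 2 ≤ n) {w : List Bool} (hw : w.length = n) {b : Bool}
    (h : stepS w = w.tail ++ [b]) : stepS (conjugate w) = w.tail ++ [!b] := by
  have hne : stepS (conjugate w) ≠ stepS w := by
    intro he
    have := stepS_injective (by rw [conjugate_length, hw]; exact hn) (by rw [conjugate_length]) he
    cases w with
    | nil => simp at hw; omega
    | cons a w => simp [conjugate] at this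
  rw [stepS_eq, conjugate_tail] at hne ⊢
  rw [h] at hne
  cases b <;> cases hc : succS (conjugate w) <;> simp [hc] at hne ⊢

theorem getLastD_conjugate {n : ℕ} (hn : 2 ≤ n) {w : List Bool} (hw : w.length = n) :
    (conjugate w).getLastD false = w.getLastD false := by
  match w with
  | [] => rfl
  | [a] => simp at hw; omega
  | a :: b :: w => simp [conjugate]

/-- If the seed were followed by 0, its conjugate would be followed by the new bit 1 and would have
a larger key than the seed. But the seed comes last and has the largest key. -/
theorem stepS_seed {n : ℕ} (hn : 2 ≤ n) : stepS (seed n) = alt (n - 1) ++ [true] := by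
  have hl := seed_getLast hn
  have ht : (seed n).tail = alt (n - 1) := rfl
  rcases stepS_cases (seed n) with h | h
  · exfalso
    have hw := seed_length hn
    obtain ⟨hper, -, -⟩ := stepS_iterate_facts hn hw
    have hc := stepS_conjugate hn hw h
    have hcl : (conjugate (seed n)).length = n := by rw [conjugate_length, hw]
    have hlt := stringKey_conjugate_lt (w := conjugate (seed n)) (by omega)
      (by rw [getLastD_conjugate hn hw, conjugate_tail, hc])
    rw [conjugate_conjugate] at hlt
    obtain ⟨j, hj, hj', he⟩ := exists_iterate_eq hn hcl
    have := stringKey_mono hn hj hj' le_rfl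
    rw [hper, he] at this
    exact absurd hlt (not_lt.2 this)
  · rw [h, hl, ht]; rfl

/-- The string, seed included, after `k + 1` bits. -/
theorem createsDuplicate_iff {n : ℕ} (hn : 2 ≤ n) {K : ℕ} (hK : 1 ≤ K) (b : Bool) :
    CreatesDuplicate n (alt (n - 1) ++ bitsFrom succS K (seed n)) b ↔
      ∃ j, 1 ≤ j ∧ j ≤ K ∧ (stepS^[K] (seed n)).tail ++ [b] = stepS^[j] (seed n) := by
  have hw := seed_length hn
  have hlen := fun j => stepS_iterate_length hn hw j
  have hP : ∀ j, ∃ P, seed n ++ bitsFrom succS j (seed n) = P ++ stepS^[j] (seed n) ∧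
      P.length = j := fun j => append_bitsFrom succS j (by rw [seed]; simp)
  have hsuf : (alt (n - 1) ++ bitsFrom succS K (seed n) ++ [b]).rtake n =
      (stepS^[K] (seed n)).tail ++ [b] := by
    obtain ⟨P, hP1, hP2⟩ := hP K
    have hne : stepS^[K] (seed n) ≠ [] := List.length_pos_iff.1 (by rw [hlen]; omega)
    obtain ⟨a, l, hal⟩ := List.exists_cons_of_ne_nil hne
    obtain ⟨p, P, rfl⟩ := List.exists_cons_of_ne_nil (l := P)
      (List.length_pos_iff.1 (by omega))
    have h1 : alt (n - 1) ++ bitsFrom succS K (seed n) = P ++ a :: l := by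
      rw [hal, seed, List.cons_append, List.cons_append, List.cons.injEq] at hP1
      exact hP1.2
    have hl : l.length + 1 = n := by
      have := hlen K
      rw [hal] at this; simpa using this
    rw [h1, hal, List.rtake_eq_reverse_take_reverse]
    have : (P ++ a :: l ++ [b]).reverse = (l ++ [b]).reverse ++ (P ++ [a]).reverse := by simp
    rw [this, List.take_left' (by simp [hl]), List.reverse_reverse, List.tail_cons]
  rw [CreatesDuplicate, hsuf]
  constructor
  · rintro ⟨s, t, hst⟩
    have hl1 : ((stepS^[K] (seed n)).tail ++ [b]).length = n := by
      simp [hlen]; omega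
    have hlen2 := congrArg List.length hst
    simp only [List.length_append, alt_length, bitsFrom_length] at hlen2
    rw [List.length_append] at hl1
    -- The string lacks the first letter of the seed; putting it back shifts positions by one, so an
    -- occurrence behind `s` is the state number |s| + 1.
    refine ⟨s.length + 1, by omega, by omega, ?_⟩
    obtain ⟨m, rfl⟩ : ∃ m, K = s.length + 1 + m := ⟨K - (s.length + 1), by omega⟩
    obtain ⟨P, hP1, hP2⟩ := hP (s.length + 1)
    have h2 : false :: s ++ ((stepS^[s.length + 1 + m] (seed n)).tail ++ [b] ++ t) =
        P ++ (stepS^[s.length + 1] (seed n) ++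
          bitsFrom succS m ((shiftRegister succS)^[s.length + 1] (seed n))) := by
      rw [← List.append_assoc P, ← hP1, List.append_assoc (seed n), ← bitsFrom_add]
      conv_rhs => rw [seed]
      rw [List.cons_append, List.cons_append, ← seed, ← hst]
      simp
    have h3 := (List.append_inj h2 (by simp [hP2])).2
    exact (List.append_inj h3 (by rw [hlen, List.length_append]; exact hl1)).1
  · rintro ⟨j, hj, hjK, he⟩
    rw [he]
    obtain ⟨m, rfl⟩ := Nat.exists_eq_add_of_le hjK
    obtain ⟨P, hP1, hP2⟩ := hP j
    obtain ⟨p, P, rfl⟩ := List.exists_cons_of_ne_nil (l := P)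
      (List.length_pos_iff.1 (by omega))
    have h1 : alt (n - 1) ++ bitsFrom succS j (seed n) = P ++ stepS^[j] (seed n) := by
      conv_lhs at hP1 => rw [seed]
      rw [List.cons_append, List.cons_append, List.cons.injEq] at hP1
      exact hP1.2
    rw [bitsFrom_add, ← List.append_assoc, h1]
    exact ⟨P, _, rfl⟩

theorem getLastD_append_bitsFrom {n : ℕ} (hn : 2 ≤ n) (K : ℕ) :
    (alt (n - 1) ++ bitsFrom succS K (seed n)).getLastD false =
      (stepS^[K] (seed n)).getLastD false := by
  obtain ⟨P, hP1, -⟩ := append_bitsFrom succS K (w := seed n) (by rw [seed]; simp)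
  change _ = P ++ stepS^[K] (seed n) at hP1
  have hne : alt (n - 1) ≠ [] := List.length_pos_iff.1 (by rw [alt_length]; omega)
  have h1 : (seed n ++ bitsFrom succS K (seed n)).getLastD false =
      (alt (n - 1) ++ bitsFrom succS K (seed n)).getLastD false := by
    conv_lhs => rw [seed]
    rw [List.cons_append, ← seed]
    obtain ⟨a, l, hal⟩ := List.exists_cons_of_ne_nil hne
    rw [hal]
    simp
  have hne2 : stepS^[K] (seed n) ≠ [] :=
    List.length_pos_iff.1 (by rw [stepS_iterate_length hn (seed_length hn)]; omega)
  rw [← h1, hP1, List.getLastD_eq_getLast?, List.getLastD_eq_getLast?,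
    List.getLast?_append_of_ne_nil _ hne2]

theorem bitsFrom_succ_append {n : ℕ} (K : ℕ) {b : Bool}
    (h : stepS (stepS^[K] (seed n)) = (stepS^[K] (seed n)).tail ++ [b]) :
    alt (n - 1) ++ bitsFrom succS (K + 1) (seed n) =
      alt (n - 1) ++ bitsFrom succS K (seed n) ++ [b] := by
  rw [stepS_eq] at h
  have : succS (stepS^[K] (seed n)) = b := by simpa using h
  rw [bitsFrom_add, ← List.append_assoc]
  congr 1
  simp only [bitsFrom]
  rw [← this]
  rfl

/-- The bit chosen by S is never a duplicate, since the states are distinct. If it is the opposite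
bit, the conjugate occurred at some earlier time i, and state i + 1 is the string that the same bit
would repeat. -/
theorem preferSameStep_bitsFrom {n : ℕ} (hn : 2 ≤ n) {K : ℕ} (hK : 1 ≤ K) (hK' : K < 2 ^ n) :
    preferSameStep n (alt (n - 1) ++ bitsFrom succS K (seed n)) =
      alt (n - 1) ++ bitsFrom succS (K + 1) (seed n) := by
  have hw := seed_length hn
  have hl := stepS_iterate_length hn hw K
  have hnew : ∀ b, stepS (stepS^[K] (seed n)) = (stepS^[K] (seed n)).tail ++ [b] →
      ¬ CreatesDuplicate n (alt (n - 1) ++ bitsFrom succS K (seed n)) b := by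
    intro b hb
    rw [createsDuplicate_iff hn hK, ← hb]
    rintro ⟨j, hj, hjK, he⟩
    rw [← iterate_succ_apply' stepS] at he
    have := iterate_injective hn (by omega) (by omega) hj (by omega) he
    omega
  rw [preferSameStep, getLastD_append_bitsFrom hn]
  rcases stepS_cases (stepS^[K] (seed n)) with h | h
  · rw [if_pos (hnew _ h), bitsFrom_succ_append K h]
  · obtain ⟨i, hi, hiK, he⟩ := exists_earlier hn hK h
    have hdup : CreatesDuplicate n (alt (n - 1) ++ bitsFrom succS K (seed n))
        ((stepS^[K] (seed n)).getLastD false) := by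
      rw [createsDuplicate_iff hn hK]
      refine ⟨i + 1, by omega, by omega, ?_⟩
      have := stepS_conjugate hn hl h
      rw [Bool.not_not] at this
      rw [iterate_succ_apply', he, this]
    rw [if_neg (not_not.2 hdup), if_pos (hnew _ h), bitsFrom_succ_append K h]

theorem seqX_eq_preferSame {n : ℕ} (hn : 2 ≤ n) : seqX n = preferSame n := by
  have hw := seed_length hn
  have hX := seqX_eq hn
  have hit : ∀ k < 2 ^ n, (preferSameStep n)^[k] (alt (n - 1) ++ [true]) =
      alt (n - 1) ++ bitsFrom succS (k + 1) (seed n) := by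
    intro k
    induction k with
    | zero =>
      intro _
      have := stepS_seed hn
      rw [stepS_eq] at this
      have hs : succS (seed n) = true := by
        have := (List.append_inj' this rfl).2
        simpa using this
      simp [bitsFrom, hs]
    | succ k ih =>
      intro hk
      rw [iterate_succ_apply', ih (by omega), preferSameStep_bitsFrom hn (by omega) hk]
  have hpos : 0 < 2 ^ n := Nat.two_pow_pos n
  have hfin : preferSameRaw n = alt (n - 1) ++ bitsFrom succS (2 ^ n) (seed n) := by
    have h1 := hit (2 ^ n - 1) (by omega)
    -- After 2^n bits every string has occurred. The initial string contains the first bit already,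
    -- so of the 2^n rounds the last one appends nothing.
    have hdup : ∀ b, CreatesDuplicate n (alt (n - 1) ++ bitsFrom succS (2 ^ n) (seed n)) b := by
      intro b
      rw [createsDuplicate_iff hn hpos]
      obtain ⟨j, hj, hj', he⟩ := exists_iterate_eq hn
        (w := (stepS^[2 ^ n] (seed n)).tail ++ [b])
        (by simp [stepS_iterate_length hn hw]; omega)
      exact ⟨j, hj, hj', he.symm⟩
    rw [Nat.sub_add_cancel hpos] at h1
    rw [preferSameRaw]
    conv_lhs => rw [← Nat.sub_add_cancel hpos]
    rw [iterate_succ_apply', h1, preferSameStep, if_neg (not_not.2 (hdup _)),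
      if_neg (not_not.2 (hdup _))]
  rw [preferSame, hfin, List.drop_left' (alt_length _), hX]

end PrefSame

namespace PrefSame

namespace Ram

open Function

/-! ### Verification conditions for programs of the random access machine -/

/-- The bit that tells whether `x = y`. -/
def eqBit (x y : ℕ) : ℕ := if x = y then 1 else 0

/-- The bit that tells whether `x < y`. -/
def ltBit (x y : ℕ) : ℕ := if x < y then 1 else 0

/-- The value of an expression in terms of the variables and the arrays. -/
def ev (v : ℕ → ℕ) (a : ℕ → ℕ → ℕ) : Expr → ℕ
  | .const k => k
  | .var x => v x
  | .get b i => a b (ev v a i)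
  | .add e f => ev v a e + ev v a f
  | .sub e f => ev v a e - ev v a f
  | .lt e f => ltBit (ev v a e) (ev v a f)
  | .eq e f => eqBit (ev v a e) (ev v a f)

theorem eval_eq_ev (s : State) (e : Expr) : e.eval s = ev s.var s.arr e := by
  induction e with
  | const k => rfl
  | var x => rfl
  | get b i ih => simp [Expr.eval, ev, ih]
  | add e f ihe ihf => simp [Expr.eval, ev, ihe, ihf]
  | sub e f ihe ihf => simp [Expr.eval, ev, ihe, ihf]
  | lt e f ihe ihf => simp [Expr.eval, ev, ltBit, ihe, ihf]
  | eq e f ihe ihf => simp [Expr.eval, ev, eqBit, ihe, ihf]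

/-- From every state with the given variables and arrays, `c` halts silently within `T` steps in a
state whose variables and arrays satisfy `Q`. -/
def Ok (B : ℕ) (c : Cmd) (T : ℕ) (v : ℕ → ℕ) (a : ℕ → ℕ → ℕ)
    (Q : (ℕ → ℕ) → (ℕ → ℕ → ℕ) → Prop) : Prop :=
  ∀ s : State, s.var = v → s.arr = a →
    ∃ s', Exec B c s s' ∧ s'.out = s.out ∧ s'.clock ≤ s.clock + T ∧ Q s'.var s'.arr

/-- The worst-case time of a command without loops. -/
def wc : Cmd → ℕ
  | .skip => 1
  | .assign _ e => e.cost + 1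
  | .store _ i e => i.cost + e.cost + 1
  | .output e => e.cost + 1
  | .seq c d => wc c + wc d
  | .ite e c d => e.cost + 1 + max (wc c) (wc d)
  | .loop _ _ => 0

/-- The weakest precondition of a silent command without loops. -/
def wp (B : ℕ) : Cmd → ((ℕ → ℕ) → (ℕ → ℕ → ℕ) → Prop) → (ℕ → ℕ) → (ℕ → ℕ → ℕ) → Prop
  | .skip, Q, v, a => Q v a
  | .assign x e, Q, v, a => ev v a e < B ∧ Q (update v x (ev v a e)) a
  | .store b i e, Q, v, a => ev v a i < B ∧ ev v a e < B ∧
      Q v (update a b (update (a b) (ev v a i) (ev v a e)))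
  | .output _, _, _, _ => False
  | .seq c d, Q, v, a => wp B c (wp B d Q) v a
  | .ite e c d, Q, v, a => (ev v a e ≠ 0 → wp B c Q v a) ∧ (ev v a e = 0 → wp B d Q v a)
  | .loop _ _, _, _, _ => False

variable {B T T' : ℕ} {v : ℕ → ℕ} {a : ℕ → ℕ → ℕ} {Q Q' : (ℕ → ℕ) → (ℕ → ℕ → ℕ) → Prop}

theorem Ok.mono {c : Cmd} (h : Ok B c T v a Q) (hT : T ≤ T') (hQ : ∀ v a, Q v a → Q' v a) :
    Ok B c T' v a Q' := by
  intro s hv ha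
  obtain ⟨s', h1, h2, h3, h4⟩ := h s hv ha
  exact ⟨s', h1, h2, by omega, hQ _ _ h4⟩

theorem Ok.seq {c d : Cmd} (hc : Ok B c T v a Q) (hd : ∀ v a, Q v a → Ok B d T' v a Q') :
    Ok B (.seq c d) (T + T') v a Q' := by
  intro s hv ha
  obtain ⟨s₁, h1, h2, h3, h4⟩ := hc s hv ha
  obtain ⟨s₂, h5, h6, h7, h8⟩ := hd _ _ h4 s₁ rfl rfl
  exact ⟨s₂, .seq _ _ _ _ _ h1 h5, h6.trans h2, by omega, h8⟩

theorem ok_of_wp {c : Cmd} (h : wp B c Q v a) : Ok B c (wc c) v a Q := by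
  induction c generalizing v a Q with
  | skip => exact fun s hv ha => ⟨_, .skip s, rfl, le_rfl, by subst hv ha; exact h⟩
  | assign x e =>
    intro s hv ha
    subst hv ha
    rw [wp, ← eval_eq_ev] at h
    exact ⟨_, .assign s x e h.1, rfl, le_rfl, h.2⟩
  | store b i e =>
    intro s hv ha
    subst hv ha
    rw [wp, ← eval_eq_ev, ← eval_eq_ev] at h
    exact ⟨_, .store s b i e h.1 h.2.1, rfl, le_rfl, h.2.2⟩
  | output e => exact h.elim
  | seq c d ihc ihd => exact Ok.seq (ihc h) fun v a h => ihd h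
  | ite e c d ihc ihd =>
    intro s hv ha
    subst hv ha
    rw [wp, ← eval_eq_ev] at h
    by_cases he : e.eval s = 0
    · obtain ⟨s', h1, h2, h3, h4⟩ := ihd (h.2 he) (s.tick (e.cost + 1)) rfl rfl
      refine ⟨s', .ite_false _ _ _ _ _ he h1, h2, h3.trans ?_, h4⟩
      simp only [State.tick, wc]
      have := le_max_right (wc c) (wc d)
      omega
    · obtain ⟨s', h1, h2, h3, h4⟩ := ihc (h.1 he) (s.tick (e.cost + 1)) rfl rfl
      refine ⟨s', .ite_true _ _ _ _ _ he h1, h2, h3.trans ?_, h4⟩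
      simp only [State.tick, wc]
      have := le_max_left (wc c) (wc d)
      omega
  | loop e c => exact h.elim

/-- The rule for loops that count the variable `x` up to the value of the variable `y`. -/
theorem ok_loop {c : Cmd} {x y hi : ℕ} {I : ℕ → (ℕ → ℕ) → (ℕ → ℕ → ℕ) → Prop}
    (hI : ∀ j v a, I j v a → v x = j ∧ v y = hi)
    (hc : ∀ j v a, j < hi → I j v a → Ok B c T v a (I (j + 1))) (k : ℕ) :
    ∀ j v a, j + k = hi → I j v a →
      Ok B (.loop (.lt (.var x) (.var y)) c) (k * (T + 4) + 4) v a (I hi) := by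
  induction k with
  | zero =>
    intro j v a hj h s hv ha
    subst hv ha
    obtain ⟨h1, h2⟩ := hI _ _ _ h
    refine ⟨_, .loop_false s _ c ?_, rfl, ?_, ?_⟩
    · simp only [Expr.eval, h1, h2]; simp; omega
    -- Evaluating x < y costs 3 steps and branching one more; this is the constant 4.
    · simp [State.tick, Expr.cost]
    · obtain rfl : j = hi := by omega
      exact h
  | succ k ih =>
    intro j v a hj h s hv ha
    subst hv ha
    obtain ⟨h1, h2⟩ := hI _ _ _ h
    obtain ⟨s₁, h3, h4, h5, h6⟩ :=
      hc j _ _ (by omega) h (s.tick (Expr.cost (.lt (.var x) (.var y)) + 1)) rfl rfl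
    obtain ⟨s₂, h7, h8, h9, h10⟩ := ih (j + 1) _ _ (by omega) h6 s₁ rfl rfl
    refine ⟨s₂, .loop_true _ _ _ _ _ ?_ h3 h7, h8.trans h4, ?_, h10⟩
    · simp only [Expr.eval, h1, h2]; simp; omega
    · simp only [State.tick, Expr.cost] at h5
      have : (k + 1) * (T + 4) = k * (T + 4) + (T + 4) := by ring
      omega

end Ram

end PrefSame

namespace PrefSame

open List

/-! ### A linear test for necklaces -/

/-- The parity of `a 0 + ⋯ + a (j - 1)` for a sequence of bits. -/
def prefixPar (a : ℕ → ℕ) : ℕ → ℕ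
  | 0 => 0
  | j + 1 => 1 - (if prefixPar a j = a j then 1 else 0)

/-- The first `j` letters of `a` have period `p`, no suffix is smaller than the prefix of the same
length, and the proper suffixes that start before position `p` are larger. -/
def PreNeck (a : ℕ → ℕ) (j p : ℕ) : Prop :=
  (∀ i, p ≤ i → i < j → a i = a (i - p)) ∧
  (∀ t k, 0 < t → t + k < j → (∀ l < k, a (t + l) = a l) → a k ≤ a (t + k)) ∧
  (∀ t, 0 < t → t < p → ∃ k, t + k < j ∧ (∀ l < k, a (t + l) = a l) ∧ a k < a (t + k))

/-- Some suffix of the first `j` letters is smaller than the prefix of the same length. -/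
def NotPreNeck (a : ℕ → ℕ) (j : ℕ) : Prop :=
  ∃ t k, 0 < t ∧ t + k < j ∧ (∀ l < k, a (t + l) = a l) ∧ a (t + k) < a k

/-- By periodicity the match at t is also a match at t - p, where the suffix condition applies. -/
theorem PreNeck.le_shift {a : ℕ → ℕ} {j p : ℕ} (hp0 : 1 ≤ p) (h : PreNeck a j p) {t k : ℕ} (ht : p < t)
    (htk : t + k = j) (he : ∀ l < k, a (t + l) = a l) : a k ≤ a (j - p) := by
  obtain ⟨h1, h2, -⟩ := h
  have := h2 (t - p) k (by omega) (by omega) fun l hl => by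
    rw [← he l hl, h1 (t + l) (by omega) (by omega)]
    congr 1; omega
  rwa [show t - p + k = j - p by omega] at this

/-- Suffixes starting before p have already become larger, the one at p continues the period, and
later ones are shifted back by p. -/
theorem PreNeck.succ_of_eq {a : ℕ → ℕ} {j p : ℕ} (hp0 : 1 ≤ p) (hp : p ≤ j) (h : PreNeck a j p)
    (he : a j = a (j - p)) : PreNeck a (j + 1) p := by
  obtain ⟨h1, h2, h3⟩ := id h
  refine ⟨fun i hi hij => ?_, fun t k ht htk hl => ?_, fun t ht htp => ?_⟩
  · rcases Nat.lt_succ_iff_lt_or_eq.1 hij with hij | rfl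
    · exact h1 i hi hij
    · exact he
  · rcases Nat.lt_succ_iff_lt_or_eq.1 htk with htk | htk
    · exact h2 t k ht htk hl
    · rcases lt_trichotomy t p with htp | rfl | htp
      · obtain ⟨k₀, hk₀, -, hlt⟩ := h3 t ht htp
        rw [hl k₀ (by omega)] at hlt
        exact absurd hlt (lt_irrefl _)
      · rw [htk, he, ← htk, Nat.add_sub_cancel_left]
      · rw [htk, he]
        exact h.le_shift hp0 htp htk hl
  · obtain ⟨k, hk, hk'⟩ := h3 t ht htp
    exact ⟨k, by omega, hk'⟩

/-- A letter above the periodic continuation makes every suffix strictly larger that still matched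
the prefix, so the whole word is the new period. -/
theorem PreNeck.succ_of_lt {a : ℕ → ℕ} {j p : ℕ} (hp0 : 1 ≤ p) (hp : p ≤ j) (h : PreNeck a j p)
    (he : a (j - p) < a j) : PreNeck a (j + 1) (j + 1) := by
  obtain ⟨h1, h2, h3⟩ := id h
  have key : ∀ t, 0 < t → t < j + 1 →
      ∃ k, t + k < j + 1 ∧ (∀ l < k, a (t + l) = a l) ∧ a k < a (t + k) := by
    intro t ht htj
    rcases lt_trichotomy t p with htp | rfl | htp
    · obtain ⟨k, hk, hk'⟩ := h3 t ht htp
      exact ⟨k, by omega, hk'⟩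
    · refine ⟨j - t, by omega, fun l hl => ?_, by rwa [Nat.add_sub_cancel' hp]⟩
      rw [h1 (t + l) (by omega) (by omega), Nat.add_sub_cancel_left]
    · by_cases hex : ∃ k, t + k < j ∧ a (t + k) ≠ a k
      · classical
        have hs := Nat.find_spec hex
        have hm : ∀ l < Nat.find hex, a (t + l) = a l := fun l hl => by
          by_contra hne
          exact Nat.find_min hex hl ⟨by omega, hne⟩
        exact ⟨Nat.find hex, by omega, hm,
          lt_of_le_of_ne (h2 t _ ht hs.1 hm) (Ne.symm hs.2)⟩
      · push Not at hex
        have hl : ∀ l < j - t, a (t + l) = a l := fun l hl => hex l (by omega)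
        have hle := h.le_shift hp0 htp (k := j - t) (by omega) hl
        refine ⟨j - t, by omega, hl, ?_⟩
        rw [show t + (j - t) = j by omega]
        exact hle.trans_lt he
  refine ⟨fun i hi hij => by omega, fun t k ht htk hl => ?_, key⟩
  obtain ⟨k₀, hk₀, hl₀, hlt⟩ := key t ht (by omega)
  rcases lt_trichotomy k k₀ with hk | rfl | hk
  · exact (hl₀ k hk).ge
  · exact hlt.le
  · rw [hl k₀ hk] at hlt
    exact absurd hlt (lt_irrefl _)

theorem PreNeck.not_of_lt {a : ℕ → ℕ} {j p : ℕ} (hp0 : 1 ≤ p) (hp : p ≤ j) (h : PreNeck a j p)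
    (he : a j < a (j - p)) : NotPreNeck a (j + 1) :=
  ⟨p, j - p, hp0, by omega, fun l hl => by
    rw [h.1 (p + l) (by omega) (by omega), Nat.add_sub_cancel_left], by
    rwa [Nat.add_sub_cancel' hp]⟩

theorem toNat_injective {b c : Bool} (h : b.toNat = c.toNat) : b = c := by
  cases b <;> cases c <;> simp_all

theorem lt_of_getD {A D : List Bool} {k : ℕ} (hl : A.length = D.length) (hk : k < A.length)
    (he : ∀ l < k, A.getD l false = D.getD l false) (hA : A.getD k false = false)
    (hD : D.getD k false = true) : A < D := by
  have h1 : ∀ E : List Bool, k < E.length →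
      E = E.take k ++ E.getD k false :: E.drop (k + 1) := by
    intro E hE
    rw [List.getD_eq_getElem _ _ hE, ← List.drop_eq_getElem_cons, List.take_append_drop]
  rw [h1 A hk, h1 D (by omega), append_lt_append_iff (by simp [hl]), hA, hD]
  refine Or.inr ⟨?_, false_cons_lt_true_cons _ _⟩
  refine List.ext_getElem (by simp [hl]) fun l h2 h3 => ?_
  simp only [List.length_take] at h2 h3
  have := he l (by omega)
  rw [List.getD_eq_getElem _ _ (by omega), List.getD_eq_getElem _ _ (by omega)] at this
  simpa using this

theorem getD_rotate {D : List Bool} {k t : ℕ} (hk : k < D.length) :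
    (D.rotate t).getD k false = D.getD ((k + t) % D.length) false := by
  have hk' : k < (D.rotate t).length := by simpa using hk
  rw [List.getD_eq_getElem _ _ hk', List.getElem_rotate, List.getD_eq_getElem]

/-- The letters of `D` are the first values of `a`. -/
def Spells (a : ℕ → ℕ) (D : List Bool) : Prop :=
  ∀ j < D.length, a j = (D.getD j false).toNat

theorem lt_of_spells {a b : ℕ → ℕ} {A D : List Bool} (hA : Spells a A) (hD : Spells b D) {k : ℕ}
    (hl : A.length = D.length) (hk : k < A.length) (he : ∀ l < k, a l = b l) (hlt : a k < b k) :
    A < D := by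
  have e1 := hA k hk
  have e2 := hD k (by omega)
  refine lt_of_getD hl hk (fun l hlk => ?_) ?_ ?_
  · have := he l hlk
    rw [hA l (by omega), hD l (by omega)] at this
    exact toNat_injective this
  · cases h : A.getD k false with
    | false => rfl
    | true =>
      rw [h] at e1
      have := Bool.toNat_le (D.getD k false)
      simp at e1; omega
  · cases h : D.getD k false with
    | true => rfl
    | false => rw [h] at e2; simp at e2; omega

theorem Spells.rotate {a : ℕ → ℕ} {D : List Bool} (h : Spells a D) (hD : 0 < D.length) (t : ℕ) :
    Spells (fun k => a ((k + t) % D.length)) (D.rotate t) := by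
  intro k hk
  rw [List.length_rotate] at hk
  rw [getD_rotate hk, ← h _ (Nat.mod_lt _ hD)]

theorem eq_of_spells {a b : ℕ → ℕ} {A D : List Bool} (hA : Spells a A) (hD : Spells b D)
    (hl : A.length = D.length) (he : ∀ l < A.length, a l = b l) : A = D := by
  refine List.ext_getElem hl fun l h1 h2 => ?_
  have := he l h1
  rw [hA l h1, hD l h2, List.getD_eq_getElem _ _ h1, List.getD_eq_getElem _ _ h2] at this
  exact toNat_injective this

theorem NotPreNeck.not_isNeck {a : ℕ → ℕ} {D : List Bool} (hD : Spells a D)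
    (h : NotPreNeck a D.length) : ¬ IsNeck D := by
  obtain ⟨t, k, ht, htk, he, hlt⟩ := h
  intro hN
  refine absurd (hN (D.rotate t) ⟨t, rfl⟩) (not_le.2 ?_)
  refine lt_of_spells (hD.rotate (by omega) t) hD (by simp) (k := k) (by simp; omega) ?_ ?_
  · intro l hl
    rw [Nat.mod_eq_of_lt (by omega), Nat.add_comm, he l hl]
  · rw [Nat.mod_eq_of_lt (by omega), Nat.add_comm]
    exact hlt

theorem PreNeck.mod {a : ℕ → ℕ} {j p : ℕ} (hp : 1 ≤ p) (h : PreNeck a j p) {i : ℕ} (hi : i < j) :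
    a i = a (i % p) := by
  induction i using Nat.strong_induction_on with
  | _ i ih =>
    rcases lt_or_ge i p with hip | hip
    · rw [Nat.mod_eq_of_lt hip]
    · rw [h.1 i hip hi, ih (i - p) (by omega) (by omega), Nat.mod_eq_sub_mod hip]

/-- If r letters remain after the full periods, moving them to the front reproduces the first r
letters and then compares the prefix with the suffix at r. This suffix is larger since 0 < r < p, so
the rotation is smaller than D. -/
theorem PreNeck.not_isNeck {a : ℕ → ℕ} {D : List Bool} {p : ℕ} (hD : Spells a D) (hp : 1 ≤ p)
    (h : PreNeck a D.length p) (ht : D.length % p ≠ 0) : ¬ IsNeck D := by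
  intro hN
  set r := D.length % p with hr
  have hrp : r < p := Nat.mod_lt _ hp
  have hle : r ≤ D.length := Nat.mod_le _ _
  obtain ⟨k, hk, he, hlt⟩ := h.2.2 r (by omega) hrp
  have hdvd : (D.length - r) % p = 0 := by
    have := Nat.div_add_mod D.length p
    rw [← hr] at this
    rw [← this, Nat.add_sub_cancel]
    exact Nat.mul_mod_right _ _
  refine absurd (hN (D.rotate (D.length - r)) ⟨_, rfl⟩) (not_le.2 ?_)
  have hrot : ∀ l, l < D.length → a ((l + (D.length - r)) % D.length) =
      if l < r then a l else a (l - r) := by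
    intro l hl
    split_ifs with hlr
    · rw [Nat.mod_eq_of_lt (by omega), h.mod hp (by omega), h.mod hp hl, Nat.add_mod, hdvd,
        Nat.add_zero, Nat.mod_mod]
    · rw [show l + (D.length - r) = l - r + D.length by omega, Nat.add_mod_right,
        Nat.mod_eq_of_lt (by omega)]
  refine lt_of_spells (hD.rotate (by omega) _) hD (by simp) (k := r + k) (by simp; omega) ?_ ?_
  · intro l hl
    rw [hrot l (by omega)]
    split_ifs with hlr
    · rfl
    · rw [← he (l - r) (by omega)]
      congr 1; omega
  · rw [hrot _ hk, if_neg (by omega), Nat.add_sub_cancel_left]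
    exact hlt

/-- If p divides the length, a rotation depends only on t mod p, and the suffix at t mod p exceeds
the prefix at a position where no wrap-around occurs. -/
theorem PreNeck.rotate_cases {a : ℕ → ℕ} {D : List Bool} {p : ℕ} (hD : Spells a D) (hp : 1 ≤ p)
    (h : PreNeck a D.length p) (hpos : 0 < D.length) (ht : D.length % p = 0) (t : ℕ) :
    (t % p = 0 → D.rotate t = D) ∧ (t % p ≠ 0 → D < D.rotate t) := by
  have hrot : ∀ l, a ((l + t) % D.length) = a ((l + t) % p) := by
    intro l
    rw [h.mod hp (Nat.mod_lt _ hpos), Nat.mod_mod_of_dvd _ (Nat.dvd_of_mod_eq_zero ht)]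
  constructor
  · intro ht0
    refine eq_of_spells (hD.rotate hpos t) hD (by simp) fun l hl => ?_
    rw [List.length_rotate] at hl
    rw [hrot, h.mod hp hl, Nat.add_mod, ht0, Nat.add_zero, Nat.mod_mod]
  · intro ht0
    obtain ⟨k, hk, he, hlt⟩ := h.2.2 (t % p) (by omega) (Nat.mod_lt _ hp)
    have hrot' : ∀ l, t % p + l < D.length → a ((l + t) % D.length) = a (t % p + l) := by
      intro l hl
      rw [hrot, h.mod hp hl, Nat.add_comm l t]
      simp
    refine lt_of_spells hD (hD.rotate hpos t) (by simp) (k := k) (by omega) ?_ ?_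
    · intro l hl
      rw [hrot' l (by omega), he l hl]
    · rwa [hrot' k hk]

theorem PreNeck.isNeck {a : ℕ → ℕ} {D : List Bool} {p : ℕ} (hD : Spells a D) (hp : 1 ≤ p)
    (h : PreNeck a D.length p) (ht : D.length % p = 0) : IsNeck D := by
  rintro E ⟨t, rfl⟩
  rcases Nat.eq_zero_or_pos D.length with h0 | hpos
  · rw [List.length_eq_zero_iff.1 h0]; simp
  obtain ⟨h1, h2⟩ := h.rotate_cases hD hp hpos ht t
  by_cases ht0 : t % p = 0
  · exact (h1 ht0).ge
  · exact (h2 ht0).le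

theorem PreNeck.idx_eq {a : ℕ → ℕ} {D : List Bool} {p : ℕ} (hD : Spells a D) (hp : 1 ≤ p)
    (hpl : p ≤ D.length) (h : PreNeck a D.length p) (ht : D.length % p = 0) (hf : false ∈ D) :
    idx D = p := by
  have hpos : 0 < D.length := by omega
  have hN := h.isNeck hD hp ht
  have hrot := fun t => h.rotate_cases hD hp hpos ht t
  refine le_antisymm ?_ ?_
  · have h1 := (hrot p).1 (Nat.mod_self p)
    rw [List.rotate_eq_drop_append_take hpl] at h1
    have hs : IsSplit (D.take p) (D.drop p) :=
      isSplit_of_isNeck (by rw [← List.length_pos_iff]; simp; omega) (by rwa [h1]) (by rwa [h1])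
    have := idx_le hs
    rw [List.take_append_drop] at this
    simpa [hpl] using this
  · obtain ⟨A, B, hAB, hl, hs⟩ := exists_coord (d := D) (List.length_pos_iff.1 hpos)
    have hBA : B ++ A = D :=
      (hN.eq_of_isRotated hs.2.1 (isRotated_iff_append.2 ⟨A, B, hAB, rfl⟩)).symm
    by_contra hc
    have hA := List.length_pos_iff.2 hs.1
    have h2 := (hrot A.length).2 (by rw [Nat.mod_eq_of_lt (by omega)]; omega)
    rw [hAB, List.rotate_append_length_eq, hBA, ← hAB] at h2
    exact absurd h2 (lt_irrefl _)

theorem prefixPar_eq {a : ℕ → ℕ} {D : List Bool} (hD : Spells a D) {j : ℕ} (hj : j ≤ D.length) :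
    prefixPar a j = (par (D.take j)).toNat := by
  induction j with
  | zero => rfl
  | succ j ih =>
    rw [prefixPar, ih (by omega), hD j (by omega), List.getD_eq_getElem _ _ (by omega),
      List.take_add_one, List.getElem?_eq_getElem (by omega)]
    simp only [Option.toList, par_append, par_cons, par_nil]
    cases par (D.take j) <;> cases D[j] <;> rfl

/-- The invariant of the necklace test. -/
structure NeckInv (a : ℕ → ℕ) (j p t ok c pp : ℕ) : Prop where
  one_le : 1 ≤ p
  le : p ≤ j
  t_lt : t < p
  ok_le : ok ≤ 1
  c_eq : c = prefixPar a j
  pp_eq : pp = prefixPar a p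
  good : ok = 1 → PreNeck a j p ∧ t = j % p
  bad : ok = 0 → NotPreNeck a j

theorem NeckInv.init (a : ℕ → ℕ) : NeckInv a 1 1 0 1 (prefixPar a 1) (prefixPar a 1) where
  one_le := le_rfl
  le := le_rfl
  t_lt := one_pos
  ok_le := le_rfl
  c_eq := rfl
  pp_eq := rfl
  good := fun _ => ⟨⟨fun i _ _ => by omega, fun t k _ _ => by omega, fun t _ _ => by omega⟩, rfl⟩
  bad := fun h => by simp at h

theorem NotPreNeck.succ {a : ℕ → ℕ} {j : ℕ} (h : NotPreNeck a j) : NotPreNeck a (j + 1) := by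
  obtain ⟨t, k, h1, h2, h3⟩ := h
  exact ⟨t, k, h1, by omega, h3⟩

theorem succ_mod_eq {j p : ℕ} (hp : 1 ≤ p) :
    (j + 1) % p = if j % p + 1 = p then 0 else j % p + 1 := by
  have h1 := Nat.mod_lt j hp
  conv_lhs => rw [← Nat.div_add_mod j p, Nat.add_assoc, Nat.mul_add_mod]
  split_ifs with h
  · rw [h, Nat.mod_self]
  · exact Nat.mod_eq_of_lt (by omega)

section

variable {a : ℕ → ℕ} {j p t ok c pp : ℕ}

theorem NeckInv.step_eq (h : NeckInv a j p t ok c pp) (he : a j = a (j - p)) :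
    NeckInv a (j + 1) p (if t + 1 = p then 0 else t + 1) ok
      (1 - (if c = a j then 1 else 0)) pp where
  one_le := h.one_le
  le := h.le.trans (Nat.le_succ j)
  t_lt := by have := h.t_lt; split_ifs <;> omega
  ok_le := h.ok_le
  c_eq := by rw [prefixPar, h.c_eq]
  pp_eq := h.pp_eq
  good := fun hok => by
    obtain ⟨h1, rfl⟩ := h.good hok
    exact ⟨h1.succ_of_eq h.one_le h.le he, (succ_mod_eq h.one_le).symm⟩
  bad := fun hok => (h.bad hok).succ

theorem NeckInv.step_lt (h : NeckInv a j p t ok c pp) (he : a j < a (j - p)) :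
    NeckInv a (j + 1) p t 0 (1 - (if c = a j then 1 else 0)) pp where
  one_le := h.one_le
  le := h.le.trans (Nat.le_succ j)
  t_lt := h.t_lt
  ok_le := zero_le_one
  c_eq := by rw [prefixPar, h.c_eq]
  pp_eq := h.pp_eq
  good := fun hok => by simp at hok
  bad := fun _ => by
    rcases Nat.le_one_iff_eq_zero_or_eq_one.1 h.ok_le with h0 | h1
    · exact (h.bad h0).succ
    · exact (h.good h1).1.not_of_lt h.one_le h.le he

theorem NeckInv.step_gt (h : NeckInv a j p t ok c pp) (he : a (j - p) < a j) :
    NeckInv a (j + 1) (j + 1) 0 ok (1 - (if c = a j then 1 else 0))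
      (1 - (if c = a j then 1 else 0)) where
  one_le := by omega
  le := le_rfl
  t_lt := by omega
  ok_le := h.ok_le
  c_eq := by rw [prefixPar, h.c_eq]
  pp_eq := by rw [prefixPar, h.c_eq]
  good := fun hok => ⟨(h.good hok).1.succ_of_lt h.one_le h.le he, (Nat.mod_self _).symm⟩
  bad := fun hok => (h.bad hok).succ

/-- D is a necklace iff no smaller suffix was found and p divides the length, which the counter t
shows without a division. Then `idx D` is p, and the parity of the first p letters decides oddness.
-/
theorem NeckInv.rlState_iff {D : List Bool} (h : NeckInv a D.length p t ok c pp)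
    (hD : Spells a D) (hf : false ∈ D) (b : Bool) :
    RLState b D ↔ ok = 1 ∧ t = 0 ∧ (pp = 0 ∨ b = true) := by
  rw [RLState]
  constructor
  · rintro ⟨h1, h2⟩
    have hok : ok = 1 := by
      rcases Nat.le_one_iff_eq_zero_or_eq_one.1 h.ok_le with h0 | h0
      · exact absurd h1 ((h.bad h0).not_isNeck hD)
      · exact h0
    obtain ⟨h3, h4⟩ := h.good hok
    have ht : t = 0 := by
      by_contra hc
      exact h3.not_isNeck hD h.one_le (by omega) h1
    refine ⟨hok, ht, ?_⟩
    by_contra hc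
    rw [not_or] at hc
    apply hc.2 (h2 (Or.inr ?_))
    rw [h3.idx_eq hD h.one_le h.le (by omega) hf]
    have := h.pp_eq
    rw [prefixPar_eq hD h.le] at this
    cases hp : par (D.take p) with
    | true => rfl
    | false => rw [hp] at this; exact absurd this hc.1
  · rintro ⟨hok, ht, hpb⟩
    obtain ⟨h3, h4⟩ := h.good hok
    refine ⟨h3.isNeck hD h.one_le (by omega), fun ho => ?_⟩
    rcases hpb with hpp | hb
    · exfalso
      rcases ho with ho | ho
      · exact ho hf
      · rw [h3.idx_eq hD h.one_le h.le (by omega) hf] at ho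
        have := h.pp_eq
        rw [prefixPar_eq hD h.le, ho] at this
        simp at this; omega
    · exact hb

end

/-! ### A linear test for special words -/

/-- The zeros among the first `j` letters are the first `y` multiples of `g`. -/
def ZerosAt (a : ℕ → ℕ) (j g y : ℕ) : Prop := ∀ i < j, (a i = 0 ↔ g ∣ i ∧ i < y * g)

theorem getD_special (f y e i : ℕ) (hi : i < y * (f + 1) + e) :
    ((List.replicate y (false :: ones f)).flatten ++ ones e).getD i false = false ↔
      (f + 1) ∣ i ∧ i < y * (f + 1) := by
  induction y generalizing i with
  | zero =>
    have : (ones e).getD i false = true := by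
      rw [List.getD_eq_getElem _ _ (by simpa using hi)]; simp
    rw [List.replicate_zero, List.flatten_nil, List.nil_append, this]
    simp
  | succ y ih =>
    rw [List.replicate_succ, List.flatten_cons, List.append_assoc]
    rcases lt_or_ge i (f + 1) with hif | hif
    · rw [List.getD_append _ _ _ _ (by simpa using hif)]
      have hlt : i < (y + 1) * (f + 1) := by rw [Nat.succ_mul]; omega
      cases i with
      | zero => simp
      | succ i =>
        have h1 : (false :: ones f).getD (i + 1) false = true := by
          rw [List.getD_cons_succ, List.getD_eq_getElem _ _ (by simp; omega)]; simp
        rw [h1]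
        have := Nat.not_dvd_of_pos_of_lt (Nat.succ_pos i) hif
        simp only [Bool.true_eq_false, false_iff]
        exact fun h => this h.1
    · rw [List.getD_append_right _ _ _ _ (by simpa using hif)]
      obtain ⟨k, rfl⟩ := Nat.exists_eq_add_of_le hif
      rw [Nat.succ_mul] at hi ⊢
      have hl : (false :: ones f).length = f + 1 := by simp
      rw [hl, Nat.add_sub_cancel_left, ih k (by omega), Nat.dvd_add_right (dvd_refl _)]
      constructor
      · exact fun h => ⟨h.1, by omega⟩
      · exact fun h => ⟨h.1, by omega⟩

/-- Here g = f + 1 is the distance of consecutive zeros, so f is odd iff g is even, and e ≥ 1 says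
that the zeros' blocks end before the word does. -/
theorem specialForm_iff {a : ℕ → ℕ} {D : List Bool} (hD : Spells a D) :
    SpecialForm D ↔ ∃ g y, g % 2 = 0 ∧ 0 < g ∧ 2 ≤ y ∧ y * g < D.length ∧
      ZerosAt a D.length g y := by
  have hbit : ∀ i < D.length, (a i = 0 ↔ D.getD i false = false) := by
    intro i hi
    rw [hD i hi]
    cases D.getD i false <;> simp
  have hlen : ∀ f y e : ℕ, ((List.replicate y (false :: ones f)).flatten ++ ones e).length =
      y * (f + 1) + e := by
    intro f y e
    simp
  constructor
  · rintro ⟨f, y, e, hf, hy, he, hE⟩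
    have hl := hlen f y e
    rw [← hE] at hl
    refine ⟨f + 1, y, by omega, by omega, hy, by omega, fun i hi => ?_⟩
    rw [hbit i hi, ← getD_special f y e i (by omega), ← hE]
  · rintro ⟨g, y, hg, hg0, hy, hyN, hz⟩
    obtain ⟨f, rfl⟩ : ∃ f, g = f + 1 := ⟨g - 1, by omega⟩
    have hl := hlen f y (D.length - y * (f + 1))
    refine ⟨f, y, D.length - y * (f + 1), by omega, hy, by omega, ?_⟩
    refine List.ext_getElem (by rw [hl]; omega) fun i h1 h2 => ?_
    have e1 := hz i h1
    rw [hbit i h1, ← getD_special f y (D.length - y * (f + 1)) i (by omega),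
      List.getD_eq_getElem _ _ h1, List.getD_eq_getElem _ _ h2] at e1
    generalize D[i] = b at e1 ⊢
    generalize ((List.replicate y (false :: ones f)).flatten ++
      ones (D.length - y * (f + 1)))[i] = b' at e1 ⊢
    cases b <;> cases b' <;> simp_all

/-- The invariant of the test for special words. -/
structure SpecialInv (a : ℕ → ℕ) (j g nx sok gp : ℕ) : Prop where
  one_le : 1 ≤ j
  g_lt : g < j
  nx_le : nx ≤ 2 * j
  sok_le : sok ≤ 1
  none : g = 0 → nx = 0 ∧ sok = 1 ∧ ∀ i, 0 < i → i < j → a i ≠ 0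
  good : 0 < g → sok = 1 → gp = g % 2 ∧ ∃ y, 2 ≤ y ∧ nx = y * g ∧ (y - 1) * g < j ∧ ZerosAt a j g y
  bad : sok = 0 → ∀ g' y', 0 < g' → 2 ≤ y' → ¬ ZerosAt a j g' y'

theorem SpecialInv.init (a : ℕ → ℕ) : SpecialInv a 1 0 0 1 0 where
  one_le := le_rfl
  g_lt := one_pos
  nx_le := by omega
  sok_le := le_rfl
  none := fun _ => ⟨rfl, rfl, fun i _ _ => by omega⟩
  good := fun h => by simp at h
  bad := fun h => by simp at h

theorem ZerosAt.mono {a : ℕ → ℕ} {j j' g y : ℕ} (h : ZerosAt a j g y) (hj : j' ≤ j) :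
    ZerosAt a j' g y := fun i hi => h i (by omega)

/-- The first zero after position 0 determines the period. -/
theorem ZerosAt.period_eq {a : ℕ → ℕ} {j g y g' y' : ℕ} (h : ZerosAt a j g y)
    (h' : ZerosAt a j g' y') (hg : 0 < g) (hgj : g < j) (hy : 2 ≤ y) (hg' : 0 < g')
    (hy' : 2 ≤ y') : g' = g := by
  have h1 : a g = 0 := (h g hgj).2 ⟨dvd_rfl, by nlinarith⟩
  have h2 := ((h' g hgj).1 h1).1
  have h3 : g' ≤ g := Nat.le_of_dvd hg h2
  have h4 : a g' = 0 := (h' g' (by omega)).2 ⟨dvd_rfl, by nlinarith⟩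
  exact Nat.dvd_antisymm h2 ((h g' (by omega)).1 h4).1

section

variable {a : ℕ → ℕ} {j g nx sok gp : ℕ}

/-- A one never violates the pattern. If it stands at the expected position nx, then nx stays behind
and every later zero is rejected. -/
theorem SpecialInv.step_ne (h : SpecialInv a j g nx sok gp) (h0 : a j ≠ 0) :
    SpecialInv a (j + 1) g nx sok gp where
  one_le := by omega
  g_lt := h.g_lt.trans (Nat.lt_succ_self j)
  nx_le := h.nx_le.trans (by omega)
  sok_le := h.sok_le
  none := fun hg => by
    obtain ⟨h1, h2, h3⟩ := h.none hg
    refine ⟨h1, h2, fun i hi hij => ?_⟩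
    rcases Nat.lt_succ_iff_lt_or_eq.1 hij with hij | rfl
    · exact h3 i hi hij
    · exact h0
  good := fun hg hs => by
    obtain ⟨h1, y, h2, h3, h4, h5⟩ := h.good hg hs
    by_cases hjy : g ∣ j ∧ j < y * g
    · exfalso
      obtain ⟨⟨q, rfl⟩, hlt⟩ := hjy
      rw [Nat.mul_comm] at h4
      have h6 := Nat.lt_of_mul_lt_mul_left h4
      rw [Nat.mul_comm] at hlt
      have h7 := Nat.lt_of_mul_lt_mul_right hlt
      omega
    · refine ⟨h1, y, h2, h3, by omega, fun i hi => ?_⟩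
      rcases Nat.lt_succ_iff_lt_or_eq.1 hi with hi | rfl
      · exact h5 i hi
      · exact iff_of_false h0 hjy
  bad := fun hs g' y' hg' hy' hz => h.bad hs g' y' hg' hy' (hz.mono (Nat.le_succ j))

theorem SpecialInv.step_first (h : SpecialInv a j g nx sok gp) (ha : a 0 = 0) (h0 : a j = 0)
    (hg : g = 0) {jp : ℕ} (hjp : jp = j % 2) : SpecialInv a (j + 1) j (j + j) sok jp where
  one_le := by omega
  g_lt := Nat.lt_succ_self j
  nx_le := by omega
  sok_le := h.sok_le
  none := fun hj => by have := h.one_le; omega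
  good := fun hj hs => by
    obtain ⟨h1, h2, h3⟩ := h.none hg
    refine ⟨hjp, 2, le_rfl, by omega, by omega, fun i hi => ?_⟩
    rcases Nat.lt_succ_iff_lt_or_eq.1 hi with hi | rfl
    · rcases Nat.eq_zero_or_pos i with rfl | hpos
      · simp [ha, hj]
      · exact iff_of_false (h3 i hpos hi) fun h => Nat.not_dvd_of_pos_of_lt hpos hi h.1
    · exact iff_of_true h0 ⟨dvd_rfl, by omega⟩
  bad := fun hs => by have := (h.none hg).2.1; omega

theorem SpecialInv.step_next (h : SpecialInv a j g nx sok gp) (h0 : a j = 0)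
    (hg : 0 < g) (hj : j = nx) : SpecialInv a (j + 1) g (nx + g) sok gp where
  one_le := by omega
  g_lt := h.g_lt.trans (Nat.lt_succ_self j)
  nx_le := by have := h.g_lt; omega
  sok_le := h.sok_le
  none := fun h => by omega
  good := fun _ hs => by
    obtain ⟨h1, y, h2, h3, h4, h5⟩ := h.good hg hs
    refine ⟨h1, y + 1, by omega, by rw [h3, Nat.succ_mul], by rw [Nat.add_sub_cancel]; omega,
      fun i hi => ?_⟩
    rw [Nat.succ_mul]
    rcases Nat.lt_succ_iff_lt_or_eq.1 hi with hi | rfl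
    · rw [h5 i hi]
      constructor
      · exact fun h => ⟨h.1, by omega⟩
      · exact fun h => ⟨h.1, by omega⟩
    · exact iff_of_true h0 ⟨⟨y, by rw [hj, h3, Nat.mul_comm]⟩, by omega⟩
  bad := fun hs g' y' hg' hy' hz => h.bad hs g' y' hg' hy' (hz.mono (Nat.le_succ j))

/-- Any admissible pattern has the same period g by `ZerosAt.period_eq`, and a zero at j would then
require one at the skipped multiple nx. -/
theorem SpecialInv.step_bad (h : SpecialInv a j g nx sok gp) (h0 : a j = 0)
    (hg : 0 < g) (hj : j ≠ nx) : SpecialInv a (j + 1) g nx 0 gp where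
  one_le := by omega
  g_lt := h.g_lt.trans (Nat.lt_succ_self j)
  nx_le := h.nx_le.trans (by omega)
  sok_le := zero_le_one
  none := fun h => by omega
  good := fun _ hs => by simp at hs
  bad := fun _ g' y' hg' hy' hz => by
    rcases Nat.le_one_iff_eq_zero_or_eq_one.1 h.sok_le with hs | hs
    · exact h.bad hs g' y' hg' hy' (hz.mono (Nat.le_succ j))
    · obtain ⟨h1, y, h2, h3, h4, h5⟩ := h.good hg hs
      obtain rfl := h5.period_eq (hz.mono (Nat.le_succ j)) hg h.g_lt h2 hg' hy'
      obtain ⟨⟨q, hq⟩, hlt⟩ := (hz j (Nat.lt_succ_self j)).1 h0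
      have h6 : y - 1 < q := by
        rw [hq, Nat.mul_comm] at h4
        exact Nat.lt_of_mul_lt_mul_left h4
      have h7 : q ≠ y := by
        rintro rfl
        apply hj; rw [h3, hq, Nat.mul_comm]
      have h8 : nx < j := by
        rw [h3, hq, Nat.mul_comm g' q]
        exact Nat.mul_lt_mul_of_pos_right (by omega) hg
      have h9 : a nx = 0 := (hz nx (by omega)).2 ⟨⟨y, by rw [h3, Nat.mul_comm]⟩, by omega⟩
      have := ((h5 nx h8).1 h9).2
      omega

/-- Since the last zero is at (y - 1)g, no pattern can have fewer than y blocks; so nx = yg fits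
into the word if some pattern does. -/
theorem SpecialInv.specialForm_iff {D : List Bool} (h : SpecialInv a D.length g nx sok gp)
    (hD : Spells a D) :
    SpecialForm D ↔ sok = 1 ∧ 0 < g ∧ gp = 0 ∧ nx < D.length := by
  rw [PrefSame.specialForm_iff hD]
  constructor
  · rintro ⟨g', y', hg2, hg', hy', hlt, hz⟩
    have hs : sok = 1 := by
      rcases Nat.le_one_iff_eq_zero_or_eq_one.1 h.sok_le with h0 | h0
      · exact absurd hz (h.bad h0 g' y' hg' hy')
      · exact h0
    have hgy : g' < y' * g' := by nlinarith
    have hg : 0 < g := by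
      by_contra hc
      refine (h.none (by omega)).2.2 g' hg' (by omega) ?_
      exact (hz g' (by omega)).2 ⟨dvd_rfl, hgy⟩
    obtain ⟨h1, y, h2, h3, h4, h5⟩ := h.good hg hs
    obtain rfl := h5.period_eq hz hg h.g_lt h2 hg' hy'
    refine ⟨hs, hg, by omega, ?_⟩
    by_contra hc
    have h6 : a ((y - 1) * g') = 0 := by
      refine (h5 _ h4).2 ⟨Dvd.intro_left _ rfl, ?_⟩
      exact Nat.mul_lt_mul_of_pos_right (by omega) hg
    have h7 := ((hz _ h4).1 h6).2
    have h8 := Nat.lt_of_mul_lt_mul_right h7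
    have : y * g' ≤ y' * g' := Nat.mul_le_mul_right _ (by omega)
    omega
  · rintro ⟨hs, hg, hgp, hlt⟩
    obtain ⟨h1, y, h2, h3, h4, h5⟩ := h.good hg hs
    exact ⟨g, y, by omega, hg, h2, by omega, h5⟩

end

end PrefSame

namespace PrefSame

open List

/-! ### A criterion for same-reps on the letters of a word -/

theorem ones_append_eq {i k : ℕ} {γ γ' : List Bool} (hγ : γ = [] ∨ ∃ E, γ = false :: E)
    (hγ' : γ' = [] ∨ ∃ E, γ' = false :: E) (h : ones i ++ γ = ones k ++ γ') : i = k ∧ γ = γ' := by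
  induction i generalizing k with
  | zero =>
    cases k with
    | zero => simpa [ones] using h
    | succ k =>
      rcases hγ with rfl | ⟨E, rfl⟩ <;> simp [ones, List.replicate_succ] at h
  | succ i ih =>
    cases k with
    | zero => rcases hγ' with rfl | ⟨E, rfl⟩ <;> simp [ones, List.replicate_succ] at h
    | succ k =>
      simp only [ones, List.replicate_succ, List.cons_append, List.cons.injEq, true_and] at h
      obtain ⟨h1, h2⟩ := ih h
      exact ⟨by rw [h1], h2⟩

/-- If `false` is followed by exactly `o - 1` letters `true`, only one rotation is relevant. -/
theorem repState_iff_rotate {b : Bool} {x : List Bool} {o : ℕ} (ho : 1 ≤ o)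
    (hoN : o ≤ x.length + 1) (h1 : ∀ k, 1 ≤ k → k < o → (false :: x).getD k false = true)
    (h0 : o = x.length + 1 ∨ (false :: x).getD o false = false) :
    RepState b (false :: x) ↔
      (RLState b (false :: x) ∧ SpecialState b (false :: x)) ∨
      (RLState (b ^^ par (ones (o - 1))) ((false :: x).rotate o) ∧
        ¬ SpecialState (b ^^ par (ones (o - 1))) ((false :: x).rotate o)) := by
  obtain ⟨k, rfl⟩ : ∃ k, o = k + 1 := ⟨o - 1, by omega⟩
  have htake : x.take k = ones k := by
    refine List.ext_getElem (by simp; omega) fun l h2 h3 => ?_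
    have hl : l < k := by simpa using h3
    have := h1 (l + 1) (by omega) (by omega)
    rw [List.getD_cons_succ, List.getD_eq_getElem _ _ (by omega)] at this
    simpa using this
  obtain ⟨γ, hx⟩ : ∃ γ, x = ones k ++ γ := ⟨x.drop k, by rw [← htake, List.take_append_drop]⟩
  have hγ : γ = [] ∨ ∃ E, γ = false :: E := by
    cases γ with
    | nil => exact Or.inl rfl
    | cons c γ =>
      rcases h0 with h0 | h0
      · rw [hx] at h0; simp at h0
      · rw [List.getD_cons_succ, hx, List.getD_append_right _ _ _ _ (by simp)] at h0
        simp only [ones, List.length_replicate, Nat.sub_self, List.getD_cons_zero] at h0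
        exact Or.inr ⟨γ, by rw [h0]⟩
  have hrot : (false :: x).rotate (k + 1) = γ ++ false :: ones k := by
    rw [hx, ← List.cons_append, show k + 1 = (false :: ones k).length by simp,
      List.rotate_append_length_eq]
  rw [hrot, Nat.add_sub_cancel]
  constructor
  · rintro ⟨y, hy, h | ⟨i, γ', h2, h3, h4⟩⟩
    · exact Or.inl h
    · obtain rfl : x = y := by simpa using hy
      have hγ' : γ' = [] ∨ ∃ E, γ' = false :: E := by
        obtain ⟨E, hE⟩ := h3.1.head_of_mem (by simp)
        cases γ' with
        | nil => exact Or.inl rfl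
        | cons c γ' => simp at hE; exact Or.inr ⟨γ', by rw [hE.1]⟩
      obtain ⟨rfl, rfl⟩ := ones_append_eq hγ' hγ (h2.symm.trans hx)
      exact Or.inr ⟨h3, h4⟩
  · rintro (h | h)
    · exact ⟨x, rfl, Or.inl h⟩
    · exact ⟨x, rfl, Or.inr ⟨k, γ, hx, h⟩⟩

-- Of w and its conjugate only the one with first difference 0 can be a representative, and its
-- first bit then equals its second bit, which both strings share.
open Classical in
theorem succS_eq {w : List Bool} (hw : 2 ≤ w.length) :
    succS w = (w.getD 0 false ^^ w.getD 1 false ^^ w.getD (w.length - 1) false ^^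
      decide (RepState (w.getD 1 false) (false :: diffWord w.tail))) := by
  obtain ⟨h, c, d, rfl⟩ := exists_dec_cons hw
  have h1 : (dec h (c :: d)).getD 1 false = (h ^^ c) := by
    obtain ⟨l, hl⟩ := dec_head (h ^^ c) d
    simp [dec, hl]
  have h2 : diffWord (dec h (c :: d)).tail = d := by
    rw [dec, List.tail_cons, diffWord_dec]
  have hiff : (dec h (c :: d) ∈ sameReps ∨ conjugate (dec h (c :: d)) ∈ sameReps) ↔
      RepState (h ^^ c) (false :: d) := by
    rw [conjugate_dec, mem_sameReps_dec (by simp), mem_sameReps_dec (by simp)]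
    constructor
    · rintro (hr | hr)
      · obtain rfl := hr.head_false
        simpa using hr
      · obtain hc := hr.head_false
        cases c with
        | false => simp at hc
        | true => simpa using hr
    · intro hr
      cases c with
      | false => exact Or.inl (by simpa using hr)
      | true => exact Or.inr (by simpa using hr)
  have h3 : prrFeedback (dec h (c :: d)) = ((dec h (c :: d)).getD 0 false ^^
    (dec h (c :: d)).getD 1 false ^^ (dec h (c :: d)).getD ((dec h (c :: d)).length - 1) false) :=
    rfl
  rw [succS, h2, ← h3, h1]
  by_cases hR : RepState (h ^^ c) (false :: d)
  · rw [if_pos (hiff.2 hR)]; simp [hR]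
  · rw [if_neg (mt hiff.1 hR)]; simp [hR]

theorem diffWord_length (l : List Bool) : (diffWord l).length = l.length - 1 := by
  induction l with
  | nil => rfl
  | cons a l ih =>
    cases l with
    | nil => rfl
    | cons b l => simp [diffWord, ih]

theorem getD_diffWord {l : List Bool} {j : ℕ} (hj : j + 1 < l.length) :
    (diffWord l).getD j false = (l.getD j false ^^ l.getD (j + 1) false) := by
  induction l generalizing j with
  | nil => simp at hj
  | cons a l ih =>
    cases l with
    | nil => simp at hj
    | cons b l =>
      cases j with
      | zero => simp [diffWord]
      | succ j =>
        rw [diffWord, List.getD_cons_succ, ih (by simpa using hj)]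
        simp

theorem spells_diffWord {a : ℕ → ℕ} {w : List Bool} (h : Spells a w) {j : ℕ} (hj : 1 ≤ j)
    (hj' : j + 1 < w.length) :
    ((false :: diffWord w.tail).getD j false).toNat = 1 - (if a j = a (j + 1) then 1 else 0) := by
  obtain ⟨k, rfl⟩ : ∃ k, j = k + 1 := ⟨j - 1, by omega⟩
  cases w with
  | nil => simp at hj'
  | cons c w =>
    rw [h _ (by omega), h _ hj', List.getD_cons_succ, List.getD_cons_succ, List.tail_cons,
      List.getD_cons_succ, getD_diffWord (by simpa using hj')]
    cases w.getD k false <;> cases w.getD (k + 1) false <;> rfl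

end PrefSame

namespace PrefSame

namespace Ram

open Function

/-! ### The programs

Variable 0 holds `n`, variable 1 holds `n - 1`, array 0 the current string `w`, array 1 two copies
of `0` followed by the differences of `w₂⋯wₙ`, and array 2 the seed. -/

/-- The command `c₁; …; cₖ`. -/
def block : List Cmd → Cmd
  | [] => .skip
  | [c] => c
  | c :: l => .seq c (block l)

/-- `while x < y do c`. -/
def upto (x y : ℕ) (c : Cmd) : Cmd := .loop (.lt (.var x) (.var y)) c

/-- `e + k`. -/
def Expr.plus (e : Expr) (k : ℕ) : Expr := .add e (.const k)

/-- `1 - e`. -/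
def Expr.not (e : Expr) : Expr := .sub (.const 1) e

/-- The exclusive or of two bits. -/
def Expr.xor (e f : Expr) : Expr := .not (.eq e f)

/-- One step of the necklace test for the letters of array 1 from position `var 8` on. -/
def neckBody : Cmd := block [
  .assign 16 (.get 1 (.add (.var 8) (.var 15))),
  .assign 17 (.get 1 (.sub (.add (.var 8) (.var 15)) (.var 10))),
  .assign 13 (.xor (.var 13) (.var 16)),
  .assign 15 (.plus (.var 15) 1),
  .ite (.eq (.var 16) (.var 17))
    (block [.assign 11 (.plus (.var 11) 1),
      .ite (.eq (.var 11) (.var 10)) (.assign 11 (.const 0)) .skip])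
    (.ite (.lt (.var 16) (.var 17)) (.assign 12 (.const 0))
      (block [.assign 10 (.var 15), .assign 11 (.const 0), .assign 14 (.var 13)]))]

/-- Preparation of the necklace test. -/
def neckInit : Cmd := block [
  .assign 10 (.const 1), .assign 11 (.const 0), .assign 12 (.const 1),
  .assign 13 (.xor (.const 0) (.get 1 (.var 8))), .assign 14 (.var 13), .assign 15 (.const 1)]

/-- One step of the test for special words. -/
def specialBody : Cmd := block [
  .ite (.get 1 (.add (.var 8) (.var 15))) .skip
    (.ite (.var 18)
      (.ite (.eq (.var 15) (.var 19)) (.assign 19 (.add (.var 19) (.var 18)))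
        (.assign 20 (.const 0)))
      (block [.assign 18 (.var 15), .assign 19 (.add (.var 15) (.var 15)),
        .assign 21 (.var 22)])),
  .assign 15 (.plus (.var 15) 1),
  .assign 22 (.not (.var 22))]

/-- Preparation of the test for special words. -/
def specialInit : Cmd := block [
  .assign 15 (.const 1), .assign 18 (.const 0), .assign 19 (.const 0), .assign 20 (.const 1),
  .assign 21 (.const 0), .assign 22 (.const 1)]

/-- Combine the results of the two tests. -/
def testEnd : Cmd := block [
  .assign 23 (.eq (.add (.var 12) (.add (.eq (.var 11) (.const 0))
    (.lt (.const 0) (.add (.eq (.var 14) (.const 0)) (.var 9))))) (.const 3)),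
  .assign 24 (.eq (.add (.eq (.var 9) (.const 0)) (.add (.var 20) (.add
    (.lt (.const 0) (.var 18)) (.add (.eq (.var 21) (.const 0))
      (.lt (.var 19) (.var 1)))))) (.const 5))]

/-- Test the state whose word starts at position `var 8` of array 1 and whose first bit is
`var 9`: variable 23 tells whether it belongs to an RL-rep, and variable 24 whether it is special. -/
def test : Cmd := block [
  .seq neckInit (upto 15 1 neckBody), .seq specialInit (upto 15 1 specialBody), testEnd]

variable {B N : ℕ} {v : ℕ → ℕ} {a : ℕ → ℕ → ℕ}

theorem bit_ne_zero {p : Prop} [Decidable p] : (if p then 1 else 0) ≠ 0 ↔ p := by simp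

theorem bit_eq_zero {p : Prop} [Decidable p] : (if p then 1 else 0) = 0 ↔ ¬p := by simp

theorem neck_ok {D : List Bool} (hN : v 1 = D.length) (hpos : 1 ≤ D.length)
    (hD : Spells (fun i => a 1 (v 8 + i)) D) (hB : D.length + 2 < B) :
    Ok B (.seq neckInit (upto 15 1 neckBody)) (wc neckInit + (D.length * (wc neckBody + 4) + 4)) v a
      (fun v' a' => a' = a ∧ (∀ x < 10, v' x = v x) ∧
        NeckInv (fun i => a 1 (v 8 + i)) D.length (v' 10) (v' 11) (v' 12) (v' 13) (v' 14)) := by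
  set α := fun i => a 1 (v 8 + i) with hα
  have hbit : ∀ i < D.length, α i ≤ 1 := fun i hi => by rw [hD i hi]; exact Bool.toNat_le _
  let I : ℕ → (ℕ → ℕ) → (ℕ → ℕ → ℕ) → Prop := fun j v' a' => v' 15 = j ∧ a' = a ∧
    (∀ x < 10, v' x = v x) ∧ NeckInv α j (v' 10) (v' 11) (v' 12) (v' 13) (v' 14)
  refine Ok.seq (Q := I 1) (ok_of_wp ?_) ?_
  · simp (disch := omega) only [neckInit, block, wp, ev, eqBit, Expr.xor, Expr.not, update_self, update_of_ne]
    refine ⟨by omega, by omega, by omega, by omega, by omega, by omega, ?_⟩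
    refine ⟨by simp, rfl, fun x hx => by simp (disch := omega) only [update_of_ne], ?_⟩
    simp (disch := omega) only [update_self, update_of_ne]
    exact NeckInv.init α
  · intro v' a' h
    refine (ok_loop (I := I) (hi := D.length) (T := wc neckBody) ?_ ?_ (D.length - 1) 1 v' a'
      (by omega) h).mono ?_ ?_
    · rintro j v a ⟨h1, h2, h3, h4⟩
      exact ⟨h1, (h3 1 (by omega)).trans hN⟩
    · rintro j v' a' hj ⟨h1, rfl, h3, h4⟩
      refine ok_of_wp ?_
      have hx := hbit j hj
      have hp := h4.le
      have hp1 := h4.one_le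
      have hy := hbit (j - v' 10) (by omega)
      have h8 := h3 8 (by omega)
      simp (disch := omega) only [neckBody, block, wp, ev, eqBit, ltBit, Expr.xor, Expr.not, Expr.plus, update_self, update_of_ne]
      have e1 : a' 1 (v' 8 + j) = α j := by rw [h8]
      have e2 : a' 1 (v' 8 + j - v' 10) = α (j - v' 10) := by
        rw [h8, Nat.add_sub_assoc hp]
      have ht := h4.t_lt
      simp only [e1, e2, h1, bit_ne_zero, bit_eq_zero]
      refine ⟨by omega, by omega, by omega, by omega, fun he => ⟨by omega, fun ht => ⟨by omega, ?_⟩,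
        fun ht => ?_⟩, fun hne => ⟨fun hlt => ⟨by omega, ?_⟩, fun hlt => ⟨by omega, by omega,
        by omega, ?_⟩⟩⟩ <;>
      refine ⟨by simp, rfl, fun x hx => by
        simp (disch := omega) only [update_of_ne]; exact h3 x hx, ?_⟩ <;>
      simp (disch := omega) only [update_self, update_of_ne]
      · simpa [ht] using h4.step_eq he
      · simpa [ht] using h4.step_eq he
      · exact h4.step_lt hlt
      · exact h4.step_gt (by omega)
    · have : (D.length - 1) * (wc neckBody + 4) ≤ D.length * (wc neckBody + 4) :=
        Nat.mul_le_mul_right _ (Nat.sub_le _ _)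
      omega
    · rintro v' a' ⟨h1, h2⟩
      exact h2

/-- The bound 3|D| comes from the expected position nx ≤ 2j, to which g < j is added. -/
theorem special_ok {D : List Bool} (hN : v 1 = D.length) (hpos : 1 ≤ D.length)
    (hD : Spells (fun i => a 1 (v 8 + i)) D) (h0 : a 1 (v 8) = 0) (hB : 3 * D.length + 2 < B) :
    Ok B (.seq specialInit (upto 15 1 specialBody))
      (wc specialInit + (D.length * (wc specialBody + 4) + 4)) v a
      (fun v' a' => a' = a ∧ (∀ x < 15, v' x = v x) ∧
        SpecialInv (fun i => a 1 (v 8 + i)) D.length (v' 18) (v' 19) (v' 20) (v' 21)) := by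
  set α := fun i => a 1 (v 8 + i) with hα
  let I : ℕ → (ℕ → ℕ) → (ℕ → ℕ → ℕ) → Prop := fun j v' a' => v' 15 = j ∧ a' = a ∧
    (∀ x < 15, v' x = v x) ∧ v' 22 = j % 2 ∧ SpecialInv α j (v' 18) (v' 19) (v' 20) (v' 21)
  refine Ok.seq (Q := I 1) (ok_of_wp ?_) ?_
  · simp (disch := omega) only [specialInit, block, wp, ev]
    refine ⟨by omega, by omega, by omega, by omega, by omega, by omega, ?_⟩
    refine ⟨by simp, rfl, fun x hx => by simp (disch := omega) only [update_of_ne], by simp, ?_⟩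
    simp (disch := omega) only [update_self, update_of_ne]
    exact SpecialInv.init α
  · intro v' a' h
    refine (ok_loop (I := I) (hi := D.length) (T := wc specialBody) ?_ ?_ (D.length - 1) 1 v' a'
      (by omega) h).mono ?_ ?_
    · rintro j v a ⟨h1, h2, h3, h4⟩
      exact ⟨h1, (h3 1 (by omega)).trans hN⟩
    · rintro j v' a' hj ⟨h1, rfl, h3, h5, h4⟩
      refine ok_of_wp ?_
      have h8 := h3 8 (by omega)
      simp (disch := omega) only [specialBody, block, wp, ev, eqBit, Expr.not, Expr.plus,
        update_of_ne]
      have e1 : a' 1 (v' 8 + j) = α j := by rw [h8]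
      have hnx := h4.nx_le
      have hg := h4.g_lt
      simp only [h1, e1, bit_ne_zero, bit_eq_zero]
      refine ⟨fun ha => ⟨by omega, by omega, ?_⟩, fun ha => ⟨fun hg => ⟨fun hj => ⟨by omega,
        by omega, by omega, ?_⟩, fun hj => ⟨by omega, by omega, by omega, ?_⟩⟩, fun hg =>
        ⟨by omega, by omega, by omega, by omega, by omega, ?_⟩⟩⟩ <;>
      refine ⟨by simp, rfl, fun x hx => by
        simp (disch := omega) only [update_of_ne]; exact h3 x hx, ?_, ?_⟩ <;>
      simp (disch := omega) only [update_self, update_of_ne]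
      · omega
      · exact h4.step_ne ha
      · omega
      · exact h4.step_next ha (by omega) hj
      · omega
      · exact h4.step_bad ha (by omega) hj
      · omega
      · exact h4.step_first h0 ha hg h5
    · have : (D.length - 1) * (wc specialBody + 4) ≤ D.length * (wc specialBody + 4) :=
        Nat.mul_le_mul_right _ (Nat.sub_le _ _)
      omega
    · rintro v' a' ⟨h1, h2, h3, h4, h5⟩
      exact ⟨h2, h3, h5⟩

/-- The time of `test`, for words of length `N`. -/
def testTime (N : ℕ) : ℕ := wc neckInit + (N * (wc neckBody + 4) + 4) +
  (wc specialInit + (N * (wc specialBody + 4) + 4) + wc testEnd)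

theorem test_ok {D : List Bool} {b : Bool} (hN : v 1 = D.length) (hpos : 1 ≤ D.length)
    (hD : Spells (fun i => a 1 (v 8 + i)) D) (h0 : a 1 (v 8) = 0) (hb : v 9 = b.toNat)
    (hB : 3 * D.length + 5 < B) :
    Ok B test (testTime D.length) v a
      (fun v' a' => a' = a ∧ (∀ x < 10, v' x = v x) ∧ (v' 23 = 1 ↔ RLState b D) ∧
        (v' 24 = 1 ↔ SpecialState b D)) := by
  have hf : false ∈ D := by
    have := hD 0 hpos
    simp only [Nat.add_zero, h0] at this
    rw [List.getD_eq_getElem _ _ hpos] at this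
    have h1 : D[0] = false := toNat_injective this.symm
    rw [← h1]
    exact List.getElem_mem _
  refine (neck_ok hN hpos hD (by omega)).seq fun v₁ a₁ h₁ => ?_
  obtain ⟨rfl, hv₁, hI₁⟩ := h₁
  have h8 := hv₁ 8 (by omega)
  have hN₁ := hv₁ 1 (by omega)
  refine Ok.seq (special_ok (D := D) (by rw [hN₁, hN]) hpos (by rw [h8]; exact hD)
    (by rw [h8, h0]) (by omega)) fun v₂ a₂ h₂ => ?_
  obtain ⟨rfl, hv₂, hI₂⟩ := h₂
  refine ok_of_wp ?_
  have e : ∀ x < 10, v₂ x = v x := fun x hx => (hv₂ x (by omega)).trans (hv₁ x hx)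
  rw [h8] at hI₂
  rw [hI₁.rlState_iff hD hf, SpecialState, hI₂.specialForm_iff hD]
  have h1 := hI₁.ok_le
  have h2 := hI₂.sok_le
  -- A conjunction is tested by comparing the sum of the bits with their number: three conditions
  -- for an RL-rep, five for a special state.
  simp (disch := omega) only [testEnd, block, wp, ev, eqBit, ltBit, update_self, update_of_ne]
  have e9 := e 9 (by omega)
  have e1 := e 1 (by omega)
  have e11 := hv₂ 11 (by omega)
  have e12 := hv₂ 12 (by omega)
  have e14 := hv₂ 14 (by omega)
  simp only [e9, e1, e11, e12, e14, hb, hN]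
  refine ⟨by split_ifs <;> omega, by split_ifs <;> omega, trivial, fun x hx => by
    simp (disch := omega) only [update_of_ne]; exact e x hx, ?_, ?_⟩
  · cases b <;> simp only [Bool.toNat_false, Bool.toNat_true] <;> split_ifs <;> simp <;> omega
  · cases b <;> simp only [Bool.toNat_false, Bool.toNat_true] <;> split_ifs <;> simp <;> omega

end Ram

end PrefSame

/-! ### Writing the difference word to memory -/

namespace PrefSame

namespace Ram

open Function

/-- The body of the loop that writes the two copies of the word of differences to array 1. -/
def buildBody : Cmd := block [
  .assign 16 (.xor (.get 0 (.var 15)) (.get 0 (.plus (.var 15) 1))),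
  .store 1 (.var 15) (.var 16),
  .store 1 (.add (.var 15) (.var 1)) (.var 16),
  .ite (.var 16) .skip
    (.ite (.var 4) .skip (block [.assign 4 (.var 15), .assign 5 (.var 10)])),
  .assign 10 (.not (.var 10)),
  .assign 15 (.plus (.var 15) 1)]

/-- Preparation of that loop. -/
def buildInit : Cmd := block [
  .assign 3 (.get 0 (.const 1)), .assign 4 (.const 0), .assign 10 (.var 3),
  .store 1 (.const 0) (.const 0), .store 1 (.var 1) (.const 0), .assign 15 (.const 1)]

/-- If that loop has not found a second zero, the position after the word counts as one. -/
def buildEnd : Cmd :=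
  .ite (.var 4) .skip (block [.assign 4 (.var 1), .assign 5 (.var 10)])

/-- Write two copies of the word of differences to array 1; variable 3 is the first bit of its
state, variable 4 the position of the second zero, and variable 5 the bit at this position. -/
def build : Cmd := .seq (.seq buildInit (upto 15 1 buildBody)) buildEnd

variable {B n : ℕ} {v : ℕ → ℕ} {a : ℕ → ℕ → ℕ}

/-- The machine holds the string `w` and the seed `σ`. -/
structure Holds (w σ : List Bool) (v : ℕ → ℕ) (a : ℕ → ℕ → ℕ) : Prop where
  var0 : v 0 = w.length
  var1 : v 1 + 1 = w.length
  arr0 : Spells (a 0) w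
  arr2 : Spells (a 2) σ

/-- The state in which the successor rule tests the string `w`. -/
def succWord (w : List Bool) : List Bool := false :: diffWord w.tail

theorem succWord_length {w : List Bool} (hw : 2 ≤ w.length) :
    (succWord w).length + 1 = w.length := by
  simp [succWord, diffWord_length]; omega

/-- The invariant of the loop in `build`. -/
structure BuildInv (w : List Bool) (a : ℕ → ℕ) (N j o s q : ℕ) : Prop where
  left : ∀ k < j, a k = ((succWord w).getD k false).toNat
  right : ∀ k < j, a (k + N) = ((succWord w).getD k false).toNat
  q_eq : q = (w.getD 1 false ^^ par (ones (j - 1))).toNat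
  before : ∀ k, 1 ≤ k → k < j → (o = 0 ∨ k < o) → (succWord w).getD k false = true
  found : 0 < o → o < j ∧ (succWord w).getD o false = false ∧
    s = (w.getD 1 false ^^ par (ones (o - 1))).toNat

theorem toNat_eq_zero {b : Bool} : b.toNat = 0 ↔ b = false := by cases b <;> simp

theorem toNat_ne_zero {b : Bool} : b.toNat ≠ 0 ↔ b = true := by cases b <;> simp

/-- Two copies make every rotation a contiguous piece of the array. Variable 10 is complemented at
every letter, so up to the second zero it is the first bit after the ones passed. Without a second
zero the position is the full length, which means rotation by a whole turn. -/
theorem build_ok {w σ : List Bool} (hw : 2 ≤ w.length) (h : Holds w σ v a)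
    (hB : 2 * w.length + 2 < B) :
    Ok B build (wc buildInit + ((v 1) * (wc buildBody + 4) + 4) + wc buildEnd) v a
      (fun v' a' => Holds w σ v' a' ∧ v' 3 = (w.getD 1 false).toNat ∧
        1 ≤ v' 4 ∧ v' 4 ≤ (succWord w).length ∧
        (∀ k, 1 ≤ k → k < v' 4 → (succWord w).getD k false = true) ∧
        (v' 4 = (succWord w).length ∨ (succWord w).getD (v' 4) false = false) ∧
        v' 5 = (w.getD 1 false ^^ par (ones (v' 4 - 1))).toNat ∧
        Spells (a' 1) (succWord w) ∧
        Spells (fun k => a' 1 (k + (succWord w).length)) (succWord w)) := by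
  obtain ⟨N, hN⟩ : ∃ N, N = (succWord w).length := ⟨_, rfl⟩
  have hl := succWord_length hw
  rw [← hN] at hl ⊢
  let I : ℕ → (ℕ → ℕ) → (ℕ → ℕ → ℕ) → Prop := fun j v' a' => v' 15 = j ∧ 1 ≤ j ∧ Holds w σ v' a' ∧
    v' 3 = (w.getD 1 false).toNat ∧ BuildInv w (a' 1) N j (v' 4) (v' 5) (v' 10)
  have h1N := h.var1
  refine (Ok.seq (ok_of_wp (Q := I 1) ?_) fun v' a' h' =>
    ok_loop (I := I) (hi := N) (T := wc buildBody) ?_ ?_ (N - 1) 1 v' a' (by omega) h').mono ?_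
    (fun _ _ h => h) |>.seq fun v' a' h' => ok_of_wp ?_
  · have e1 := h.arr0 1 (by omega)
    have e2 := Bool.toNat_le (w.getD 1 false)
    simp (disch := omega) only [buildInit, block, wp, ev, update_self, update_of_ne, e1]
    refine ⟨by omega, by omega, by omega, by omega, by omega, by omega, by omega, by omega, ?_⟩
    refine ⟨by simp, le_rfl, ⟨?_, ?_, ?_, ?_⟩, ?_, ⟨?_, ?_, ?_, ?_, ?_⟩⟩ <;>
      simp (disch := omega) only [update_self, update_of_ne]
    · exact h.var0
    · exact h.var1
    · exact h.arr0
    · exact h.arr2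
    · intro k hk
      obtain rfl : k = 0 := by omega
      simp [succWord, update_apply]
    · intro k hk
      obtain rfl : k = 0 := by omega
      have : v 1 = N := by omega
      simp [succWord, this]
    · simp [ones]
    · intro k h1 h2; omega
    · intro h; omega
  · rintro j v a ⟨h1, h2, h3, h4⟩
    exact ⟨h1, by have := h3.var1; omega⟩
  · rintro j v a hj ⟨h1, h2, h3, h4, h5⟩
    refine ok_of_wp ?_
    have hv1 : v 1 = N := by have := h3.var1; omega
    have e1 := spells_diffWord h3.arr0 h2 (by omega)
    have e2 := Bool.toNat_le ((succWord w).getD j false)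
    have e3 : a 0 (j + 1) < B := by
      rw [h3.arr0 _ (by omega)]; have := Bool.toNat_le (w.getD (j + 1) false); omega
    have hq := h5.q_eq
    have hq' := Bool.toNat_le (w.getD 1 false ^^ par (ones (j - 1)))
    simp (disch := omega) only [buildBody, block, wp, ev, eqBit, Expr.xor, Expr.not, Expr.plus,
      update_self, update_of_ne, h1, hv1, ← e1]
    rw [← succWord]
    have hcopy : ∀ k < j + 1,
        update (a 1) j ((succWord w).getD j false).toNat k = ((succWord w).getD k false).toNat ∧
        update (update (a 1) j ((succWord w).getD j false).toNat) (j + N)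
          ((succWord w).getD j false).toNat (k + N) = ((succWord w).getD k false).toNat := by
      intro k hk
      rcases Nat.lt_succ_iff_lt_or_eq.1 hk with hk | rfl
      · simp (disch := omega) only [update_of_ne]
        exact ⟨h5.left k hk, h5.right k hk⟩
      · simp (disch := omega) only [update_self, and_self]
    have hstep : 1 - (w.getD 1 false ^^ par (ones (j - 1))).toNat =
        (w.getD 1 false ^^ par (ones (j + 1 - 1))).toNat := by
      obtain ⟨i, rfl⟩ : ∃ i, j = i + 1 := ⟨j - 1, by omega⟩
      rw [Nat.add_sub_cancel, Nat.add_sub_cancel, par_ones_succ]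
      cases w.getD 1 false <;> cases par (ones i) <;> rfl
    have hH : ∀ v' a', v' 0 = v 0 → v' 1 = N → a' 0 = a 0 → a' 2 = a 2 → Holds w σ v' a' :=
      fun v' a' h0 h1 ha hb => ⟨h0.trans h3.var0, by omega, ha ▸ h3.arr0, hb ▸ h3.arr2⟩
    refine ⟨by omega, by omega, by omega, by omega, by omega, fun hx => ⟨by omega, by omega, ?_⟩,
      fun hx => ⟨fun ho => ⟨by omega, by omega, ?_⟩,
        fun ho => ⟨by omega, by omega, by omega, by omega, ?_⟩⟩⟩ <;>
    refine ⟨by simp, by omega, hH _ _ ?_ ?_ ?_ ?_, ?_, fun k hk => ?_, fun k hk => ?_, ?_,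
      fun k hk1 hk2 hk3 => ?_, fun ho' => ?_⟩ <;>
    (try simp (disch := omega) only [update_self, update_of_ne, h4, hv1, hq]) <;>
    (try simp (disch := omega) only [update_self, update_of_ne] at hk3) <;>
    (try simp (disch := omega) only [update_self, update_of_ne] at ho') <;>
    first
      | exact (hcopy k hk).1
      | exact (hcopy k hk).2
      | exact hstep
      | skip
    · rcases Nat.lt_succ_iff_lt_or_eq.1 hk2 with hk | rfl
      · exact h5.before k hk1 hk hk3
      · rw [toNat_ne_zero] at hx; exact hx
    · obtain ⟨h6, h7⟩ := h5.found ho'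
      exact ⟨by omega, h7⟩
    · obtain ⟨h6, h7⟩ := h5.found (by omega)
      exact h5.before k hk1 (by omega) hk3
    · obtain ⟨h6, h7⟩ := h5.found ho'
      exact ⟨by omega, h7⟩
    · exact h5.before k hk1 (by omega) (Or.inl ho)
    · exact ⟨by omega, toNat_eq_zero.1 hx, trivial⟩
  · have : v 1 = N := by omega
    rw [this]
    have : (N - 1) * (wc buildBody + 4) ≤ N * (wc buildBody + 4) :=
      Nat.mul_le_mul_right _ (Nat.sub_le _ _)
    omega
  · obtain ⟨h1, h2, h3, h4, h5⟩ := h'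
    have hv1 : v' 1 = N := by have := h3.var1; omega
    have hq := h5.q_eq
    have hq' := Bool.toNat_le (w.getD 1 false ^^ par (ones (N - 1)))
    have hH : ∀ v'' a'', v'' 0 = v' 0 → v'' 1 = N → a'' = a' → Holds w σ v'' a'' :=
      fun v'' a'' h0 h1 ha => ⟨h0.trans h3.var0, by omega, ha ▸ h3.arr0, ha ▸ h3.arr2⟩
    have hL : Spells (a' 1) (succWord w) := fun k hk => h5.left k (by omega)
    have hR : Spells (fun k => a' 1 (k + N)) (succWord w) := fun k hk => h5.right k (by omega)
    simp (disch := omega) only [buildEnd, block, wp, ev, update_self, update_of_ne, hv1]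
    refine ⟨fun ho => ?_, fun ho => ⟨by omega, by omega, hH _ _ ?_ ?_ rfl, ?_⟩⟩
    · obtain ⟨h6, h7, h8⟩ := h5.found (by omega)
      exact ⟨h3, h4, by omega, by omega, fun k hk1 hk2 => h5.before k hk1 (by omega) (Or.inr hk2),
        Or.inr h7, h8, hL, hR⟩
    · simp (disch := omega) only [update_of_ne]
    · simp (disch := omega) only [update_of_ne, hv1]
    · exact ⟨h4, by omega, le_rfl, fun k hk1 hk2 => h5.before k hk1 hk2 (Or.inl ho), Or.inl trivial,
        hq, hL, hR⟩

end Ram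

end PrefSame

/-! ### Evaluating the successor rule -/

namespace PrefSame

namespace Ram

open Function

/-- Prepare the test of the state itself. -/
def firstInit : Cmd := block [.assign 8 (.const 0), .assign 9 (.var 3)]

/-- Store whether the state is special and belongs to an RL-rep, and prepare the test of the state
that starts at the second zero. -/
def secondInit : Cmd := block [
  .assign 6 (.eq (.add (.eq (.var 23) (.const 1)) (.eq (.var 24) (.const 1))) (.const 2)),
  .assign 8 (.var 4), .assign 9 (.var 5)]

/-- Compute the next bit from the results of the two tests. -/
def succEnd : Cmd := .assign 7 (.xor (.xor (.get 0 (.const 0)) (.get 0 (.const 1)))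
  (.xor (.get 0 (.var 1)) (.lt (.const 0) (.add (.var 6)
    (.lt (.eq (.var 24) (.const 1)) (.eq (.var 23) (.const 1)))))))

/-- Store the bit that the successor rule appends in variable 7. -/
def succ : Cmd := .seq build (.seq (.seq firstInit test) (.seq (.seq secondInit test) succEnd))

/-- The time of `succ`, for strings of length `N + 1`. -/
def succTime (N : ℕ) : ℕ := (wc buildInit + (N * (wc buildBody + 4) + 4) + wc buildEnd) +
  (wc firstInit + testTime N + (wc secondInit + testTime N + wc succEnd))

variable {B : ℕ} {v : ℕ → ℕ} {a : ℕ → ℕ → ℕ}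

theorem Holds.congr {w σ : List Bool} {v' : ℕ → ℕ} (h : Holds w σ v a) (h0 : v' 0 = v 0)
    (h1 : v' 1 = v 1) : Holds w σ v' a where
  var0 := h0.trans h.var0
  var1 := by rw [h1]; exact h.var1
  arr0 := h.arr0
  arr2 := h.arr2

theorem spells_rotate {α : ℕ → ℕ} {D : List Bool} {o : ℕ} (h : Spells α D)
    (h' : Spells (fun k => α (k + D.length)) D) (ho : o ≤ D.length) :
    Spells (fun i => α (o + i)) (D.rotate o) := by
  intro i hi
  rw [List.length_rotate] at hi
  rw [getD_rotate hi, Nat.add_comm i o]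
  rcases lt_or_ge (o + i) D.length with hlt | hge
  · rw [Nat.mod_eq_of_lt hlt, ← h _ hlt]
  · rw [Nat.mod_eq_sub_mod hge, Nat.mod_eq_of_lt (by omega), ← h' _ (by omega)]
    simp only
    rw [Nat.sub_add_cancel hge]

theorem xor_toNat (b c : Bool) : 1 - eqBit b.toNat c.toNat = (b ^^ c).toNat := by
  cases b <;> cases c <;> rfl

theorem succ_ok {w σ : List Bool} (hw : 2 ≤ w.length) (h : Holds w σ v a)
    (hB : 3 * w.length + 5 < B) :
    Ok B succ (succTime (v 1)) v a
      (fun v' a' => Holds w σ v' a' ∧ v' 7 = (succS w).toNat) := by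
  have hl := succWord_length hw
  have hvN : v 1 = (succWord w).length := by have := h.var1; omega
  rw [succTime, hvN]
  refine ((build_ok hw h (by omega)).mono (by rw [hvN]) fun _ _ h => h).seq fun v₁ a₁ hb => ?_
  obtain ⟨h1, h2, h3, h4, h5, h6, h7, hL, hR⟩ := hb
  have hv1 : v₁ 1 = (succWord w).length := by have := h1.var1; omega
  have hz : a₁ 1 0 = 0 := hL 0 (by omega)
  -- The test requires a word that begins with 0; the position behind the first copy is the initial
  -- zero of the second one.
  have hz' : a₁ 1 (v₁ 4) = 0 := by
    rcases h6 with h6 | h6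
    · rw [h6, ← Nat.zero_add (succWord w).length]
      exact hR 0 (by omega)
    · rcases h4.lt_or_eq with h4 | h4
      · rw [hL _ h4, h6]; rfl
      · rw [h4, ← Nat.zero_add (succWord w).length]
        exact hR 0 (by omega)
  have hb3 := Bool.toNat_le (w.getD 1 false)
  have hb5 := Bool.toNat_le (w.getD 1 false ^^ par (ones (v₁ 4 - 1)))
  refine ((ok_of_wp (Q := fun v' a' => a' = a₁ ∧ (∀ x < 6, v' x = v₁ x) ∧ v' 8 = 0 ∧
    v' 9 = v₁ 3) ?_).seq (T' := testTime (succWord w).length) (Q' := fun v' a' => a' = a₁ ∧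
      (∀ x < 6, v' x = v₁ x) ∧ (v' 23 = 1 ↔ RLState (w.getD 1 false) (succWord w)) ∧
      (v' 24 = 1 ↔ SpecialState (w.getD 1 false) (succWord w)))
    fun v₂ a₂ h' => ?_).seq fun v₂ a₂ h' => ?_
  · simp (disch := omega) only [firstInit, block, wp, ev, update_self, update_of_ne]
    exact ⟨by omega, by omega, trivial, fun x hx => by
      simp (disch := omega) only [update_of_ne], trivial, trivial⟩
  · obtain ⟨rfl, h8, h9, h10⟩ := h'
    refine (test_ok (D := succWord w) (b := w.getD 1 false) ?_ (by omega) ?_ ?_ ?_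
      (by omega)).mono le_rfl fun v' a' h => ?_
    · rw [h8 1 (by omega), hv1]
    · rw [h9]; simpa using hL
    · rw [h9, hz]
    · rw [h10, h2]
    · exact ⟨h.1, fun x hx => (h.2.1 x (by omega)).trans (h8 x hx), h.2.2⟩
  · obtain ⟨rfl, h8, h9, h10⟩ := h'
    have h81 := h8 1 (by omega)
    have h84 := h8 4 (by omega)
    have h85 := h8 5 (by omega)
    refine ((ok_of_wp (Q := fun v' a' => a' = a₂ ∧ (∀ x < 6, v' x = v₁ x) ∧ v' 8 = v₁ 4 ∧
      v' 9 = v₁ 5 ∧ (v' 6 ≤ 1 ∧ (v' 6 = 1 ↔ RLState (w.getD 1 false) (succWord w) ∧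
        SpecialState (w.getD 1 false) (succWord w)))) ?_).seq
      (T' := testTime (succWord w).length) (Q' := fun v' a' => a' = a₂ ∧ (∀ x < 6, v' x = v₁ x) ∧
        (v' 6 ≤ 1 ∧ (v' 6 = 1 ↔ RLState (w.getD 1 false) (succWord w) ∧
          SpecialState (w.getD 1 false) (succWord w))) ∧
        (v' 23 = 1 ↔ RLState (w.getD 1 false ^^ par (ones (v₁ 4 - 1)))
          ((succWord w).rotate (v₁ 4))) ∧
        (v' 24 = 1 ↔ SpecialState (w.getD 1 false ^^ par (ones (v₁ 4 - 1)))
          ((succWord w).rotate (v₁ 4)))) fun v₃ a₃ h' => ?_).seq fun v₃ a₃ h' => ok_of_wp ?_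
    · simp (disch := omega) only [secondInit, block, wp, ev, update_self, update_of_ne, h84, h85]
      simp only [eqBit]
      refine ⟨by split_ifs <;> omega, by omega, by omega, trivial, fun x hx => by
        simp (disch := omega) only [update_of_ne]; exact h8 x hx, trivial, trivial, ?_, ?_⟩
      · split_ifs <;> omega
      · rw [← h9, ← h10]
        by_cases e1 : v₂ 23 = 1 <;> by_cases e2 : v₂ 24 = 1 <;> simp [e1, e2]
    · obtain ⟨rfl, h11, h12, h13, h14⟩ := h'
      have hlen : ((succWord w).rotate (v₁ 4)).length = (succWord w).length := by simp
      rw [← hlen]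
      refine (test_ok (D := (succWord w).rotate (v₁ 4))
        (b := w.getD 1 false ^^ par (ones (v₁ 4 - 1))) ?_ (by omega) ?_ ?_ ?_
        (by omega)).mono le_rfl fun v' a' h => ?_
      · rw [h11 1 (by omega), hv1, hlen]
      · rw [h12]; exact spells_rotate hL hR h4
      · rw [h12, hz']
      · rw [h13, h7]
      · exact ⟨h.1, fun x hx => (h.2.1 x (by omega)).trans (h11 x hx),
          by rw [h.2.1 6 (by omega)]; exact h14, h.2.2⟩
    · obtain ⟨rfl, h11, ⟨h12, h13⟩, h14, h15⟩ := h'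
      have hrep := repState_iff_rotate (b := w.getD 1 false) (x := diffWord w.tail) (o := v₁ 4) h3
        h4 h5 h6
      rw [← succWord, ← h14, ← h15, ← h13] at hrep
      have e0 := h1.arr0 0 (by omega)
      have e1 := h1.arr0 1 (by omega)
      have eN := h1.arr0 (v₁ 1) (by have := h1.var1; omega)
      have hlen : w.length - 1 = v₁ 1 := by omega
      simp (disch := omega) only [succEnd, wp, ev, Expr.xor, Expr.not, update_self, h11 1, e0, e1,
        eN]
      refine ⟨by omega, h1.congr ?_ ?_, ?_⟩
      · simp (disch := omega) only [update_of_ne, h11]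
      · simp (disch := omega) only [update_of_ne, h11]
      · classical
        -- For bits, x < y means y and not x; so this is the disjunction of the special case and the
        -- LC case.
        have hflip : ltBit 0 (v₃ 6 + ltBit (eqBit (v₃ 24) 1) (eqBit (v₃ 23) 1)) =
            (decide (RepState (w.getD 1 false) (false :: diffWord w.tail))).toNat := by
          have hdec : decide (RepState (w.getD 1 false) (succWord w)) =
              decide (v₃ 6 = 1 ∨ v₃ 23 = 1 ∧ ¬v₃ 24 = 1) := decide_eq_decide.2 hrep
          rw [← succWord, hdec]
          rcases Nat.le_one_iff_eq_zero_or_eq_one.1 h12 with e0 | e0 <;>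
          by_cases e1 : v₃ 24 = 1 <;> by_cases e2 : v₃ 23 = 1 <;> simp [eqBit, ltBit, e0, e1, e2]
        rw [hflip, xor_toNat, xor_toNat, xor_toNat, succS_eq hw, hlen]
        congr 1
        generalize decide (RepState _ _) = r
        cases w.getD 0 false <;> cases w.getD 1 false <;> cases w.getD (v₁ 1) false <;>
          cases r <;> rfl

end Ram

end PrefSame

namespace PrefSame

namespace Ram

open Function

/-! ### Shifting the register, and the initial state -/

/-- The body of the loop that shifts the string in array 0. -/
def shiftBody : Cmd := block [
  .store 0 (.var 15) (.get 0 (.plus (.var 15) 1)), .assign 15 (.plus (.var 15) 1)]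

/-- The body of the loop that compares the string with the seed. -/
def cmpBody : Cmd := block [
  .ite (.eq (.get 0 (.var 15)) (.get 2 (.var 15))) .skip (.assign 2 (.const 1)),
  .assign 15 (.plus (.var 15) 1)]

/-- Store the new bit, and prepare the comparison with the seed. -/
def storeBit : Cmd := block [
  .store 0 (.var 1) (.var 7), .assign 2 (.const 0), .assign 15 (.const 0)]

/-- Append variable 7 to the string; variable 2 tells whether the result differs from the seed. -/
def advance : Cmd := .seq (.seq (.assign 15 (.const 0)) (upto 15 1 shiftBody))
  (.seq storeBit (upto 15 0 cmpBody))

/-- The time of `advance`, for strings of length `n`. -/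
def advanceTime (n : ℕ) : ℕ := (2 + (n * (wc shiftBody + 4) + 4)) +
  (wc storeBit + (n * (wc cmpBody + 4) + 4))

variable {B : ℕ} {v : ℕ → ℕ} {a : ℕ → ℕ → ℕ}

theorem advance_ok {w σ : List Bool} {b : Bool} (hw : 1 ≤ w.length) (h : Holds w σ v a)
    (hσ : σ.length = w.length) (hb : v 7 = b.toNat) (hB : w.length + 2 < B) :
    Ok B advance (advanceTime w.length) v a
      (fun v' a' => Holds (w.tail ++ [b]) σ v' a' ∧ (v' 2 ≠ 0 ↔ w.tail ++ [b] ≠ σ)) := by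
  have h0 := h.var0
  have h1 := h.var1
  have hbit := Bool.toNat_le b
  set N := v 1 with hN
  let I : ℕ → (ℕ → ℕ) → (ℕ → ℕ → ℕ) → Prop := fun j v' a' => v' 15 = j ∧
    (∀ x < 8, v' x = v x) ∧ a' 2 = a 2 ∧ ∀ k < w.length, a' 0 k = a 0 (if k < j then k + 1 else k)
  let J : ℕ → (ℕ → ℕ) → (ℕ → ℕ → ℕ) → Prop := fun j v' a' => v' 15 = j ∧
    Holds (w.tail ++ [b]) σ v' a' ∧
    (v' 2 ≠ 0 ↔ ∃ k < j, (w.tail ++ [b]).getD k false ≠ σ.getD k false)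
  have hl : (w.tail ++ [b]).length = w.length := by simp; omega
  refine Ok.mono (Ok.seq (Q := I N) (Ok.seq (ok_of_wp (Q := I 0) ?_) fun v' a' h' => ok_loop
    (I := I) (hi := N) (T := wc shiftBody) ?_ ?_ N 0 v' a' (by omega) h') fun v' a' h' =>
    Ok.seq (ok_of_wp (Q := J 0) ?_) fun v' a' h' => ok_loop
      (I := J) (hi := w.length) (T := wc cmpBody) ?_ ?_ w.length 0 v' a' (by omega) h') ?_
    fun v' a' h' => ?_
  · simp only [wp, ev]
    refine ⟨by omega, by simp, fun x hx => ?_, rfl, fun k hk => by simp⟩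
    simp (disch := omega) only [update_of_ne]
  · rintro j v' a' ⟨h2, h3, h4⟩
    exact ⟨h2, h3 1 (by omega)⟩
  · rintro j v' a' hj ⟨h2, h3, h4, h5⟩
    refine ok_of_wp ?_
    -- Shifting in place from left to right is safe, as the cell that is read has not been
    -- overwritten yet.
    have e1 : a' 0 (j + 1) = a 0 (j + 1) := by rw [h5 _ (by omega), if_neg (by omega)]
    have e2 : a 0 (j + 1) < B := by
      rw [h.arr0 _ (by omega)]
      have := Bool.toNat_le (w.getD (j + 1) false); omega
    simp (disch := omega) only [shiftBody, block, wp, ev, Expr.plus, h2, e1]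
    refine ⟨by omega, e2, by omega, by simp, fun x hx => ?_, ?_, fun k hk => ?_⟩
    · simp (disch := omega) only [update_of_ne]
      exact h3 x hx
    · simp (disch := omega) only [update_of_ne]
      exact h4
    · rw [update_self]
      rcases lt_trichotomy k j with hkj | rfl | hkj
      · rw [update_of_ne (by omega), h5 k hk, if_pos hkj, if_pos (by omega)]
      · rw [update_self, if_pos (by omega)]
      · rw [update_of_ne (by omega), h5 k hk, if_neg (by omega), if_neg (by omega)]
  · obtain ⟨h2, h3, h4, h5⟩ := h'
    have e1 := h3 1 (by omega)
    have e7 := h3 7 (by omega)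
    simp (disch := omega) only [storeBit, block, wp, ev, e1, e7]
    refine ⟨by omega, by omega, by omega, by omega, by simp, ⟨?_, ?_, ?_, ?_⟩, ?_⟩
    · simp (disch := omega) only [update_of_ne]
      rw [h3 0 (by omega), hl, h0]
    · simp (disch := omega) only [update_of_ne]
      rw [e1, hl, h1]
    · intro k hk
      rw [update_self]
      rcases (show k ≤ N by omega).lt_or_eq with hkN | rfl
      · rw [update_of_ne (by omega), h5 k (by omega), if_pos hkN, h.arr0 _ (by omega),
          List.getD_append _ _ _ _ (by simp; omega)]
        cases w with
        | nil => simp at hw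
        | cons c w => simp
      · rw [update_self, List.getD_append_right _ _ _ _ (by simp; omega), hb]
        have : v 1 - w.tail.length = 0 := by simp; omega
        rw [this]; rfl
    · simp (disch := omega) only [update_of_ne]
      rw [h4]; exact h.arr2
    · simp
  · rintro j v' a' ⟨h2, h3, h4⟩
    exact ⟨h2, by rw [h3.var0, hl]⟩
  · rintro j v' a' hj ⟨h2, h3, h4⟩
    refine ok_of_wp ?_
    have e1 := h3.arr0 j (by omega)
    have e2 := h3.arr2 j (by omega)
    simp (disch := omega) only [cmpBody, block, wp, ev, eqBit, Expr.plus, h2, e1, e2, bit_ne_zero,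
      bit_eq_zero, update_of_ne]
    have hH : ∀ v'' : ℕ → ℕ, v'' 0 = v' 0 → v'' 1 = v' 1 → Holds (w.tail ++ [b]) σ v'' a' :=
      fun v'' => h3.congr
    refine ⟨fun he => ⟨by omega, by simp, hH _ ?_ ?_, ?_⟩, fun hne => ⟨by omega, by omega, by simp,
      hH _ ?_ ?_, ?_⟩⟩ <;> simp (disch := omega) only [update_self, update_of_ne]
    · rw [h4]
      constructor
      · rintro ⟨k, hk, hk'⟩
        exact ⟨k, by omega, hk'⟩
      · rintro ⟨k, hk, hk'⟩
        refine ⟨k, ?_, hk'⟩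
        rcases Nat.lt_succ_iff_lt_or_eq.1 hk with hk | rfl
        · exact hk
        · exact absurd (toNat_injective he) hk'
    · exact ⟨fun _ => ⟨j, by omega, fun h => hne (by rw [h])⟩, fun _ => one_ne_zero⟩
  · have : N * (wc shiftBody + 4) ≤ w.length * (wc shiftBody + 4) :=
      Nat.mul_le_mul_right _ (by omega)
    have h2 : wc (.assign 15 (.const 0)) = 2 := rfl
    rw [advanceTime, h2]
    omega
  · obtain ⟨-, h2, h3⟩ := h'
    refine ⟨h2, h3.trans ⟨?_, fun hne => ?_⟩⟩
    · rintro ⟨k, hk, hk'⟩ he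
      exact hk' (by rw [he])
    · by_contra hc
      push Not at hc
      refine hne (List.ext_getElem (by rw [hl, hσ]) fun k hk1 hk2 => ?_)
      have := hc k (by omega)
      rwa [List.getD_eq_getElem _ _ hk1, List.getD_eq_getElem _ _ hk2] at this

/-- The body of the loop that writes the seed. -/
def seedBody : Cmd := block [
  .store 0 (.sub (.var 1) (.var 15)) (.var 10),
  .store 2 (.sub (.var 1) (.var 15)) (.var 10),
  .assign 10 (.not (.var 10)),
  .assign 15 (.plus (.var 15) 1)]

/-- Write the seed. -/
def seedInit : Cmd := .seq (.assign 1 (.sub (.var 0) (.const 1))) (upto 15 1 seedBody)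

theorem getD_alt {m i : ℕ} (hi : i < m) : (alt m).getD i false = decide ((m - 1 - i) % 2 = 1) := by
  induction m generalizing i with
  | zero => simp at hi
  | succ m ih =>
    cases i with
    | zero => simp [alt]
    | succ i =>
      rw [alt, List.getD_cons_succ, ih (by omega)]
      congr 3; omega

theorem decide_odd_toNat (m : ℕ) : (decide (m % 2 = 1)).toNat = m % 2 := by
  rcases Nat.mod_two_eq_zero_or_one m with h | h <;> simp [h]

/-- The alternating part is written from its end backwards; cell 0 is never written, and its default
value 0 is the first letter of the seed. -/
theorem seed_ok {n : ℕ} (hn : 2 ≤ n) (hB : n + 2 < B) :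
    Ok B (.seq seedInit (.assign 2 (.const 1))) (4 + (n * (wc seedBody + 4) + 4) + 2)
      (State.init n).var (State.init n).arr
      (fun v a => Holds (seed n) (seed n) v a ∧ v 2 ≠ 0) := by
  have hl := seed_length hn
  let I : ℕ → (ℕ → ℕ) → (ℕ → ℕ → ℕ) → Prop := fun j v a => v 15 = j ∧ v 1 = n - 1 ∧ v 0 = n ∧
    v 10 = j % 2 ∧ a 0 0 = 0 ∧ a 2 0 = 0 ∧
    ∀ i < j, a 0 (n - 1 - i) = i % 2 ∧ a 2 (n - 1 - i) = i % 2
  refine Ok.mono (Ok.seq (Q := I (n - 1)) (Ok.seq (ok_of_wp (Q := I 0) ?_) fun v' a' h' => ok_loop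
    (I := I) (hi := n - 1) (T := wc seedBody) ?_ ?_ (n - 1) 0 v' a' (by omega) h') fun v' a' h' =>
    ok_of_wp ?_) ?_ fun _ _ h => h
  · simp only [wp, ev, State.init, update_self]
    exact ⟨by omega, by simp, by simp, by simp, by simp, rfl, rfl, fun i hi => by omega⟩
  · rintro j v a ⟨h1, h2, -⟩
    exact ⟨h1, h2⟩
  · rintro j v a hj ⟨h1, h2, h3, h4, h5, h6, h7⟩
    refine ok_of_wp ?_
    simp (disch := omega) only [seedBody, block, wp, ev, Expr.not, Expr.plus, update_of_ne, h1, h2,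
      h4]
    refine ⟨by omega, by omega, by omega, by omega, by omega, by omega, by simp, ?_, ?_, ?_, ?_, ?_,
      fun i hi => ?_⟩ <;> simp (disch := omega) only [update_self, update_of_ne]
    · exact h2
    · exact h3
    · omega
    · exact h5
    · exact h6
    · rcases Nat.lt_succ_iff_lt_or_eq.1 hi with hi | rfl
      · rw [update_of_ne (by omega), update_of_ne (by omega)]
        exact h7 i hi
      · rw [update_self, update_self]
        exact ⟨rfl, rfl⟩
  · obtain ⟨h1, h2, h3, h4, h5, h6, h7⟩ := h'
    simp only [wp, ev]
    have hs : ∀ c, c = 0 ∨ c = 2 → Spells (a' c) (seed n) := by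
      intro c hc k hk
      rw [seed]
      cases k with
      | zero => rcases hc with rfl | rfl <;> simpa
      | succ k =>
        rw [List.getD_cons_succ, getD_alt (by omega), decide_odd_toNat]
        have := h7 (n - 1 - 1 - k) (by omega)
        rw [show n - 1 - (n - 1 - 1 - k) = k + 1 by omega] at this
        rcases hc with rfl | rfl
        exacts [this.1, this.2]
    refine ⟨by omega, ⟨?_, ?_, hs 0 (Or.inl rfl), hs 2 (Or.inr rfl)⟩, by simp⟩ <;>
      simp (disch := omega) only [update_of_ne] <;> omega
  · have : (n - 1) * (wc seedBody + 4) ≤ n * (wc seedBody + 4) :=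
      Nat.mul_le_mul_right _ (by omega)
    have h1 : wc (.assign 1 (.sub (.var 0) (.const 1))) = 4 := rfl
    have h2 : wc (.assign 2 (.const 1)) = 2 := rfl
    omega

end Ram

end PrefSame

namespace PrefSame

namespace Ram

open Function

/-! ### The generation of the sequence -/

/-- Output one bit after another until the string equals the seed. -/
def mainLoop : Cmd := .loop (.var 2) (.seq succ (.seq (.output (.var 7)) advance))

/-- The program that outputs the Prefer-same sequence. -/
def generator : Cmd := .seq (.seq seedInit (.assign 2 (.const 1))) mainLoop

/-- Induction on the number m of bits still to be output. Here τ is the time of the previous output,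
or 0 at the start, and E bounds the time that has passed since. The loop ends when the state is the
seed again, which first happens after 2^n steps. The constant 4 pays for the loop test and the
output. -/
theorem mainLoop_exec {n B d E : ℕ} (hn : 2 ≤ n) (hB : 3 * n + 5 < B) (hE : advanceTime n ≤ E)
    (hd : E + succTime (n - 1) + 4 ≤ d) (m : ℕ) :
    ∀ (k : ℕ) (s : State) (τ : ℕ), k + m = 2 ^ n →
      Holds (stepS^[k] (seed n)) (seed n) s.var s.arr → (s.var 2 ≠ 0 ↔ m ≠ 0) →
      s.clock ≤ τ + E →
      ∃ (s' : State) (l : List (Bool × ℕ)), Exec B mainLoop s s' ∧ s'.out = s.out ++ l ∧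
        l.map Prod.fst = bitsFrom succS m (stepS^[k] (seed n)) ∧
        List.IsChain (fun t t' => t' ≤ t + d) (τ :: (l.map Prod.snd ++ [s'.clock])) := by
  induction m with
  | zero =>
    intro k s τ hk hH h2 hτ
    refine ⟨_, [], .loop_false s _ _ (by simpa [Expr.eval] using h2), by simp [State.tick], rfl, ?_⟩
    simp [State.tick, Expr.cost]
    omega
  | succ m ih =>
    intro k s τ hk hH h2 hτ
    have hlen : (stepS^[k] (seed n)).length = n := stepS_iterate_length hn (seed_length hn) k
    set w := stepS^[k] (seed n) with hw
    have h1 := hH.var1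
    obtain ⟨s₁, hs₁, ho₁, ht₁, hH₁, hb₁⟩ := succ_ok (B := B) (by omega) hH (by omega)
      (s.tick (Expr.cost (.var 2) + 1)) rfl rfl
    have hb : decide (s₁.var 7 ≠ 0) = succS w := by
      rw [hb₁]; cases succS w <;> rfl
    obtain ⟨s₂, hs₂, ho₂, ht₂, hH₂, hg₂⟩ := advance_ok (by omega) hH₁
      (by rw [hlen, seed_length hn]) hb₁ (B := B) (by omega)
      { s₁.tick (Expr.cost (.var 7) + 1) with
        out := s₁.out ++ [(decide (Expr.eval s₁ (.var 7) ≠ 0),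
          s₁.clock + (Expr.cost (.var 7) + 1))] } rfl rfl
    have hstep : w.tail ++ [succS w] = stepS^[k + 1] (seed n) := by
      rw [iterate_succ_apply', ← hw, stepS_eq]
    rw [hstep] at hH₂ hg₂
    obtain ⟨hper, hinj, -⟩ := stepS_iterate_facts hn (seed_length hn)
    have hgo : stepS^[k + 1] (seed n) ≠ seed n ↔ m ≠ 0 := by
      constructor
      · rintro h rfl
        rw [show k + 1 = 2 ^ n by omega] at h
        exact h hper
      · intro hm h
        have := hinj (k + 1) 0 (by omega) (by positivity) h
        omega
    simp only [State.tick, Expr.cost] at ht₁ ht₂ ho₁ ho₂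
    have hN : s.var 1 = n - 1 := by omega
    rw [hN] at ht₁
    rw [hlen] at ht₂
    obtain ⟨s₃, l, hs₃, ho₃, hl, hc⟩ := ih (k + 1) s₂ (s₁.clock + 2) (by omega) hH₂
      (hg₂.trans hgo) (by omega)
    refine ⟨s₃, (succS w, s₁.clock + 2) :: l, .loop_true _ _ _ _ _ (h2.2 (by omega))
      (.seq _ _ _ _ _ hs₁ (.seq _ _ _ _ _ (.output _ _) hs₂)) hs₃, ?_, ?_, ?_⟩
    · rw [ho₃, ho₂, ho₁, Expr.eval, hb]
      simp
    · rw [List.map_cons, hl, bitsFrom, ← hstep]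
      rfl
    · rw [List.map_cons, List.cons_append, List.isChain_cons_cons]
      exact ⟨by omega, hc⟩

theorem generates_preferSame :
    ∃ (P : Cmd) (C : ℕ), ∀ n : ℕ, 2 ≤ n → Generates P n (C * n) (C * n) (preferSame n) := by
  -- The constant is generous: the delays add up to about 224n plus a constant, and the words and
  -- indices stay below 3n + 6.
  refine ⟨generator, 1000, fun n hn => ?_⟩
  obtain ⟨s₁, hs₁, ho₁, ht₁, hH₁, hg₁⟩ := seed_ok hn (B := 1000 * n) (by omega)
    (State.init n) rfl rfl
  have hN : n - 1 ≤ n := Nat.sub_le n 1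
  obtain ⟨s₂, l, hs₂, ho₂, hl, hc⟩ := mainLoop_exec hn (B := 1000 * n) (d := 1000 * n)
    (E := advanceTime n + (4 + (n * (wc seedBody + 4) + 4) + 2)) (by omega) (by omega)
    (by
      have e1 : wc neckInit = 17 ∧ wc neckBody = 36 ∧ wc specialInit = 12 ∧ wc specialBody = 23 ∧
          wc testEnd = 36 ∧ wc buildInit = 15 ∧ wc buildBody = 34 ∧ wc buildEnd = 6 :=
        ⟨rfl, rfl, rfl, rfl, rfl, rfl, rfl, rfl⟩
      have e2 : wc firstInit = 4 ∧ wc secondInit = 14 ∧ wc succEnd = 27 ∧ wc shiftBody = 10 ∧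
          wc storeBit = 7 ∧ wc cmpBody = 12 ∧ wc seedBody = 18 := ⟨rfl, rfl, rfl, rfl, rfl, rfl, rfl⟩
      simp only [succTime, testTime, advanceTime, e1, e2]
      omega) (2 ^ n) 0 s₁ 0 (by omega) hH₁
    (iff_of_true hg₁ (by positivity)) (by simp only [State.init] at ht₁; omega)
  refine ⟨s₂, .seq _ _ _ _ _ hs₁ hs₂, ?_, ?_⟩
  · rw [ho₂, ho₁, State.init, List.nil_append, hl, ← seqX_eq_preferSame hn, seqX_eq hn]
    rfl
  · rw [ho₂, ho₁]
    exact hc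

end Ram

end PrefSame

theorem mainTheorem1 :
    (∀ n : ℕ, 2 ≤ n →
      PrefSame.IsDeBruijn n (PrefSame.seqX n) ∧
        PrefSame.seqX n = PrefSame.preferSame n) ∧
    (∃ (P : PrefSame.Ram.Cmd) (C : ℕ), ∀ n : ℕ, 2 ≤ n →
      PrefSame.Ram.Generates P n (C * n) (C * n) (PrefSame.preferSame n)) :=
  ⟨fun _ hn => ⟨PrefSame.isDeBruijn_seqX hn, PrefSame.seqX_eq_preferSame hn⟩,
    PrefSame.Ram.generates_preferSame⟩
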